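/- Conventions. Let $K$ be a commutative ring with unity and let $(M_0,q_0)$ be a quadratic $K$-module, where $M_0$ is finitely generated projective of constant odd rank $n=2\nu+1\ge 1$. Write $b_{q_0}(u,v)=q_0(u+v)-q_0(u)-q_0(v)$. Let $P_n\in\mathbb Z[\xi_i,\xi_{ij}]$ be half the determinant of the symmetric $n\times n$ matrix with diagonal entries $2\xi_i$ and off-diagonal entries $\xi_{ij}=\xi_{ji}$. Assume that $q_0$ is semiregular: the elements $P_n(q_0(u_i),b_{q_0}(u_i,u_j))$, for $u_1,\dots,u_n\in M_0$, generate the unit ideal of $K$. Let $M=e_{-2}K\oplus e_{-1}K\oplus M_0\oplus e_1K\oplus e_2K$ with $q(x_{-2},x_{-1},u_0,x_1,x_2)=q_0(u_0)+x_{-1}x_1+x_{-2}x_2$. Let $\mathrm O(M,q)$ be the group of $K$-linear automorphisms of $M$ preserving $q$, and let $\mathrm{SO}(M,q)$ be its subgroup of those $\phi$ whose localization at every maximal ideal of $K$ has determinant one. Put $\mu_2(K)=\{\omega\in K:\omega^2=1\}$. Write $e_{ij}$ for the matrix units with respect to this decomposition. For $i,j\in\{\pm1,\pm2\}$, $y\in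 K$ and $u\in M_0$ put $T_{ij}(y)=1+e_{ij}y-e_{-j,-i}y$ (when $i\ne\pm j$) and $T_i(u)=1+e_{0,i}u-e_{-i,0}\,b_{q_0}(u,\cdot)-e_{-i,i}q_0(u)$. These lie in $\mathrm O(M,q)$, and $\mathrm{EO}(M,q)$ is the subgroup that they generate. A pair $(N_0,I)$ of a submodule $N_0\le M_0$ and an ideal $I\trianglelefteqslant K$ is admissible if $M_0I\le N_0$ and $b_{q_0}(M_0,N_0)+q_0(N_0)\subset I$. For such a pair put $N=e_{-2}I\oplus e_{-1}I\oplus N_0\oplus e_1I\oplus e_2I$ and $$\mathrm O(M,q,N_0,I)=\{\phi\in\mathrm O(M,q):\phi(v)\equiv v\ (\mathrm{mod}\ N)\text{ for all }v\in M\},\qquad \mathrm{SO}(M,q,N_0,I)=\mathrm{SO}(M,q)\cap\mathrm O(M,q,N_0,I).$$ Let $\mathrm{EO}(M,q,N_0,I)$ be the subgroup generated by all $\mathrm{EO}(M,q)$-conjugates of the elements $T_{ij}(y)$, $T_i(u)$ with $y\in I$, $u\in N_0$. The quotient $M/N$ is a $K/I$-module, and $q$ induces on it a quadratic form $q_{M/N}:M/N\to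 K/I$. For subgroups $A,B$ of a group $G$ put $\mathrm{Trans}_G(A,B)=\{\phi\in G:[\phi,A]\le B\}$, where $[\phi,A]$ is the subgroup generated by the elements $\phi a\phi^{-1}a^{-1}$, $a\in A$. Proposition. Let $(N_0,I)$ be an admissible pair. Every $\phi\in\mathrm O(M,q)$ induces an automorphism $\rho_N(\phi)$ of $M/N$, which gives a group homomorphism $\rho_N:\mathrm O(M,q)\to\mathrm O(M/N,q_{M/N})$, and $$\rho_N^{-1}\bigl(\mu_2(K/I)\cdot\mathrm{id}\bigr)=\mathrm{Trans}_{\mathrm O(M,q)}\bigl(\mathrm{EO}(M,q),\mathrm O(M,q,N_0,I)\bigr)=\mathrm{Trans}_{\mathrm O(M,q)}\bigl(\mathrm O(M,q),\mathrm O(M,q,N_0,I)\bigr)=\mathrm{Trans}_{\mathrm O(M,q)}\bigl(\mathrm{EO}(M,q),\mathrm{EO}(M,q,N_0,I)\bigr).$$ If moreover $N_0=M_0I$, then $\rho_N^{-1}(\mu_2(K/I)\cdot\mathrm{id})=\mu_2(K)\times\mathrm{SO}(M,q,N_0,I)$, as an internal direct product: the map $(\omega,\sigma)\mapsto\omega\sigma$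 is a group isomorphism from $\mu_2(K)\times\mathrm{SO}(M,q,N_0,I)$ onto $\rho_N^{-1}(\mu_2(K/I)\cdot\mathrm{id})$. -/

import Mathlib

namespace OddOrthogonal

open scoped TensorProduct

/-! ### Orthogonal groups -/

/-- The orthogonal group `O(M, q)`: the `K`-linear automorphisms of `M` that preserve `q`. -/
def orthogonalGroup {K M : Type*} [CommRing K] [AddCommGroup M] [Module K M]
    (q : QuadraticForm K M) : Subgroup (M ≃ₗ[K] M) where
  carrier := {φ | ∀ x, q (φ x) = q x}
  mul_mem' {a b} ha hb x := (ha (b x)).trans (hb x)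
  one_mem' _ := rfl
  inv_mem' {a} ha x := by
    have h := ha (a.symm x)
    rw [LinearEquiv.apply_symm_apply] at h
    exact h.symm

/-- The special orthogonal group `SO(M, q)` of a finitely generated projective module `M`: those
`φ ∈ O(M, q)` whose localization at every maximal ideal (an automorphism of a free module of finite
rank) has determinant one. -/
def specialOrthogonalGroup {K M : Type*} [CommRing K] [AddCommGroup M] [Module K M]
    (q : QuadraticForm K M) : Subgroup (orthogonalGroup q) where
  carrier := {φ | ∀ (m : Ideal K) [m.IsMaximal],
    LinearMap.det (((φ : M ≃ₗ[K] M) : M →ₗ[K] M).baseChange (Localization.AtPrime m)) = 1}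
  mul_mem' {a b} ha hb m _ := by
    have h : (((a * b : orthogonalGroup q) : M ≃ₗ[K] M) : M →ₗ[K] M) =
      ((a : M ≃ₗ[K] M) : M →ₗ[K] M) ∘ₗ ((b : M ≃ₗ[K] M) : M →ₗ[K] M) := rfl
    rw [h, LinearMap.baseChange_comp, LinearMap.det_comp, ha m, hb m, one_mul]
  one_mem' m _ := by
    have h : (((1 : orthogonalGroup q) : M ≃ₗ[K] M) : M →ₗ[K] M) = LinearMap.id := rfl
    rw [h, LinearMap.baseChange_id, LinearMap.det_id]
  inv_mem' {a} ha m _ := by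
    have h : ((a : M ≃ₗ[K] M) : M →ₗ[K] M) ∘ₗ
        (((a⁻¹ : orthogonalGroup q) : M ≃ₗ[K] M) : M →ₗ[K] M) = LinearMap.id :=
      LinearMap.ext fun x => LinearEquiv.apply_symm_apply (a : M ≃ₗ[K] M) x
    have h2 := congrArg (fun f => LinearMap.det (f.baseChange (Localization.AtPrime m))) h
    simp only [LinearMap.baseChange_comp, LinearMap.det_comp, LinearMap.baseChange_id,
      LinearMap.det_id] at h2
    rw [ha m, one_mul] at h2
    exact h2

/-- The homomorphism `μ₂(K) → O(M, q)`, `ω ↦ ω · id`. -/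
def scalarHom {K M : Type*} [CommRing K] [AddCommGroup M] [Module K M]
    (q : QuadraticForm K M) : rootsOfUnity 2 K →* orthogonalGroup q where
  toFun ω := ⟨LinearEquiv.smulOfUnit (ω : Kˣ), fun x => by
    have h : ((ω : Kˣ) : K) * ((ω : Kˣ) : K) = 1 := by
      rw [← sq, ← Units.val_pow_eq_pow_val, (mem_rootsOfUnity 2 (ω : Kˣ)).1 ω.2, Units.val_one]
    change q (((ω : Kˣ) : K) • x) = q x
    rw [QuadraticMap.map_smul, h, one_smul]⟩
  map_one' := by
    ext x
    exact one_smul K x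
  map_mul' a b := by
    ext x
    exact mul_smul ((a : Kˣ) : K) ((b : Kˣ) : K) x

/-- The subgroup `μ₂(K) · id` of `O(M, q)`. -/
def scalars {K M : Type*} [CommRing K] [AddCommGroup M] [Module K M]
    (q : QuadraticForm K M) : Subgroup (orthogonalGroup q) :=
  (scalarHom q).range

/-- The transporter `Trans_G(A, B) = {φ ∈ G | [φ, A] ≤ B}`, where
`[φ, A]` is the subgroup generated by all
`[φ, a] = φ a φ⁻¹ a⁻¹`, `a ∈ A`. -/
def transporter {G : Type*} [Group G] (A B : Subgroup G) : Set G :=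
  {φ | Subgroup.closure ((fun a => φ * a * φ⁻¹ * a⁻¹) '' (A : Set G)) ≤ B}

/-! ### Semiregular quadratic forms of odd rank -/

/-- The symmetric matrix `Ξ` with entries `2 ξ_i` on the diagonal and `ξ_{ij} = ξ_{ji}` off the
diagonal. The variable `ξ_i` is indexed by the diagonal pair `s(i, i)`. -/
noncomputable def genericGram (n : ℕ) :
    Matrix (Fin n) (Fin n) (MvPolynomial (Sym2 (Fin n)) ℤ) :=
  Matrix.of fun i j =>
    if i = j then 2 * MvPolynomial.X s(i, i) else MvPolynomial.X s(i, j)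

theorem det_eq_zero_of_charTwo {R : Type*} [CommRing R] [CharP R 2] {n : ℕ} (hn : Odd n)
    (A : Matrix (Fin n) (Fin n) R) (hs : ∀ i j, A i j = A j i) (hd : ∀ i, A i i = 0) :
    A.det = 0 := by
  rw [Matrix.det_apply']
  refine Finset.sum_involution (fun σ _ => σ⁻¹) ?_ ?_ (fun _ _ => Finset.mem_univ _)
    (fun _ _ => inv_inv _)
  · intro σ _
    have h : ∏ i, A (σ⁻¹ i) i = ∏ i, A (σ i) i := by
      rw [← Equiv.prod_comp σ]
      exact Finset.prod_congr rfl fun i _ => by rw [Equiv.Perm.inv_def, Equiv.symm_apply_apply, hs]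
    rw [h, Equiv.Perm.sign_inv]
    exact CharTwo.add_self_eq_zero _
  · intro σ _ hne heq
    apply hne
    have hfix : ∃ i, σ i = i := by
      by_contra hcon
      have h1 := Equiv.Perm.card_fixedPoints_modEq (f := (σ : Fin n → Fin n)) (p := 2) (n := 1)
        (by
          funext x
          change σ (σ x) = x
          have h4 := congrArg (fun τ : Equiv.Perm (Fin n) => τ (σ x)) heq
          simpa using h4.symm)
      have h2 : Fintype.card (Function.fixedPoints (σ : Fin n → Fin n)) = 0 := by
        rw [Fintype.card_eq_zero_iff]
        exact ⟨fun x => hcon ⟨x.1, x.2⟩⟩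
      rw [h2, Fintype.card_fin] at h1
      have h3 := Nat.odd_iff.1 hn
      unfold Nat.ModEq at h1
      omega
    obtain ⟨i, hi⟩ := hfix
    rw [Finset.prod_eq_zero (Finset.mem_univ i) (by rw [hi, hd]), mul_zero]

theorem two_dvd_det_genericGram (ν : ℕ) :
    (2 : MvPolynomial (Sym2 (Fin (2 * ν + 1))) ℤ) ∣ (genericGram (2 * ν + 1)).det := by
  have h := (MvPolynomial.C_dvd_iff_zmod 2 (genericGram (2 * ν + 1)).det).2 (by
    rw [RingHom.map_det]
    refine det_eq_zero_of_charTwo ⟨ν, rfl⟩ _ (fun i j => ?_) (fun i => ?_)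
    · simp only [RingHom.mapMatrix_apply, Matrix.map_apply, genericGram, Matrix.of_apply]
      by_cases hij : i = j
      · subst hij; rfl
      · rw [if_neg hij, if_neg (Ne.symm hij), Sym2.eq_swap]
    · simp only [RingHom.mapMatrix_apply, Matrix.map_apply, genericGram, Matrix.of_apply,
        if_true, map_mul, map_ofNat]
      exact mul_eq_zero_of_left CharTwo.two_eq_zero _)
  simpa using h

/-- The semidiscriminant polynomial `P_n = det(Ξ) / 2` with integer coefficients, for
`n = 2ν + 1`. -/
noncomputable def halfDet (ν : ℕ) : MvPolynomial (Sym2 (Fin (2 * ν + 1))) ℤ :=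
  (two_dvd_det_genericGram ν).choose

theorem two_mul_halfDet (ν : ℕ) : 2 * halfDet ν = (genericGram (2 * ν + 1)).det :=
  (two_dvd_det_genericGram ν).choose_spec.symm

/-- The substitution `ξ_i ↦ q(u_i)`, `ξ_{ij} ↦ b_q(u_i, u_j)`. -/
def gramValue {K M : Type*} [CommRing K] [AddCommGroup M] [Module K M]
    (q : QuadraticForm K M) {n : ℕ} (u : Fin n → M) : Sym2 (Fin n) → K :=
  Sym2.lift ⟨fun i j => if i = j then q (u i) else QuadraticMap.polar q (u i) (u j), by
    intro i j
    by_cases h : i = j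
    · subst h; rfl
    · simp only [if_neg h, if_neg (Ne.symm h), QuadraticMap.polar_comm]⟩

/-- A quadratic form on a module of rank `2ν + 1` is semiregular if the values of `P_{2ν+1}` on all
families of `2ν + 1` vectors generate the unit ideal. -/
def IsSemiregular {K M : Type*} [CommRing K] [AddCommGroup M] [Module K M] (ν : ℕ)
    (q : QuadraticForm K M) : Prop :=
  Ideal.span (Set.range fun u : Fin (2 * ν + 1) → M =>
    MvPolynomial.aeval (gramValue q u) (halfDet ν)) = ⊤

/-! ### The quadratic module of Witt index at least two -/

/-- The index set `{-2, -1, 1, 2}` of the hyperbolic coordinates. -/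
inductive Idx : Type
  | m2 | m1 | p1 | p2
  deriving DecidableEq

instance : Fintype Idx :=
  ⟨{.m2, .m1, .p1, .p2}, by intro x; cases x <;> simp⟩

instance : Neg Idx :=
  ⟨fun i => match i with
    | .m2 => .p2
    | .m1 => .p1
    | .p1 => .m1
    | .p2 => .m2⟩

/-- `M = e₋₂K ⊕ e₋₁K ⊕ M₀ ⊕ e₁K ⊕ e₂K`. -/
abbrev WittModule (K M₀ : Type*) : Type _ := (Idx → K) × M₀

section Witt

variable {K M₀ : Type*} [CommRing K] [AddCommGroup M₀] [Module K M₀]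

/-- The form `q(x₋₂, x₋₁, u₀, x₁, x₂) = q₀(u₀) + x₋₁x₁ + x₋₂x₂`. -/
def wittForm (q₀ : QuadraticForm K M₀) : QuadraticForm K (WittModule K M₀) :=
  q₀.comp (LinearMap.snd K (Idx → K) M₀) +
    QuadraticMap.linMulLin (LinearMap.proj Idx.m1 ∘ₗ LinearMap.fst K (Idx → K) M₀)
      (LinearMap.proj Idx.p1 ∘ₗ LinearMap.fst K (Idx → K) M₀) +
    QuadraticMap.linMulLin (LinearMap.proj Idx.m2 ∘ₗ LinearMap.fst K (Idx → K) M₀)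
      (LinearMap.proj Idx.p2 ∘ₗ LinearMap.fst K (Idx → K) M₀)

theorem wittForm_apply (q₀ : QuadraticForm K M₀) (x : Idx → K) (u : M₀) :
    wittForm q₀ (x, u) = q₀ u + x .m1 * x .p1 + x .m2 * x .p2 := rfl

/-- The endomorphism `1 + e_{ij} y - e_{-j,-i} y`. -/
def longMap (i j : Idx) (y : K) : WittModule K M₀ →ₗ[K] WittModule K M₀ where
  toFun v := (v.1 + Pi.single i (y * v.1 j) - Pi.single (-j) (y * v.1 (-i)), v.2)
  map_add' v w := by
    ext k
    · simp only [Prod.fst_add, Pi.add_apply, Pi.sub_apply, mul_add, Pi.single_add]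
      ring
    · rfl
  map_smul' a v := by
    ext k
    · simp only [Prod.smul_fst, Pi.add_apply, Pi.sub_apply, Pi.smul_apply, smul_eq_mul,
        RingHom.id_apply, Pi.single_apply]
      split_ifs <;> ring
    · rfl

/-- The endomorphism `1 + e_{0,i} u - e_{-i,0} u^* - e_{-i,i} q₀(u)`, where
`u^* = b_{q₀}(u, _)`. -/
def shortMap (q₀ : QuadraticForm K M₀) (i : Idx) (u : M₀) :
    WittModule K M₀ →ₗ[K] WittModule K M₀ where
  toFun v := (v.1 - Pi.single (-i) (QuadraticMap.polar q₀ u v.2) -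
    Pi.single (-i) (q₀ u * v.1 i), v.2 + v.1 i • u)
  map_add' v w := by
    ext k
    · simp only [Prod.fst_add, Prod.snd_add, Pi.add_apply, Pi.sub_apply,
        QuadraticMap.polar_add_right, mul_add, Pi.single_add]
      ring
    · simp only [Prod.snd_add, Prod.fst_add, Pi.add_apply, add_smul]
      abel
  map_smul' a v := by
    ext k
    · simp only [Prod.smul_fst, Prod.smul_snd, Pi.sub_apply, Pi.smul_apply, smul_eq_mul,
        RingHom.id_apply, QuadraticMap.polar_smul_right, Pi.single_apply]
      split_ifs <;> ring
    · simp only [Prod.smul_fst, Prod.smul_snd, Pi.smul_apply, smul_eq_mul, RingHom.id_apply,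
        smul_add, mul_smul]

theorem wittForm_longMap (q₀ : QuadraticForm K M₀) {i j : Idx} (h : i ≠ j ∧ i ≠ -j) (y : K)
    (v : WittModule K M₀) : wittForm q₀ (longMap i j y v) = wittForm q₀ v := by
  obtain ⟨x, w⟩ := v
  obtain ⟨h1, h2⟩ := h
  change wittForm q₀ (_, _) = wittForm q₀ (_, _)
  rw [wittForm_apply, wittForm_apply]
  cases i <;> cases j <;> first | exact absurd rfl h1 | exact absurd rfl h2 |
    (simp [Neg.neg]; ring)

theorem longMap_longMap_neg {i j : Idx} (h : i ≠ j ∧ i ≠ -j) (y : K) (v : WittModule K M₀) :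
    longMap i j y (longMap i j (-y) v) = v := by
  obtain ⟨x, w⟩ := v
  obtain ⟨h1, h2⟩ := h
  ext k
  · cases i <;> cases j <;> first | exact absurd rfl h1 | exact absurd rfl h2 |
      (cases k <;> simp [longMap, Neg.neg])
  · rfl

theorem wittForm_shortMap (q₀ : QuadraticForm K M₀) (i : Idx) (u : M₀)
    (v : WittModule K M₀) : wittForm q₀ (shortMap q₀ i u v) = wittForm q₀ v := by
  obtain ⟨x, w⟩ := v
  change wittForm q₀ (_, _) = wittForm q₀ (_, _)
  have h : ∀ a : K, q₀ (w + a • u) = q₀ w + a * a * q₀ u + a * QuadraticMap.polar q₀ u w := by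
    intro a
    rw [QuadraticMap.map_add (⇑q₀), QuadraticMap.map_smul, QuadraticMap.polar_smul_right,
      QuadraticMap.polar_comm, smul_eq_mul, smul_eq_mul]
  rw [wittForm_apply, wittForm_apply]
  cases i <;> (simp [Neg.neg, h]; ring)

theorem shortMap_shortMap_neg (q₀ : QuadraticForm K M₀) (i : Idx) (u : M₀)
    (v : WittModule K M₀) : shortMap q₀ i u (shortMap q₀ i (-u) v) = v := by
  obtain ⟨x, w⟩ := v
  have h : QuadraticMap.polar q₀ u u = 2 * q₀ u := by
    rw [QuadraticMap.polar_self, two_nsmul, two_mul]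
  ext k
  · cases i <;> cases k <;>
      (simp [shortMap, Neg.neg, QuadraticMap.polar_neg_left, h,
        QuadraticMap.polar_smul_right]; try ring)
  · cases i <;> simp [shortMap, Neg.neg]

/-- The elementary transvection `T_{ij}(y) ∈ O(M, q)`, for `i ≠ ±j`. -/
def longT (q₀ : QuadraticForm K M₀) (i j : Idx) (h : i ≠ j ∧ i ≠ -j) (y : K) :
    orthogonalGroup (wittForm q₀) :=
  ⟨{ longMap i j y with
      invFun := longMap i j (-y)
      left_inv := fun v => by
        have h' := longMap_longMap_neg h (-y) v
        rwa [neg_neg] at h'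
      right_inv := longMap_longMap_neg h y },
    wittForm_longMap q₀ h y⟩

/-- The elementary transvection `T_i(u) ∈ O(M, q)`. -/
def shortT (q₀ : QuadraticForm K M₀) (i : Idx) (u : M₀) : orthogonalGroup (wittForm q₀) :=
  ⟨{ shortMap q₀ i u with
      invFun := shortMap q₀ i (-u)
      left_inv := fun v => by
        have h' := shortMap_shortMap_neg q₀ i (-u) v
        rwa [neg_neg] at h'
      right_inv := shortMap_shortMap_neg q₀ i u },
    wittForm_shortMap q₀ i u⟩

/-- The elementary transvections `T_{ij}(y)`, `T_i(u)` with `y ∈ I` and `u ∈ N₀`. -/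
def transvections (q₀ : QuadraticForm K M₀) (N₀ : Submodule K M₀) (I : Ideal K) :
    Set (orthogonalGroup (wittForm q₀)) :=
  {g | (∃ (i j : Idx) (h : i ≠ j ∧ i ≠ -j), ∃ y ∈ I, g = longT q₀ i j h y) ∨
    ∃ (i : Idx), ∃ u ∈ N₀, g = shortT q₀ i u}

/-- The elementary subgroup `EO(M, q)`, generated by all elementary transvections. -/
def elementaryGroup (q₀ : QuadraticForm K M₀) : Subgroup (orthogonalGroup (wittForm q₀)) :=
  Subgroup.closure (transvections q₀ ⊤ ⊤)

/-! ### Admissible pairs and relative subgroups -/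

/-- An admissible pair `(N₀, I)`: a submodule `N₀ ≤ M₀` and an ideal `I` of `K` such that
`M₀ I ≤ N₀` and `b_{q₀}(M₀, N₀) + q₀(N₀) ⊆ I`. -/
structure AdmissiblePair (q₀ : QuadraticForm K M₀) where
  /-- The submodule `N₀`. -/
  N₀ : Submodule K M₀
  /-- The ideal `I`. -/
  I : Ideal K
  smul_top_le : I • (⊤ : Submodule K M₀) ≤ N₀
  polar_mem : ∀ (u : M₀), ∀ v ∈ N₀, QuadraticMap.polar q₀ u v ∈ I
  form_mem : ∀ v ∈ N₀, q₀ v ∈ I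

namespace AdmissiblePair

variable {q₀ : QuadraticForm K M₀} (P : AdmissiblePair q₀)

/-- `N = e₋₂I ⊕ e₋₁I ⊕ N₀ ⊕ e₁I ⊕ e₂I`. -/
def N : Submodule K (WittModule K M₀) where
  carrier := {v | (∀ i, v.1 i ∈ P.I) ∧ v.2 ∈ P.N₀}
  add_mem' ha hb := ⟨fun i => P.I.add_mem (ha.1 i) (hb.1 i), P.N₀.add_mem ha.2 hb.2⟩
  zero_mem' := ⟨fun _ => P.I.zero_mem, P.N₀.zero_mem⟩
  smul_mem' c _ ha := ⟨fun i => P.I.mul_mem_left c (ha.1 i), P.N₀.smul_mem c ha.2⟩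

/-- The relative orthogonal group `O(M, q, N₀, I)`: all `φ ∈ O(M, q)` with `φ(v) ≡ v` modulo `N`
for every `v ∈ M`. -/
def relOrthogonal : Subgroup (orthogonalGroup (wittForm q₀)) where
  carrier := {φ | ∀ v, (φ : WittModule K M₀ ≃ₗ[K] WittModule K M₀) v - v ∈ P.N}
  mul_mem' {a b} ha hb v := by
    have h := P.N.add_mem (ha ((b : WittModule K M₀ ≃ₗ[K] WittModule K M₀) v)) (hb v)
    rwa [sub_add_sub_cancel] at h
  one_mem' v := by
    have h : ((1 : orthogonalGroup (wittForm q₀)) : WittModule K M₀ ≃ₗ[K] WittModule K M₀) v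
        = v := rfl
    rw [h, sub_self]
    exact P.N.zero_mem
  inv_mem' {a} ha v := by
    have h := P.N.neg_mem (ha ((a : WittModule K M₀ ≃ₗ[K] WittModule K M₀).symm v))
    rwa [LinearEquiv.apply_symm_apply, neg_sub] at h

/-- `SO(M, q, N₀, I) = SO(M, q) ∩ O(M, q, N₀, I)`. -/
def relSpecialOrthogonal : Subgroup (orthogonalGroup (wittForm q₀)) :=
  specialOrthogonalGroup (wittForm q₀) ⊓ P.relOrthogonal

/-- The relative elementary group `EO(M, q, N₀, I)`: the subgroup generated by the
`EO(M, q)`-conjugates of the elementary transvections `T_{ij}(y)`, `T_i(u)` with `y ∈ I`,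
`u ∈ N₀`. -/
def relElementary : Subgroup (orthogonalGroup (wittForm q₀)) :=
  Subgroup.closure {z | ∃ g ∈ elementaryGroup q₀, ∃ x ∈ transvections q₀ P.N₀ P.I,
    z = g * x * g⁻¹}

/-! ### The quotient quadratic module `(M/N, q_{M/N})` over `K/I` -/

/-- The quotient module `M/N`. -/
def Quot : Type _ := WittModule K M₀ ⧸ P.N

instance : AddCommGroup P.Quot := inferInstanceAs (AddCommGroup (WittModule K M₀ ⧸ P.N))

instance : Module K P.Quot := inferInstanceAs (Module K (WittModule K M₀ ⧸ P.N))

/-- The projection `M → M/N`. -/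
def proj : WittModule K M₀ →ₗ[K] P.Quot := P.N.mkQ

theorem proj_surjective : Function.Surjective P.proj := P.N.mkQ_surjective

theorem proj_eq_iff {v w : WittModule K M₀} : P.proj v = P.proj w ↔ v - w ∈ P.N :=
  Submodule.Quotient.eq P.N

theorem smul_mem {a : K} (ha : a ∈ P.I) (v : WittModule K M₀) : a • v ∈ P.N :=
  ⟨fun i => P.I.mul_mem_right (v.1 i) ha,
    P.smul_top_le (Submodule.smul_mem_smul ha Submodule.mem_top)⟩

theorem isTorsionBySet : Module.IsTorsionBySet K P.Quot P.I := by
  intro x a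
  obtain ⟨v, rfl⟩ := P.proj_surjective x
  change P.proj ((a : K) • v) = 0
  rw [← map_zero P.proj, proj_eq_iff, sub_zero]
  exact P.smul_mem a.2 v

/-- The `K/I`-module structure of `M/N`. -/
instance : Module (K ⧸ P.I) P.Quot := P.isTorsionBySet.module

theorem mk_smul_proj (a : K) (v : WittModule K M₀) :
    Ideal.Quotient.mk P.I a • P.proj v = P.proj (a • v) := rfl

theorem wittForm_sub_mem {v w : WittModule K M₀} (h : v - w ∈ P.N) :
    wittForm q₀ v - wittForm q₀ w ∈ P.I := by
  obtain ⟨x, a⟩ := v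
  obtain ⟨y, b⟩ := w
  obtain ⟨h1, h2⟩ := h
  have h1' : ∀ i, x i - y i ∈ P.I := h1
  have h2' : a - b ∈ P.N₀ := h2
  have h3 : q₀ a - q₀ b ∈ P.I := by
    have h4 := QuadraticMap.map_add (⇑q₀) b (a - b)
    rw [add_sub_cancel] at h4
    rw [h4, add_assoc, add_sub_cancel_left]
    exact P.I.add_mem (P.form_mem _ h2') (P.polar_mem _ _ h2')
  have h5 : ∀ i j, x i * x j - y i * y j ∈ P.I := by
    intro i j
    have h6 : x i * x j - y i * y j = (x i - y i) * x j + y i * (x j - y j) := by ring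
    rw [h6]
    exact P.I.add_mem (P.I.mul_mem_right _ (h1' i)) (P.I.mul_mem_left _ (h1' j))
  have h7 : wittForm q₀ (x, a) - wittForm q₀ (y, b) = (q₀ a - q₀ b) +
      (x .m1 * x .p1 - y .m1 * y .p1) + (x .m2 * x .p2 - y .m2 * y .p2) := by
    rw [wittForm_apply, wittForm_apply]
    ring
  rw [h7]
  exact P.I.add_mem (P.I.add_mem h3 (h5 _ _)) (h5 _ _)

/-- The map `M/N → K/I` induced by `q`. -/
def quotFun : P.Quot → K ⧸ P.I :=
  Quotient.lift (fun v => Ideal.Quotient.mk P.I (wittForm q₀ v)) fun _ _ h =>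
    Ideal.Quotient.eq.2 (P.wittForm_sub_mem ((Submodule.quotientRel_def P.N).1 h))

theorem quotFun_proj (v : WittModule K M₀) :
    P.quotFun (P.proj v) = Ideal.Quotient.mk P.I (wittForm q₀ v) := rfl

theorem polar_quotFun_proj (v w : WittModule K M₀) :
    QuadraticMap.polar P.quotFun (P.proj v) (P.proj w) =
      Ideal.Quotient.mk P.I (QuadraticMap.polar (wittForm q₀) v w) := by
  simp only [QuadraticMap.polar, ← map_add, quotFun_proj, map_sub]

/-- The quadratic form `q_{M/N} : M/N → K/I` induced by `q`. -/
def quotForm : QuadraticForm (K ⧸ P.I) P.Quot :=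
  QuadraticMap.ofPolar P.quotFun
    (fun a x => by
      obtain ⟨a, rfl⟩ := Ideal.Quotient.mk_surjective a
      obtain ⟨v, rfl⟩ := P.proj_surjective x
      rw [mk_smul_proj, quotFun_proj, quotFun_proj, QuadraticMap.map_smul, smul_eq_mul,
        smul_eq_mul, map_mul, map_mul])
    (fun x x' y => by
      obtain ⟨v, rfl⟩ := P.proj_surjective x
      obtain ⟨v', rfl⟩ := P.proj_surjective x'
      obtain ⟨w, rfl⟩ := P.proj_surjective y
      rw [← map_add, polar_quotFun_proj, polar_quotFun_proj, polar_quotFun_proj,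
        QuadraticMap.polar_add_left, map_add])
    (fun a x y => by
      obtain ⟨a, rfl⟩ := Ideal.Quotient.mk_surjective a
      obtain ⟨v, rfl⟩ := P.proj_surjective x
      obtain ⟨w, rfl⟩ := P.proj_surjective y
      rw [mk_smul_proj, polar_quotFun_proj, polar_quotFun_proj, QuadraticMap.polar_smul_left,
        smul_eq_mul, smul_eq_mul, map_mul])

theorem quotForm_proj (v : WittModule K M₀) :
    P.quotForm (P.proj v) = Ideal.Quotient.mk P.I (wittForm q₀ v) := rfl

end AdmissiblePair

end Witt

end OddOrthogonal

open OddOrthogonal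

/-! Write T(x, y) for the Eichler transvection of an isotropic x and a vector y orthogonal to x.
Elementary transvections have the form T(e_k, w), and φ T(x, y) φ⁻¹ = T(φx, φy), so conjugation
questions ask which T(x, y) are elementary. For isotropic v, every T(v, v_i³ w) with w orthogonal to
v is elementary (`eichlerMem_cube`); hence, if v pairs to 1 with some vector, all T(v, w) are
(`eichlerMem_of_unimodular`). This uses that the values of q₀ generate K, a consequence of
semiregularity.

The relative statements come from doubling. The absolute results apply to the fibre products K
×_{K/I} K and M₀ ×_{M₀/N₀} M₀, and an elementary automorphism over the double is a pair (g₁, g₂)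
with g₁g₂⁻¹ in EO(M, q, N₀, I) (`exists_pair`). Pairs (g, 1) give normality of EO(M, q, N₀, I) in
O(M, q). For φ scalar modulo N, pairs equal to (φgφ⁻¹, g) up to relative factors give [φ, g] ∈ EO(M,
q, N₀, I). Conversely, an isometry commuting modulo N with all elementary transvections is scalar
modulo N (`isScalarMod_of_commutator`). Hence the three transporters agree.

The map ρ_N exists because O(M, q) preserves N. Every vector of N is orthogonal to M modulo I. By
semiregularity in odd rank, such vectors are locally carried by a single vector modulo IM, so an
isometry sends each such x into Kx + IM (`orthogonal_apply_mem_of_radical`).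

For the product decomposition, the semidiscriminant of a family is multiplied by det² under a change
of family, so isometries have determinant of square one. As the rank is odd, ω · id has determinant
ω, and φ = det φ · (det φ · φ) splits off the scalar. If N = IM and φ ≡ a modulo N, then det φ ≡ aⁿ
≡ a modulo I, so the second factor is trivial modulo N. The identities for the half-determinant are
proved over ℤ[K], where 2 can be cancelled, and then specialized. -/

namespace OddOrthogonal

open scoped TensorProduct

/-! ### Eichler transvections -/

section Eichler

variable {K M : Type*} [CommRing K] [AddCommGroup M] [Module K M]

/-- The Eichler transvection
`p ↦ p + b(x, p) y - b(y, p) x - q(y) b(x, p) x`. -/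
def eichler (q : QuadraticForm K M) (x y p : M) : M :=
  p + QuadraticMap.polar q x p • y - QuadraticMap.polar q y p • x -
    (q y * QuadraticMap.polar q x p) • x

variable {q : QuadraticForm K M}

theorem polar_self_eq (q : QuadraticForm K M) (x : M) : QuadraticMap.polar q x x = 2 * q x := by
  rw [QuadraticMap.polar_self, two_nsmul, two_mul]

theorem eichler_add {x y y' : M} (hx : q x = 0) (hy : QuadraticMap.polar q x y = 0)
    (hy' : QuadraticMap.polar q x y' = 0) (p : M) :
    eichler q x y (eichler q x y' p) = eichler q x (y + y') p := by
  have h1 : QuadraticMap.polar q x x = 0 := by rw [polar_self_eq, hx, mul_zero]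
  have h2 : QuadraticMap.polar q y x = 0 := by rw [QuadraticMap.polar_comm, hy]
  have h3 : q (y + y') = q y + q y' + QuadraticMap.polar q y y' := QuadraticMap.map_add q y y'
  simp only [eichler, QuadraticMap.polar_add_right, QuadraticMap.polar_sub_right,
    QuadraticMap.polar_smul_right, QuadraticMap.polar_add_left, h1, h2, h3, hy', smul_eq_mul]
  module

/-- With both vectors isotropic the quadratic term vanishes and the rest is alternating in x and y.
This lets a complicated base vector trade places with a simple one. -/
theorem eichler_swap {x y : M} (hx : q x = 0) (hy : q y = 0) (p : M) :
    eichler q x y p = eichler q y (-x) p := by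
  simp only [eichler, hy, QuadraticMap.map_neg, hx, QuadraticMap.polar_neg_left]
  module

theorem eichler_smul_left (a : K) (x y p : M) : eichler q (a • x) y p = eichler q x (a • y) p := by
  simp only [eichler, QuadraticMap.polar_smul_left, QuadraticMap.map_smul, smul_eq_mul]
  module

theorem eichler_smul_self {x : M} (hx : q x = 0) (a : K) (p : M) : eichler q x (a • x) p = p := by
  simp only [eichler, QuadraticMap.polar_smul_left, QuadraticMap.map_smul, smul_eq_mul, hx]
  module

theorem eichler_zero (x p : M) : eichler q x 0 p = p := by
  simp [eichler]

/-- T is additive in its second argument but not in its first: the product T(x, u) T(x', u) contains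
a term with b(u, u) = 2 q(u) where a symmetric expression in x and x' is wanted. The alternating
discrepancy is exactly T(x', q(u) x). -/
theorem eichler_add_left {x x' u : M} (hx : q x = 0) (hx' : q x' = 0)
    (hxx' : QuadraticMap.polar q x x' = 0) (hu : QuadraticMap.polar q x u = 0)
    (hu' : QuadraticMap.polar q x' u = 0) (p : M) :
    eichler q x' (q u • x) (eichler q x u (eichler q x' u p)) = eichler q (x + x') u p := by
  have h1 : QuadraticMap.polar q x x = 0 := by rw [polar_self_eq, hx, mul_zero]
  have h2 : QuadraticMap.polar q x' x' = 0 := by rw [polar_self_eq, hx', mul_zero]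
  have h3 : QuadraticMap.polar q x' x = 0 := by rw [QuadraticMap.polar_comm, hxx']
  have h5 : QuadraticMap.polar q u x' = 0 := by rw [QuadraticMap.polar_comm, hu']
  simp only [eichler, QuadraticMap.polar_add_right, QuadraticMap.polar_sub_right,
    QuadraticMap.polar_smul_right, QuadraticMap.polar_add_left, QuadraticMap.polar_smul_left,
    h1, h2, h3, h5, hxx', hu, hu', polar_self_eq q u, smul_eq_mul, QuadraticMap.map_smul, hx]
  module

theorem polar_map_orthogonal (φ : orthogonalGroup q) (x y : M) :
    QuadraticMap.polar q ((φ : M ≃ₗ[K] M) x) ((φ : M ≃ₗ[K] M) y) = QuadraticMap.polar q x y := by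
  have h : ∀ z, q ((φ : M ≃ₗ[K] M) z) = q z := φ.2
  simp only [QuadraticMap.polar, ← map_add, h]

theorem map_eichler (φ : orthogonalGroup q) (x y p : M) :
    (φ : M ≃ₗ[K] M) (eichler q x y p) =
      eichler q ((φ : M ≃ₗ[K] M) x) ((φ : M ≃ₗ[K] M) y) ((φ : M ≃ₗ[K] M) p) := by
  have h : ∀ z, q ((φ : M ≃ₗ[K] M) z) = q z := φ.2
  simp only [eichler, polar_map_orthogonal, h, map_add, map_sub, map_smul]

theorem orthogonal_mul_apply (a b : orthogonalGroup q) (p : M) :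
    ((a * b : orthogonalGroup q) : M ≃ₗ[K] M) p = (a : M ≃ₗ[K] M) ((b : M ≃ₗ[K] M) p) := rfl

theorem orthogonal_one_apply (p : M) :
    ((1 : orthogonalGroup q) : M ≃ₗ[K] M) p = p := rfl

theorem orthogonal_apply_inv (a : orthogonalGroup q) (p : M) :
    (a : M ≃ₗ[K] M) (((a⁻¹ : orthogonalGroup q) : M ≃ₗ[K] M) p) = p := by
  rw [← orthogonal_mul_apply, mul_inv_cancel, orthogonal_one_apply]

theorem orthogonal_inv_apply (a : orthogonalGroup q) (p : M) :
    ((a⁻¹ : orthogonalGroup q) : M ≃ₗ[K] M) ((a : M ≃ₗ[K] M) p) = p := by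
  rw [← orthogonal_mul_apply, inv_mul_cancel, orthogonal_one_apply]

theorem orthogonal_ext {a b : orthogonalGroup q}
    (h : ∀ p, (a : M ≃ₗ[K] M) p = (b : M ≃ₗ[K] M) p) : a = b :=
  Subtype.ext (LinearEquiv.ext h)

/-- The Eichler transvection of an isotropic `x` and a vector `y` orthogonal to `x` lies in the
subgroup `E`. -/
def EichlerMem (E : Subgroup (orthogonalGroup q)) (x y : M) : Prop :=
  q x = 0 ∧ QuadraticMap.polar q x y = 0 ∧ ∃ g ∈ E, ∀ p, (g : M ≃ₗ[K] M) p = eichler q x y p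

namespace EichlerMem

variable {E : Subgroup (orthogonalGroup q)} {x y y' : M}

theorem add (h : EichlerMem E x y) (h' : EichlerMem E x y') : EichlerMem E x (y + y') := by
  obtain ⟨hx, hy, g, hg, hgp⟩ := h
  obtain ⟨_, hy', g', hg', hgp'⟩ := h'
  refine ⟨hx, by rw [QuadraticMap.polar_add_right, hy, hy', add_zero], g * g', E.mul_mem hg hg',
    fun p => ?_⟩
  rw [orthogonal_mul_apply, hgp', hgp, eichler_add hx hy hy']

theorem smul_self (E : Subgroup (orthogonalGroup q)) (hx : q x = 0) (a : K) :
    EichlerMem E x (a • x) :=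
  ⟨hx, by rw [QuadraticMap.polar_smul_right, polar_self_eq, hx, mul_zero, smul_zero], 1, E.one_mem,
    fun p => (eichler_smul_self hx a p).symm⟩

theorem zero (E : Subgroup (orthogonalGroup q)) (hx : q x = 0) : EichlerMem E x 0 := by
  have h := smul_self E hx 0
  rwa [zero_smul] at h

theorem neg (h : EichlerMem E x y) : EichlerMem E x (-y) := by
  obtain ⟨hx, hy, g, hg, hgp⟩ := h
  have hny : QuadraticMap.polar q x (-y) = 0 := by rw [QuadraticMap.polar_neg_right, hy, neg_zero]
  refine ⟨hx, hny, g⁻¹, E.inv_mem hg, fun p => ?_⟩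
  apply (g : M ≃ₗ[K] M).injective
  rw [orthogonal_apply_inv, hgp, eichler_add hx hy hny, add_neg_cancel, eichler_zero]

theorem sub (h : EichlerMem E x y) (h' : EichlerMem E x y') : EichlerMem E x (y - y') := by
  rw [sub_eq_add_neg]
  exact h.add h'.neg

theorem swap (h : EichlerMem E x y) (hy : q y = 0) : EichlerMem E y (-x) := by
  obtain ⟨hx, hxy, g, hg, hgp⟩ := h
  exact ⟨hy, by rw [QuadraticMap.polar_neg_right, QuadraticMap.polar_comm, hxy, neg_zero], g, hg,
    fun p => by rw [hgp, eichler_swap hx hy]⟩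

theorem swap' (h : EichlerMem E x y) (hy : q y = 0) : EichlerMem E y x := by
  have h2 := (h.swap hy).neg
  rwa [neg_neg] at h2

theorem smul_left {a : K} (hx : q x = 0) (h : EichlerMem E x (a • y)) :
    EichlerMem E (a • x) y := by
  obtain ⟨_, hxy, g, hg, hgp⟩ := h
  refine ⟨by rw [QuadraticMap.map_smul, hx, smul_zero], ?_, g, hg, fun p => ?_⟩
  · rw [QuadraticMap.polar_smul_left, ← QuadraticMap.polar_smul_right, hxy]
  · rw [hgp, eichler_smul_left]

theorem smul_right {a : K} (hx : q x = 0) (h : EichlerMem E (a • x) y) :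
    EichlerMem E x (a • y) := by
  obtain ⟨_, hxy, g, hg, hgp⟩ := h
  refine ⟨hx, ?_, g, hg, fun p => ?_⟩
  · rw [QuadraticMap.polar_smul_right, ← QuadraticMap.polar_smul_left, hxy]
  · rw [hgp, eichler_smul_left]

theorem conj (h : EichlerMem E x y) {f : orthogonalGroup q} (hf : f ∈ E) :
    EichlerMem E ((f : M ≃ₗ[K] M) x) ((f : M ≃ₗ[K] M) y) := by
  obtain ⟨hx, hxy, g, hg, hgp⟩ := h
  refine ⟨(f.2 x).trans hx, by rw [polar_map_orthogonal, hxy], f * g * f⁻¹,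
    E.mul_mem (E.mul_mem hf hg) (E.inv_mem hf), fun p => ?_⟩
  rw [orthogonal_mul_apply, orthogonal_mul_apply, hgp, map_eichler, orthogonal_apply_inv]

theorem add_left {x' : M} (h : EichlerMem E x y) (h' : EichlerMem E x' y)
    (h'' : EichlerMem E x' (q y • x)) (hxx' : QuadraticMap.polar q x x' = 0) :
    EichlerMem E (x + x') y := by
  obtain ⟨hx, hxy, g, hg, hgp⟩ := h
  obtain ⟨hx', hxy', g', hg', hgp'⟩ := h'
  obtain ⟨_, _, g'', hg'', hgp''⟩ := h''
  refine ⟨?_, by rw [QuadraticMap.polar_add_left, hxy, hxy', add_zero], g'' * (g * g'),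
    E.mul_mem hg'' (E.mul_mem hg hg'), fun p => ?_⟩
  · rw [QuadraticMap.map_add q x x', hx, hx', hxx', add_zero, add_zero]
  · rw [orthogonal_mul_apply, orthogonal_mul_apply, hgp', hgp, hgp'',
      eichler_add_left hx hx' hxx' hxy hxy']

end EichlerMem

end Eichler

/-! ### Eichler transvections of the Witt module -/

/-- The vector `e_i` of the Witt module. -/
def hyp (K M₀ : Type*) [CommRing K] [AddCommGroup M₀] (i : Idx) : WittModule K M₀ :=
  (Pi.single i 1, 0)

/-- The inclusion `M₀ → M`. -/
def aniso (K : Type*) {M₀ : Type*} [CommRing K] (u : M₀) : WittModule K M₀ :=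
  (0, u)

theorem hyp_fst_apply {K M₀ : Type*} [CommRing K] [AddCommGroup M₀] (i k : Idx) :
    (hyp K M₀ i).1 k = if k = i then 1 else 0 := by
  simp [hyp, Pi.single_apply]

section WittEichler

variable {K M₀ : Type*} [CommRing K] [AddCommGroup M₀] [Module K M₀] {q₀ : QuadraticForm K M₀}

theorem idx_neg_neg (i : Idx) : -(-i) = i := by cases i <;> rfl

theorem idx_indep_neg_left {i j : Idx} (h : i ≠ j ∧ i ≠ -j) : -i ≠ j ∧ -i ≠ -j := by
  revert h; cases i <;> cases j <;> decide

theorem idx_indep_neg_right {i j : Idx} (h : i ≠ j ∧ i ≠ -j) : i ≠ -j ∧ i ≠ -(-j) := by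
  revert h; cases i <;> cases j <;> decide

theorem idx_indep_symm {i j : Idx} (h : i ≠ j ∧ i ≠ -j) : j ≠ i ∧ j ≠ -i := by
  revert h; cases i <;> cases j <;> decide

theorem idx_exists_indep (i : Idx) : ∃ j : Idx, i ≠ j ∧ i ≠ -j := by
  cases i
  exacts [⟨.p1, by decide⟩, ⟨.p2, by decide⟩, ⟨.p2, by decide⟩, ⟨.p1, by decide⟩]

theorem polar_wittForm (v w : WittModule K M₀) :
    QuadraticMap.polar (wittForm q₀) v w = QuadraticMap.polar q₀ v.2 w.2 +
      (v.1 .m1 * w.1 .p1 + v.1 .p1 * w.1 .m1) + (v.1 .m2 * w.1 .p2 + v.1 .p2 * w.1 .m2) := by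
  obtain ⟨x, u⟩ := v
  obtain ⟨y, w⟩ := w
  simp only [QuadraticMap.polar, Prod.mk_add_mk, wittForm_apply, Pi.add_apply]
  ring

theorem polar_hyp_left (i : Idx) (w : WittModule K M₀) :
    QuadraticMap.polar (wittForm q₀) (hyp K M₀ i) w = w.1 (-i) := by
  rw [polar_wittForm]
  cases i <;> simp [hyp, Neg.neg]

theorem polar_hyp_right (i : Idx) (w : WittModule K M₀) :
    QuadraticMap.polar (wittForm q₀) w (hyp K M₀ i) = w.1 (-i) := by
  rw [QuadraticMap.polar_comm, polar_hyp_left]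

theorem polar_aniso_left (u : M₀) (w : WittModule K M₀) :
    QuadraticMap.polar (wittForm q₀) (aniso K u) w = QuadraticMap.polar q₀ u w.2 := by
  rw [polar_wittForm]
  simp [aniso]

theorem polar_aniso_right (u : M₀) (w : WittModule K M₀) :
    QuadraticMap.polar (wittForm q₀) w (aniso K u) = QuadraticMap.polar q₀ w.2 u := by
  rw [polar_wittForm]
  simp [aniso]

theorem wittForm_hyp (i : Idx) : wittForm q₀ (hyp K M₀ i) = 0 := by
  rw [hyp, wittForm_apply]
  cases i <;> simp

theorem wittForm_aniso (u : M₀) : wittForm q₀ (aniso K u) = q₀ u := by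
  rw [aniso, wittForm_apply]
  simp

theorem witt_decomp {i j : Idx} (h : i ≠ j ∧ i ≠ -j) (v : WittModule K M₀) :
    v = v.1 i • hyp K M₀ i + v.1 (-i) • hyp K M₀ (-i) + v.1 j • hyp K M₀ j +
      v.1 (-j) • hyp K M₀ (-j) + aniso K v.2 := by
  obtain ⟨h1, h2⟩ := h
  ext k
  · cases i <;> cases j <;> first | exact absurd rfl h1 | exact absurd rfl h2 |
      (cases k <;> simp [hyp, aniso, Neg.neg])
  · simp [hyp, aniso]

theorem longT_apply {i j : Idx} (h : i ≠ j ∧ i ≠ -j) (y : K) (p : WittModule K M₀) :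
    (longT q₀ i j h y : WittModule K M₀ ≃ₗ[K] WittModule K M₀) p =
      eichler (wittForm q₀) (hyp K M₀ (-j)) (y • hyp K M₀ i) p := by
  change longMap i j y p = _
  simp only [eichler, polar_hyp_left, QuadraticMap.polar_smul_left, QuadraticMap.map_smul,
    wittForm_hyp, idx_neg_neg]
  ext k
  · simp [longMap, hyp, Pi.single_apply]
    split_ifs <;> ring
  · simp [longMap, hyp]

theorem shortT_apply (i : Idx) (u : M₀) (p : WittModule K M₀) :
    (shortT q₀ i u : WittModule K M₀ ≃ₗ[K] WittModule K M₀) p =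
      eichler (wittForm q₀) (hyp K M₀ (-i)) (aniso K u) p := by
  change shortMap q₀ i u p = _
  simp only [eichler, polar_hyp_left, polar_aniso_left, wittForm_aniso, idx_neg_neg]
  ext k
  · simp [shortMap, hyp, aniso, Pi.single_apply]
  · simp [shortMap, hyp, aniso]

theorem longT_mem (i j : Idx) (h : i ≠ j ∧ i ≠ -j) (y : K) :
    longT q₀ i j h y ∈ elementaryGroup q₀ :=
  Subgroup.subset_closure (Or.inl ⟨i, j, h, y, Submodule.mem_top, rfl⟩)

theorem shortT_mem (i : Idx) (u : M₀) : shortT q₀ i u ∈ elementaryGroup q₀ :=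
  Subgroup.subset_closure (Or.inr ⟨i, u, Submodule.mem_top, rfl⟩)

theorem polar_hyp_hyp {i j : Idx} (h : i ≠ j ∧ i ≠ -j) :
    QuadraticMap.polar (wittForm q₀) (hyp K M₀ i) (hyp K M₀ j) = 0 := by
  rw [polar_hyp_left, hyp_fst_apply, if_neg (idx_indep_neg_left h).1]

theorem eichlerMem_hyp_hyp {i j : Idx} (h : i ≠ j ∧ i ≠ -j) (a : K) :
    EichlerMem (elementaryGroup q₀) (hyp K M₀ i) (a • hyp K M₀ j) := by
  have h' := idx_indep_symm (idx_indep_neg_left h)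
  refine ⟨wittForm_hyp i, ?_, longT q₀ j (-i) h' a, longT_mem _ _ _ _, fun p => ?_⟩
  · rw [QuadraticMap.polar_smul_right, polar_hyp_hyp h, smul_zero]
  · rw [longT_apply, idx_neg_neg]

theorem eichlerMem_hyp_aniso (i : Idx) (u : M₀) :
    EichlerMem (elementaryGroup q₀) (hyp K M₀ i) (aniso K u) := by
  refine ⟨wittForm_hyp i, ?_, shortT q₀ (-i) u, shortT_mem _ _, fun p => ?_⟩
  · rw [polar_hyp_left]; rfl
  · rw [shortT_apply, idx_neg_neg]

theorem smul_aniso (a : K) (u : M₀) : a • aniso K u = aniso K (a • u) := by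
  simp [aniso]

theorem eichlerMem_smul_hyp_aniso (i : Idx) (a : K) (u : M₀) :
    EichlerMem (elementaryGroup q₀) (a • hyp K M₀ i) (aniso K u) := by
  apply EichlerMem.smul_left (wittForm_hyp i)
  rw [smul_aniso]
  exact eichlerMem_hyp_aniso i _

theorem wittForm_plane {i j : Idx} (h : i ≠ j ∧ i ≠ -j) (a b : K) :
    wittForm q₀ (a • hyp K M₀ i + b • hyp K M₀ j) = 0 := by
  rw [QuadraticMap.map_add (wittForm q₀) (a • hyp K M₀ i), QuadraticMap.map_smul,
    QuadraticMap.map_smul, wittForm_hyp, wittForm_hyp, QuadraticMap.polar_smul_left,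
    QuadraticMap.polar_smul_right, polar_hyp_hyp h]
  simp

/-- Transvections along a totally isotropic coordinate plane. -/
theorem eichlerMem_plane_hyp {i j : Idx} (h : i ≠ j ∧ i ≠ -j) (a b c : K) :
    EichlerMem (elementaryGroup q₀) (a • hyp K M₀ i + b • hyp K M₀ j) (c • hyp K M₀ i) := by
  -- Both vectors are isotropic, so the standard vector e_i can be made the base vector; additivity
  -- in the second argument then finishes.
  refine EichlerMem.swap' ?_ (wittForm_plane h a b)
  apply EichlerMem.smul_left (wittForm_hyp i)
  rw [smul_add]
  refine EichlerMem.add ?_ ?_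
  · rw [smul_smul]; exact EichlerMem.smul_self _ (wittForm_hyp i) _
  · rw [smul_smul]; exact eichlerMem_hyp_hyp h _

theorem eichlerMem_plane_plane {i j : Idx} (h : i ≠ j ∧ i ≠ -j) (a b c d : K) :
    EichlerMem (elementaryGroup q₀) (a • hyp K M₀ i + b • hyp K M₀ j)
      (c • hyp K M₀ i + d • hyp K M₀ j) := by
  refine (eichlerMem_plane_hyp h a b c).add ?_
  rw [add_comm]
  exact eichlerMem_plane_hyp (idx_indep_symm h) b a d

theorem eichlerMem_plane_aniso {i j : Idx} (h : i ≠ j ∧ i ≠ -j) (a b : K) (u : M₀) :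
    EichlerMem (elementaryGroup q₀) (a • hyp K M₀ i + b • hyp K M₀ j) (aniso K u) := by
  refine EichlerMem.add_left (eichlerMem_smul_hyp_aniso i a u) (eichlerMem_smul_hyp_aniso j b u)
    ?_ ?_
  · apply EichlerMem.smul_left (wittForm_hyp j)
    rw [smul_smul, smul_smul]
    exact eichlerMem_hyp_hyp (idx_indep_symm h) _
  · rw [QuadraticMap.polar_smul_left, QuadraticMap.polar_smul_right, polar_hyp_hyp h]
    simp

/-- Here r and z are orthogonal but lie in complementary isotropic planes, so T(r, z) is not visibly
a product of generators. The transvection g = T(z, u) fixes r and moves b e_{-i} by a multiple of u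
and a multiple of q₀(u) z. Conjugating T(r, b e_{-i}) by g and removing the known factors isolates
T(r, b q₀(u) c z). The factor c is b(z, e_{-i}). -/
theorem eichlerMem_cross (hq : Ideal.span (Set.range q₀) = ⊤) {i j : Idx} (h : i ≠ j ∧ i ≠ -j)
    (c d a : K) :
    EichlerMem (elementaryGroup q₀) (c • hyp K M₀ j - d • hyp K M₀ (-i))
      ((a * c) • (c • hyp K M₀ i + d • hyp K M₀ (-j))) := by
  set r : WittModule K M₀ := c • hyp K M₀ j - d • hyp K M₀ (-i) with hr
  set z : WittModule K M₀ := c • hyp K M₀ i + d • hyp K M₀ (-j) with hz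
  have hji : j ≠ -i ∧ j ≠ -(-i) := idx_indep_neg_right (idx_indep_symm h)
  have hr' : r = c • hyp K M₀ j + (-d) • hyp K M₀ (-i) := by rw [hr, neg_smul, sub_eq_add_neg]
  have hqr : wittForm q₀ r = 0 := by rw [hr']; exact wittForm_plane hji _ _
  have key : ∀ (u : M₀) (b : K),
      EichlerMem (elementaryGroup q₀) r ((b * q₀ u * c) • z) := by
    intro u b
    obtain ⟨_, _, g, hg, hgp⟩ :=
      eichlerMem_plane_aniso (q₀ := q₀) (idx_indep_neg_right h) c d u
    have h1 : EichlerMem (elementaryGroup q₀) r (b • hyp K M₀ (-i)) := by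
      rw [hr', add_comm]
      exact eichlerMem_plane_hyp (idx_indep_symm hji) _ _ _
    have h2 : EichlerMem (elementaryGroup q₀) r (aniso K ((b * c) • u)) := by
      rw [hr']
      exact eichlerMem_plane_aniso hji _ _ _
    have h3 := h1.conj hg
    have h4 : (g : WittModule K M₀ ≃ₗ[K] WittModule K M₀) r = r := by
      rw [hgp, eichler]
      have e1 : QuadraticMap.polar (wittForm q₀) z r = 0 := by
        rw [hz, hr', QuadraticMap.polar_add_left, QuadraticMap.polar_smul_left,
          QuadraticMap.polar_smul_left, polar_hyp_left, polar_hyp_left]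
        obtain ⟨n1, n2⟩ := h
        cases i <;> cases j <;> first | exact absurd rfl n1 | exact absurd rfl n2 |
          (simp [hyp, Neg.neg]; try ring)
      have e2 : QuadraticMap.polar (wittForm q₀) (aniso K u) r = 0 := by
        rw [polar_aniso_left]
        simp [hr, hyp]
      rw [e1, e2]
      simp
    have h5 : (g : WittModule K M₀ ≃ₗ[K] WittModule K M₀) (b • hyp K M₀ (-i)) =
        b • hyp K M₀ (-i) + aniso K ((b * c) • u) - (b * q₀ u * c) • z := by
      rw [hgp, eichler]
      have e1 : QuadraticMap.polar (wittForm q₀) z (b • hyp K M₀ (-i)) = b * c := by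
        rw [QuadraticMap.polar_smul_right, polar_hyp_right, idx_neg_neg, hz]
        obtain ⟨n1, n2⟩ := h
        cases i <;> cases j <;> first | exact absurd rfl n1 | exact absurd rfl n2 |
          (simp [hyp, Neg.neg])
      have e2 : QuadraticMap.polar (wittForm q₀) (aniso K u) (b • hyp K M₀ (-i)) = 0 := by
        rw [polar_aniso_left]
        simp [hyp]
      rw [e1, e2, wittForm_aniso, ← smul_aniso]
      module
    rw [h4, h5] at h3
    have h6 := (h1.add h2).sub h3
    rwa [sub_sub_cancel] at h6
  -- The admissible coefficients form an ideal containing every q₀(u), and these values generate K.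
  have ha : a ∈ Ideal.span (Set.range q₀) := by rw [hq]; exact Submodule.mem_top
  have key' : ∀ b : K, EichlerMem (elementaryGroup q₀) r ((b * a * c) • z) := by
    refine Submodule.span_induction (p := fun x _ => ∀ b : K,
      EichlerMem (elementaryGroup q₀) r ((b * x * c) • z)) ?_ ?_ ?_ ?_ ha
    · rintro _ ⟨u, rfl⟩ b
      exact key u b
    · intro b
      rw [mul_zero, zero_mul, zero_smul]
      exact EichlerMem.zero _ hqr
    · intro x y _ _ hx hy b
      rw [mul_add, add_mul, add_smul]
      exact (hx b).add (hy b)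
    · intro b' x _ hx b
      rw [smul_eq_mul, ← mul_assoc]
      exact hx _
  have h1 := key' 1
  rwa [one_mul] at h1

variable {v : WittModule K M₀}

/-- The vector r = v_i e_j - v_{-j} e_{-i} is isotropic and orthogonal to v, so T(v, a v_i r) = T(a
v_i v, r) can be swapped to T(r, a v_i v) up to sign. Now v splits into its part in the plane of r,
its part v_i e_i + v_{-j} e_{-j} treated by `eichlerMem_cross`, and its component in M₀. -/
theorem eichlerMem_isotropic (hq : Ideal.span (Set.range q₀) = ⊤) (hv : wittForm q₀ v = 0)
    {i j : Idx} (h : i ≠ j ∧ i ≠ -j) (a : K) :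
    EichlerMem (elementaryGroup q₀) v
      ((a * v.1 i) • (v.1 i • hyp K M₀ j - v.1 (-j) • hyp K M₀ (-i))) := by
  have hji : j ≠ -i ∧ j ≠ -(-i) := idx_indep_neg_right (idx_indep_symm h)
  set r : WittModule K M₀ := v.1 i • hyp K M₀ j - v.1 (-j) • hyp K M₀ (-i) with hr
  have hr' : r = v.1 i • hyp K M₀ j + (-v.1 (-j)) • hyp K M₀ (-i) := by
    rw [hr, neg_smul, sub_eq_add_neg]
  refine EichlerMem.smul_right hv ?_
  have hqr : wittForm q₀ r = 0 := by rw [hr']; exact wittForm_plane hji _ _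
  refine EichlerMem.swap' ?_ (by rw [QuadraticMap.map_smul, hv, smul_zero])
  have hd : (a * v.1 i) • v = (((a * v.1 i) * v.1 j) • hyp K M₀ j +
      ((a * v.1 i) * v.1 (-i)) • hyp K M₀ (-i)) +
      (a * v.1 i) • (v.1 i • hyp K M₀ i + v.1 (-j) • hyp K M₀ (-j)) +
      aniso K ((a * v.1 i) • v.2) := by
    refine (congrArg (fun w => (a * v.1 i) • w) (witt_decomp h v)).trans ?_
    rw [← smul_aniso]
    module
  rw [hd]
  refine EichlerMem.add (EichlerMem.add ?_ (eichlerMem_cross hq h _ _ _)) ?_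
  · rw [hr']; exact eichlerMem_plane_plane hji _ _ _ _
  · rw [hr']; exact eichlerMem_plane_aniso hji _ _ _

theorem shortT_hyp (j : Idx) (u : M₀) :
    (shortT q₀ j u : WittModule K M₀ ≃ₗ[K] WittModule K M₀) (hyp K M₀ j) =
      hyp K M₀ j + aniso K u - q₀ u • hyp K M₀ (-j) := by
  rw [shortT_apply, eichler, polar_hyp_left, polar_aniso_left, idx_neg_neg, wittForm_aniso,
    hyp_fst_apply, if_pos rfl]
  simp [hyp]

theorem shortT_hyp_of_ne {i j : Idx} (h : i ≠ j) (u : M₀) :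
    (shortT q₀ j u : WittModule K M₀ ≃ₗ[K] WittModule K M₀) (hyp K M₀ i) = hyp K M₀ i := by
  rw [shortT_apply, eichler, polar_hyp_left, polar_aniso_left, idx_neg_neg, wittForm_aniso,
    hyp_fst_apply, if_neg h.symm]
  simp [hyp]

theorem shortT_fst_neg (j : Idx) (u : M₀) (w : WittModule K M₀) :
    ((shortT q₀ j u : WittModule K M₀ ≃ₗ[K] WittModule K M₀) w).1 (-j) =
      w.1 (-j) - QuadraticMap.polar q₀ u w.2 - q₀ u * w.1 j := by
  change (shortMap q₀ j u w).1 (-j) = _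
  simp [shortMap]

theorem shortT_fst_of_ne {i j : Idx} (h : i ≠ -j) (u : M₀) (w : WittModule K M₀) :
    ((shortT q₀ j u : WittModule K M₀ ≃ₗ[K] WittModule K M₀) w).1 i = w.1 i := by
  change (shortMap q₀ j u w).1 i = _
  simp [shortMap, h]

theorem shortT_shortT_neg (j : Idx) (u : M₀) (w : WittModule K M₀) :
    (shortT q₀ j u : WittModule K M₀ ≃ₗ[K] WittModule K M₀)
      ((shortT q₀ j (-u) : WittModule K M₀ ≃ₗ[K] WittModule K M₀) w) = w :=
  shortMap_shortMap_neg q₀ j u w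

/-- The element T_j(u) sends e_j to e_j + u - q₀(u) e_{-j}. Applying `eichlerMem_isotropic` to
T_j(-u)v and conjugating back by T_j(u) therefore produces the wanted vector together with terms
along r for j and for -j, which the same lemma removes. -/
theorem eichlerMem_anisotropic (hq : Ideal.span (Set.range q₀) = ⊤) (hv : wittForm q₀ v = 0)
    (i : Idx) (a : K) (u : M₀) :
    EichlerMem (elementaryGroup q₀) v ((a * v.1 i) •
      (v.1 i • aniso K u - QuadraticMap.polar q₀ v.2 u • hyp K M₀ (-i))) := by
  obtain ⟨j, h⟩ := idx_exists_indep i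
  set v' := (shortT q₀ j (-u) : WittModule K M₀ ≃ₗ[K] WittModule K M₀) v with hv'
  have h1 : wittForm q₀ v' = 0 := ((shortT q₀ j (-u)).2 v).trans hv
  have h2 := (eichlerMem_isotropic hq h1 h a).conj (shortT_mem (q₀ := q₀) j u)
  have e1 : v'.1 i = v.1 i := shortT_fst_of_ne h.2 _ _
  have e2 : v'.1 (-j) = v.1 (-j) + QuadraticMap.polar q₀ v.2 u - q₀ u * v.1 j := by
    rw [hv', shortT_fst_neg, QuadraticMap.polar_neg_left, QuadraticMap.map_neg,
      QuadraticMap.polar_comm]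
    ring
  have e3 : (shortT q₀ j u : WittModule K M₀ ≃ₗ[K] WittModule K M₀) v' = v :=
    shortT_shortT_neg j u v
  rw [map_smul, map_sub, map_smul, map_smul, shortT_hyp, shortT_hyp_of_ne
    (idx_indep_neg_left h).1, e1, e2, e3] at h2
  have h3 := eichlerMem_isotropic hq hv h a
  have h4 := eichlerMem_isotropic hq hv (idx_indep_neg_right h) (a * q₀ u)
  rw [idx_neg_neg] at h4
  convert (h2.sub h3).add h4 using 1
  module

/-- Multiples of v contribute trivially, so w may be replaced by w' = c w - w_i v, whose i-th
coordinate vanishes. Orthogonality to v then expresses c w'_{-i} through the other coordinates, and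
c² w' becomes a combination of the vectors already treated. One power of c is spent on passing to
w', two on this combination. -/
theorem eichlerMem_cube (hq : Ideal.span (Set.range q₀) = ⊤) (hv : wittForm q₀ v = 0)
    (i : Idx) {w : WittModule K M₀} (hw : QuadraticMap.polar (wittForm q₀) v w = 0) :
    EichlerMem (elementaryGroup q₀) v (v.1 i ^ 3 • w) := by
  obtain ⟨j, h⟩ := idx_exists_indep i
  set c := v.1 i with hc
  set w' := c • w - w.1 i • v with hw'
  have hw'i : w'.1 i = 0 := by
    simp only [hw', hc, Prod.fst_sub, Prod.smul_fst, Pi.sub_apply, Pi.smul_apply, smul_eq_mul]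
    ring
  have hvw' : QuadraticMap.polar (wittForm q₀) v w' = 0 := by
    rw [hw', QuadraticMap.polar_sub_right, QuadraticMap.polar_smul_right, hw,
      QuadraticMap.polar_smul_right, polar_self_eq, hv]
    simp
  have hcoord : c * w'.1 (-i) = -(v.1 (-j) * w'.1 j) - v.1 j * w'.1 (-j) -
      QuadraticMap.polar q₀ v.2 w'.2 := by
    replace hvw' := (congrArg (QuadraticMap.polar (wittForm q₀) v) (witt_decomp h w')).symm.trans hvw'
    simp only [QuadraticMap.polar_add_right, QuadraticMap.polar_smul_right, polar_hyp_right,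
      polar_aniso_right, idx_neg_neg, hw'i, smul_eq_mul, zero_mul, ← hc] at hvw'
    linear_combination hvw'
  have hsplit : c ^ 3 • w = (w'.1 j * c) • (c • hyp K M₀ j - v.1 (-j) • hyp K M₀ (-i)) +
      (w'.1 (-j) * c) • (c • hyp K M₀ (-j) - v.1 j • hyp K M₀ (-i)) +
      (1 * c) • (c • aniso K w'.2 - QuadraticMap.polar q₀ v.2 w'.2 • hyp K M₀ (-i)) +
      (c ^ 2 * w.1 i) • v := by
    have e1 : c ^ 3 • w = c ^ 2 • w' + (c ^ 2 * w.1 i) • v := by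
      rw [hw']; module
    rw [e1]
    congr 1
    have e2 : c ^ 2 • w' = (c * (c * w'.1 (-i))) • hyp K M₀ (-i) + (c ^ 2 * w'.1 j) • hyp K M₀ j +
      (c ^ 2 * w'.1 (-j)) • hyp K M₀ (-j) + c ^ 2 • aniso K w'.2 := by
      refine (congrArg (fun w => c ^ 2 • w) (witt_decomp h w')).trans ?_
      simp only [hw'i]
      module
    rw [e2, hcoord]
    module
  rw [hsplit]
  have h4 := eichlerMem_isotropic hq hv (idx_indep_neg_right h) (w'.1 (-j))
  rw [idx_neg_neg] at h4
  exact (((eichlerMem_isotropic hq hv h _).add h4).add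
    (eichlerMem_anisotropic hq hv i 1 w'.2)).add (EichlerMem.smul_self _ hv _)

/-- The ideal of those `a` for which all transvections `T(v, a w)` are elementary. -/
def eichlerIdeal (q₀ : QuadraticForm K M₀) {v : WittModule K M₀} (hv : wittForm q₀ v = 0) :
    Ideal K where
  carrier := {a | ∀ w, QuadraticMap.polar (wittForm q₀) v w = 0 →
    EichlerMem (elementaryGroup q₀) v (a • w)}
  add_mem' ha hb w hw := by
    rw [add_smul]
    exact (ha w hw).add (hb w hw)
  zero_mem' w _ := by
    rw [zero_smul]
    exact EichlerMem.zero _ hv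
  smul_mem' c a ha w hw := by
    rw [smul_eq_mul, mul_comm, mul_smul]
    exact ha _ (by rw [QuadraticMap.polar_smul_right, hw, smul_zero])

/-- Transvections of unimodular isotropic vectors are elementary. -/
theorem eichlerMem_of_unimodular (hq : Ideal.span (Set.range q₀) = ⊤) (hv : wittForm q₀ v = 0)
    {p : WittModule K M₀} (hp : QuadraticMap.polar (wittForm q₀) v p = 1)
    {w : WittModule K M₀} (hw : QuadraticMap.polar (wittForm q₀) v w = 0) :
    EichlerMem (elementaryGroup q₀) v w := by
  -- The cubes of the coordinates lie in the ideal, so it is enough to put 1 = b(v, p) into its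
  -- radical.
  have h1 : ∀ i, v.1 i ∈ (eichlerIdeal q₀ hv).radical := fun i =>
    ⟨3, fun w hw => eichlerMem_cube hq hv i hw⟩
  have h2 : ∀ u, QuadraticMap.polar q₀ v.2 u ∈ (eichlerIdeal q₀ hv).radical := by
    intro u
    -- The pairing of v with u ∈ M₀ is not a hyperbolic coordinate of v, but up to such coordinates
    -- it is one of T_1(u)v. The cube lemma for T_1(u)v is carried back to v by conjugation.
    have h3 : ((shortT q₀ .p1 u : WittModule K M₀ ≃ₗ[K] WittModule K M₀) v).1 (-.p1) ∈
        (eichlerIdeal q₀ hv).radical := by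
      refine ⟨3, fun w hw => ?_⟩
      have h4 := eichlerMem_cube hq (((shortT q₀ .p1 u).2 v).trans hv) (-.p1)
        (w := (shortT q₀ .p1 u : WittModule K M₀ ≃ₗ[K] WittModule K M₀) w)
        (by rw [polar_map_orthogonal, hw])
      have h5 := h4.conj (Subgroup.inv_mem _ (shortT_mem (q₀ := q₀) .p1 u))
      rwa [map_smul, orthogonal_inv_apply, orthogonal_inv_apply] at h5
    rw [shortT_fst_neg] at h3
    have h4 := Ideal.sub_mem _ (Ideal.sub_mem _ (h1 (-.p1)) h3)
      (Ideal.mul_mem_left _ (q₀ u) (h1 .p1))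
    convert h4 using 1
    rw [QuadraticMap.polar_comm]
    ring
  have h3 : (1 : K) ∈ (eichlerIdeal q₀ hv).radical := by
    rw [← hp, polar_wittForm]
    exact Ideal.add_mem _ (Ideal.add_mem _ (h2 _) (Ideal.add_mem _ (Ideal.mul_mem_right _ _ (h1 _))
      (Ideal.mul_mem_right _ _ (h1 _)))) (Ideal.add_mem _ (Ideal.mul_mem_right _ _ (h1 _))
      (Ideal.mul_mem_right _ _ (h1 _)))
  obtain ⟨n, hn⟩ := h3
  have h4 := hn w hw
  rwa [one_pow, one_smul] at h4

end WittEichler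

/-! ### Isometries along ring homomorphisms -/

section Semilinear

variable {K K' M M' : Type*} [CommRing K] [CommRing K'] [AddCommGroup M] [AddCommGroup M']
  [Module K M] [Module K' M'] {σ : K' →+* K} {q : QuadraticForm K M} {q' : QuadraticForm K' M'}
  {f : M' →ₛₗ[σ] M}

theorem polar_semilinear (hf : ∀ x, q (f x) = σ (q' x)) (x y : M') :
    QuadraticMap.polar q (f x) (f y) = σ (QuadraticMap.polar q' x y) := by
  simp only [QuadraticMap.polar, ← map_add, hf, map_sub]

theorem eichler_semilinear (hf : ∀ x, q (f x) = σ (q' x)) (x y p : M') :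
    f (eichler q' x y p) = eichler q (f x) (f y) (f p) := by
  simp only [eichler, polar_semilinear hf, hf, map_add, map_sub, LinearMap.map_smulₛₗ, map_mul]

variable {M₀ M₀' : Type*} [AddCommGroup M₀] [AddCommGroup M₀'] [Module K M₀] [Module K' M₀']
  {q₀ : QuadraticForm K M₀} {q₀' : QuadraticForm K' M₀'}

/-- The map of Witt modules induced by a semilinear map. -/
def wittMap (f : M₀' →ₛₗ[σ] M₀) : WittModule K' M₀' →ₛₗ[σ] WittModule K M₀ where
  toFun v := (fun i => σ (v.1 i), f v.2)
  map_add' v w := by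
    ext <;> simp
  map_smul' a v := by
    ext <;> simp

theorem wittForm_wittMap {f : M₀' →ₛₗ[σ] M₀} (hf : ∀ x, q₀ (f x) = σ (q₀' x))
    (v : WittModule K' M₀') : wittForm q₀ (wittMap f v) = σ (wittForm q₀' v) := by
  obtain ⟨x, u⟩ := v
  change wittForm q₀ (_, _) = _
  simp only [wittForm_apply, hf, map_add, map_mul]

theorem wittMap_hyp (f : M₀' →ₛₗ[σ] M₀) (i : Idx) : wittMap f (hyp K' M₀' i) = hyp K M₀ i := by
  ext k
  · change σ ((Pi.single i 1 : Idx → K') k) = (Pi.single i 1 : Idx → K) k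
    simp only [Pi.single_apply]
    split_ifs <;> simp
  · exact map_zero f

theorem wittMap_aniso (f : M₀' →ₛₗ[σ] M₀) (u : M₀') :
    wittMap f (aniso K' u) = aniso K (f u) := by
  ext k
  · exact map_zero σ
  · rfl

theorem wittMap_longT {f : M₀' →ₛₗ[σ] M₀} (hf : ∀ x, q₀ (f x) = σ (q₀' x)) {i j : Idx}
    (h : i ≠ j ∧ i ≠ -j) (y : K') (p : WittModule K' M₀') :
    wittMap f ((longT q₀' i j h y : WittModule K' M₀' ≃ₗ[K'] WittModule K' M₀') p) =
      (longT q₀ i j h (σ y) : WittModule K M₀ ≃ₗ[K] WittModule K M₀) (wittMap f p) := by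
  rw [longT_apply, longT_apply, eichler_semilinear (wittForm_wittMap hf), LinearMap.map_smulₛₗ,
    wittMap_hyp, wittMap_hyp]

theorem wittMap_shortT {f : M₀' →ₛₗ[σ] M₀} (hf : ∀ x, q₀ (f x) = σ (q₀' x)) (i : Idx)
    (u : M₀') (p : WittModule K' M₀') :
    wittMap f ((shortT q₀' i u : WittModule K' M₀' ≃ₗ[K'] WittModule K' M₀') p) =
      (shortT q₀ i (f u) : WittModule K M₀ ≃ₗ[K] WittModule K M₀) (wittMap f p) := by
  rw [shortT_apply, shortT_apply, eichler_semilinear (wittForm_wittMap hf), wittMap_hyp,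
    wittMap_aniso]

end Semilinear

/-! ### Elementary transvections with parameters -/

section Root

variable {K M₀ : Type*} [CommRing K] [AddCommGroup M₀] [Module K M₀] {q₀ : QuadraticForm K M₀}

/-- The vectors `w` for which `T(e_k, w)` is an elementary transvection with parameter in `I` or
`N₀`. -/
def IsRootVector (N₀ : Submodule K M₀) (I : Ideal K) (k : Idx) (w : WittModule K M₀) : Prop :=
  (∃ i, (k ≠ i ∧ k ≠ -i) ∧ ∃ y ∈ I, w = y • hyp K M₀ i) ∨ ∃ u ∈ N₀, w = aniso K u

theorem exists_isRootVector {N₀ : Submodule K M₀} {I : Ideal K}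
    {g : orthogonalGroup (wittForm q₀)} (hg : g ∈ transvections q₀ N₀ I) :
    ∃ k w, IsRootVector N₀ I k w ∧ ∀ p, (g : WittModule K M₀ ≃ₗ[K] WittModule K M₀) p =
      eichler (wittForm q₀) (hyp K M₀ k) w p := by
  rcases hg with ⟨i, j, h, y, hy, rfl⟩ | ⟨i, u, hu, rfl⟩
  · exact ⟨-j, y • hyp K M₀ i, Or.inl ⟨i, idx_indep_neg_left (idx_indep_symm h), y, hy, rfl⟩,
      longT_apply h y⟩
  · exact ⟨-i, aniso K u, Or.inr ⟨u, hu, rfl⟩, shortT_apply i u⟩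

theorem IsRootVector.exists_mem {N₀ : Submodule K M₀} {I : Ideal K} {k : Idx}
    {w : WittModule K M₀} (hw : IsRootVector N₀ I k w) :
    ∃ g ∈ transvections q₀ N₀ I, ∀ p, (g : WittModule K M₀ ≃ₗ[K] WittModule K M₀) p =
      eichler (wittForm q₀) (hyp K M₀ k) w p := by
  rcases hw with ⟨i, h, y, hy, rfl⟩ | ⟨u, hu, rfl⟩
  · refine ⟨_, Or.inl ⟨i, -k, idx_indep_symm (idx_indep_neg_left h), y, hy, rfl⟩, fun p => ?_⟩
    rw [longT_apply, idx_neg_neg]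
  · refine ⟨_, Or.inr ⟨-k, u, hu, rfl⟩, fun p => ?_⟩
    rw [shortT_apply, idx_neg_neg]

theorem IsRootVector.polar_eq_zero {N₀ : Submodule K M₀} {I : Ideal K} {k : Idx}
    {w : WittModule K M₀} (hw : IsRootVector N₀ I k w) :
    QuadraticMap.polar (wittForm q₀) (hyp K M₀ k) w = 0 := by
  rcases hw with ⟨i, h, y, hy, rfl⟩ | ⟨u, hu, rfl⟩
  · rw [QuadraticMap.polar_smul_right, polar_hyp_hyp h, smul_zero]
  · rw [polar_hyp_left]; rfl

variable {P : AdmissiblePair q₀}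

theorem IsRootVector.smul {k : Idx} {w : WittModule K M₀} (hw : IsRootVector ⊤ ⊤ k w) {a : K}
    (ha : a ∈ P.I) : IsRootVector P.N₀ P.I k (a • w) := by
  rcases hw with ⟨i, h, y, hy, rfl⟩ | ⟨u, hu, rfl⟩
  · exact Or.inl ⟨i, h, a * y, P.I.mul_mem_right _ ha, smul_smul _ _ _⟩
  · exact Or.inr ⟨a • u, P.smul_top_le (Submodule.smul_mem_smul ha hu), smul_aniso _ _⟩

theorem IsRootVector.mem {k : Idx} {w : WittModule K M₀} (hw : IsRootVector P.N₀ P.I k w) :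
    w ∈ P.N := by
  rcases hw with ⟨i, h, y, hy, rfl⟩ | ⟨u, hu, rfl⟩
  · exact P.smul_mem hy _
  · exact ⟨fun _ => P.I.zero_mem, hu⟩

end Root

namespace AdmissiblePair

variable {K M₀ : Type*} [CommRing K] [AddCommGroup M₀] [Module K M₀] {q₀ : QuadraticForm K M₀}
  (P : AdmissiblePair q₀)

theorem transvections_subset_relElementary :
    transvections q₀ P.N₀ P.I ⊆ (P.relElementary : Set (orthogonalGroup (wittForm q₀))) := by
  intro x hx
  exact Subgroup.subset_closure ⟨1, Subgroup.one_mem _, x, hx, by rw [one_mul, inv_one, mul_one]⟩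

theorem relElementary_conj_mem {g h : orthogonalGroup (wittForm q₀)}
    (hg : g ∈ elementaryGroup q₀) (hh : h ∈ P.relElementary) : g * h * g⁻¹ ∈ P.relElementary := by
  unfold relElementary at hh
  induction hh using Subgroup.closure_induction with
  | mem z hz =>
    obtain ⟨e, he, x, hx, rfl⟩ := hz
    exact Subgroup.subset_closure ⟨g * e, Subgroup.mul_mem _ hg he, x, hx, by group⟩
  | one => rw [mul_one, mul_inv_cancel]; exact Subgroup.one_mem _
  | mul x y _ _ hx hy =>
    have h1 := Subgroup.mul_mem _ hx hy
    rwa [show g * x * g⁻¹ * (g * y * g⁻¹) = g * (x * y) * g⁻¹ by group] at h1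
  | inv x _ hx =>
    have h1 := Subgroup.inv_mem _ hx
    rwa [show (g * x * g⁻¹)⁻¹ = g * x⁻¹ * g⁻¹ by group] at h1

/-! ### The double of an admissible pair -/

/-- The fibre product `K ×_{K/I} K`. -/
def doubleRing : Subring (K × K) where
  carrier := {a | a.1 - a.2 ∈ P.I}
  mul_mem' {a b} ha hb := by
    have h : a.1 * b.1 - a.2 * b.2 = (a.1 - a.2) * b.1 + a.2 * (b.1 - b.2) := by ring
    change a.1 * b.1 - a.2 * b.2 ∈ P.I
    rw [h]
    exact P.I.add_mem (P.I.mul_mem_right _ ha) (P.I.mul_mem_left _ hb)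
  one_mem' := by
    change (1 : K) - 1 ∈ P.I
    rw [sub_self]; exact P.I.zero_mem
  add_mem' {a b} ha hb := by
    change (a.1 + b.1) - (a.2 + b.2) ∈ P.I
    rw [add_sub_add_comm]
    exact P.I.add_mem ha hb
  zero_mem' := by
    change (0 : K) - 0 ∈ P.I
    rw [sub_self]; exact P.I.zero_mem
  neg_mem' {a} ha := by
    have h := P.I.neg_mem ha
    change -a.1 - -a.2 ∈ P.I
    rwa [neg_sub_neg, ← neg_sub]

/-- The fibre product `M₀ ×_{M₀/N₀} M₀`. -/
def doubleModule : AddSubgroup (M₀ × M₀) where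
  carrier := {u | u.1 - u.2 ∈ P.N₀}
  add_mem' {a b} ha hb := by
    change (a.1 + b.1) - (a.2 + b.2) ∈ P.N₀
    rw [add_sub_add_comm]
    exact P.N₀.add_mem ha hb
  zero_mem' := by
    change (0 : M₀) - 0 ∈ P.N₀
    rw [sub_self]; exact P.N₀.zero_mem
  neg_mem' {a} ha := by
    have h := P.N₀.neg_mem ha
    change -a.1 - -a.2 ∈ P.N₀
    rwa [neg_sub_neg, ← neg_sub]

theorem double_smul_mem (a : P.doubleRing) (u : P.doubleModule) :
    a.1.1 • u.1.1 - a.1.2 • u.1.2 ∈ P.N₀ := by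
  have h : a.1.1 • u.1.1 - a.1.2 • u.1.2 =
      a.1.1 • (u.1.1 - u.1.2) + (a.1.1 - a.1.2) • u.1.2 := by module
  rw [h]
  exact P.N₀.add_mem (P.N₀.smul_mem _ u.2)
    (P.smul_top_le (Submodule.smul_mem_smul a.2 Submodule.mem_top))

instance : Module P.doubleRing P.doubleModule where
  smul a u := ⟨(a.1.1 • u.1.1, a.1.2 • u.1.2), P.double_smul_mem a u⟩
  one_smul _ := Subtype.ext (Prod.ext (one_smul K _) (one_smul K _))
  mul_smul _ _ _ := Subtype.ext (Prod.ext (mul_smul _ _ _) (mul_smul _ _ _))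
  smul_zero _ := Subtype.ext (Prod.ext (smul_zero _) (smul_zero _))
  smul_add _ _ _ := Subtype.ext (Prod.ext (smul_add _ _ _) (smul_add _ _ _))
  add_smul _ _ _ := Subtype.ext (Prod.ext (add_smul _ _ _) (add_smul _ _ _))
  zero_smul _ := Subtype.ext (Prod.ext (zero_smul K _) (zero_smul K _))

/-- The first projection of the double ring. -/
def ringFst : P.doubleRing →+* K := (RingHom.fst K K).comp P.doubleRing.subtype

/-- The second projection of the double ring. -/
def ringSnd : P.doubleRing →+* K := (RingHom.snd K K).comp P.doubleRing.subtype

/-- The first projection of the double module. -/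
def moduleFst : P.doubleModule →ₛₗ[P.ringFst] M₀ where
  toFun u := u.1.1
  map_add' _ _ := rfl
  map_smul' _ _ := rfl

/-- The second projection of the double module. -/
def moduleSnd : P.doubleModule →ₛₗ[P.ringSnd] M₀ where
  toFun u := u.1.2
  map_add' _ _ := rfl
  map_smul' _ _ := rfl

theorem form_sub_mem {u v : M₀} (h : u - v ∈ P.N₀) : q₀ u - q₀ v ∈ P.I := by
  have h4 := QuadraticMap.map_add (⇑q₀) v (u - v)
  rw [add_sub_cancel] at h4
  rw [h4, add_assoc, add_sub_cancel_left]
  exact P.I.add_mem (P.form_mem _ h) (P.polar_mem _ _ h)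

/-- The quadratic form `(q₀, q₀)` on the double module. -/
def doubleForm : QuadraticForm P.doubleRing P.doubleModule :=
  QuadraticMap.ofPolar (fun u => ⟨(q₀ u.1.1, q₀ u.1.2), P.form_sub_mem u.2⟩)
    (fun _ _ => Subtype.ext (Prod.ext (QuadraticMap.map_smul q₀ _ _)
      (QuadraticMap.map_smul q₀ _ _)))
    (fun _ _ _ => Subtype.ext (Prod.ext (QuadraticMap.polar_add_left q₀ _ _ _)
      (QuadraticMap.polar_add_left q₀ _ _ _)))
    (fun _ _ _ => Subtype.ext (Prod.ext (QuadraticMap.polar_smul_left q₀ _ _ _)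
      (QuadraticMap.polar_smul_left q₀ _ _ _)))

theorem form_moduleFst (u : P.doubleModule) :
    q₀ (P.moduleFst u) = P.ringFst (P.doubleForm u) := rfl

theorem form_moduleSnd (u : P.doubleModule) :
    q₀ (P.moduleSnd u) = P.ringSnd (P.doubleForm u) := rfl

theorem doubleRing_ext {a b : P.doubleRing} (h1 : P.ringFst a = P.ringFst b)
    (h2 : P.ringSnd a = P.ringSnd b) : a = b :=
  Subtype.ext (Prod.ext h1 h2)

/-- On diagonal pairs (u, u) the form takes the diagonal values (q₀(u), q₀(u)), and the diagonal map
K → K ×_{K/I} K carries the unit ideal to the unit ideal. -/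
theorem span_range_doubleForm (hq : Ideal.span (Set.range q₀) = ⊤) :
    Ideal.span (Set.range P.doubleForm) = ⊤ := by
  have hd : ∀ a : K, (a, a) ∈ P.doubleRing := fun a => by
    change a - a ∈ P.I
    rw [sub_self]; exact P.I.zero_mem
  let δ : K →+* P.doubleRing := (RingHom.prod (RingHom.id K) (RingHom.id K)).codRestrict _ hd
  have h : (Ideal.span (Set.range q₀)).map δ ≤ Ideal.span (Set.range P.doubleForm) := by
    rw [Ideal.map_span, Ideal.span_le]
    rintro _ ⟨_, ⟨u, rfl⟩, rfl⟩
    refine Ideal.subset_span ⟨⟨(u, u), ?_⟩, rfl⟩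
    change u - u ∈ P.N₀
    rw [sub_self]; exact P.N₀.zero_mem
  rw [hq, Ideal.map_top] at h
  exact top_le_iff.1 h

/-- Vectors of the double Witt module are pairs of vectors congruent modulo `N`. -/
def doubleMk (v w : WittModule K M₀) (h : v - w ∈ P.N) :
    WittModule P.doubleRing P.doubleModule :=
  (fun i => ⟨(v.1 i, w.1 i), h.1 i⟩, ⟨(v.2, w.2), h.2⟩)

theorem wittFst_doubleMk (v w : WittModule K M₀) (h : v - w ∈ P.N) :
    wittMap P.moduleFst (P.doubleMk v w h) = v := rfl

theorem wittSnd_doubleMk (v w : WittModule K M₀) (h : v - w ∈ P.N) :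
    wittMap P.moduleSnd (P.doubleMk v w h) = w := rfl

theorem longT_mul_longT {i j : Idx} (h : i ≠ j ∧ i ≠ -j) (a b : K) :
    longT q₀ i j h a * longT q₀ i j h b = longT q₀ i j h (a + b) := by
  refine orthogonal_ext fun p => ?_
  have h' := idx_indep_neg_left (idx_indep_symm h)
  rw [orthogonal_mul_apply, longT_apply, longT_apply, longT_apply, eichler_add (wittForm_hyp _),
    add_smul]
  all_goals rw [QuadraticMap.polar_smul_right, polar_hyp_hyp h', smul_zero]

theorem shortT_mul_shortT (i : Idx) (u v : M₀) :
    shortT q₀ i u * shortT q₀ i v = shortT q₀ i (u + v) := by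
  refine orthogonal_ext fun p => ?_
  rw [orthogonal_mul_apply, shortT_apply, shortT_apply, shortT_apply,
    eichler_add (wittForm_hyp _)]
  · congr 1
    simp [aniso]
  all_goals rw [polar_hyp_left]; rfl

/-- Elementary automorphisms of the double Witt module are pairs of elementary automorphisms that
are congruent modulo the relative elementary group. -/
theorem exists_pair {g : orthogonalGroup (wittForm P.doubleForm)}
    (hg : g ∈ elementaryGroup P.doubleForm) :
    ∃ g₁ ∈ elementaryGroup q₀, ∃ g₂ ∈ elementaryGroup q₀, g₁ * g₂⁻¹ ∈ P.relElementary ∧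
      (∀ p, wittMap P.moduleFst ((g : WittModule P.doubleRing P.doubleModule ≃ₗ[P.doubleRing]
        WittModule P.doubleRing P.doubleModule) p) =
        (g₁ : WittModule K M₀ ≃ₗ[K] WittModule K M₀) (wittMap P.moduleFst p)) ∧
      ∀ p, wittMap P.moduleSnd ((g : WittModule P.doubleRing P.doubleModule ≃ₗ[P.doubleRing]
        WittModule P.doubleRing P.doubleModule) p) =
        (g₂ : WittModule K M₀ ≃ₗ[K] WittModule K M₀) (wittMap P.moduleSnd p) := by
  unfold elementaryGroup at hg
  induction hg using Subgroup.closure_induction with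
  | mem g hg =>
    rcases hg with ⟨i, j, h, y, -, rfl⟩ | ⟨i, u, -, rfl⟩
    · refine ⟨_, longT_mem i j h (P.ringFst y), _, longT_mem i j h (P.ringSnd y), ?_,
        wittMap_longT P.form_moduleFst h y, wittMap_longT P.form_moduleSnd h y⟩
      apply P.transvections_subset_relElementary
      refine Or.inl ⟨i, j, h, _, y.2, ?_⟩
      rw [mul_inv_eq_iff_eq_mul, longT_mul_longT]
      congr 1
      exact (sub_add_cancel _ _).symm
    · refine ⟨_, shortT_mem i (P.moduleFst u), _, shortT_mem i (P.moduleSnd u), ?_,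
        wittMap_shortT P.form_moduleFst i u, wittMap_shortT P.form_moduleSnd i u⟩
      apply P.transvections_subset_relElementary
      refine Or.inr ⟨i, _, u.2, ?_⟩
      rw [mul_inv_eq_iff_eq_mul, shortT_mul_shortT]
      congr 1
      exact (sub_add_cancel _ _).symm
  | one =>
    exact ⟨1, Subgroup.one_mem _, 1, Subgroup.one_mem _,
      by rw [inv_one, mul_one]; exact Subgroup.one_mem _, fun _ => rfl, fun _ => rfl⟩
  | mul a b _ _ ha hb =>
    obtain ⟨a₁, ha₁, a₂, ha₂, ha, ha', ha''⟩ := ha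
    obtain ⟨b₁, hb₁, b₂, hb₂, hb, hb', hb''⟩ := hb
    refine ⟨a₁ * b₁, Subgroup.mul_mem _ ha₁ hb₁, a₂ * b₂, Subgroup.mul_mem _ ha₂ hb₂, ?_,
      fun p => ?_, fun p => ?_⟩
    -- Congruence is multiplicative because EO(M, q, N₀, I) is by construction stable under
    -- conjugation by EO(M, q).
    · have h1 := Subgroup.mul_mem _ (P.relElementary_conj_mem ha₁ hb) ha
      rwa [show a₁ * (b₁ * b₂⁻¹) * a₁⁻¹ * (a₁ * a₂⁻¹) = a₁ * b₁ * (a₂ * b₂)⁻¹ by group] at h1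
    · rw [orthogonal_mul_apply, orthogonal_mul_apply, ha', hb']
    · rw [orthogonal_mul_apply, orthogonal_mul_apply, ha'', hb'']
  | inv a _ ha =>
    obtain ⟨a₁, ha₁, a₂, ha₂, ha, ha', ha''⟩ := ha
    refine ⟨a₁⁻¹, Subgroup.inv_mem _ ha₁, a₂⁻¹, Subgroup.inv_mem _ ha₂, ?_,
      fun p => ?_, fun p => ?_⟩
    · have h1 := P.relElementary_conj_mem (Subgroup.inv_mem _ ha₁) (Subgroup.inv_mem _ ha)
      rwa [show a₁⁻¹ * (a₁ * a₂⁻¹)⁻¹ * a₁⁻¹⁻¹ = a₁⁻¹ * a₂⁻¹⁻¹ by group] at h1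
    · apply (a₁ : WittModule K M₀ ≃ₗ[K] WittModule K M₀).injective
      rw [orthogonal_apply_inv, ← ha', orthogonal_apply_inv]
    · apply (a₂ : WittModule K M₀ ≃ₗ[K] WittModule K M₀).injective
      rw [orthogonal_apply_inv, ← ha'', orthogonal_apply_inv]

/-- Evaluating on diagonal vectors (p, p) identifies both components for every p ∈ M, so they are
the Eichler transvections of the two projections. -/
theorem exists_pair_of_eichlerMem {x y : WittModule P.doubleRing P.doubleModule}
    (h : EichlerMem (elementaryGroup P.doubleForm) x y) :
    ∃ g₁ g₂ : orthogonalGroup (wittForm q₀), g₁ * g₂⁻¹ ∈ P.relElementary ∧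
      (∀ p, (g₁ : WittModule K M₀ ≃ₗ[K] WittModule K M₀) p =
        eichler (wittForm q₀) (wittMap P.moduleFst x) (wittMap P.moduleFst y) p) ∧
      ∀ p, (g₂ : WittModule K M₀ ≃ₗ[K] WittModule K M₀) p =
        eichler (wittForm q₀) (wittMap P.moduleSnd x) (wittMap P.moduleSnd y) p := by
  obtain ⟨_, _, g, hg, hgp⟩ := h
  obtain ⟨g₁, _, g₂, _, h, h1, h2⟩ := P.exists_pair hg
  have hp : ∀ p : WittModule K M₀, p - p ∈ P.N := fun p => by
    rw [sub_self]; exact P.N.zero_mem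
  refine ⟨g₁, g₂, h, fun p => ?_, fun p => ?_⟩
  · have h3 := h1 (P.doubleMk p p (hp p))
    rw [hgp, eichler_semilinear (wittForm_wittMap P.form_moduleFst)] at h3
    exact h3.symm
  · have h3 := h2 (P.doubleMk p p (hp p))
    rw [hgp, eichler_semilinear (wittForm_wittMap P.form_moduleSnd)] at h3
    exact h3.symm

theorem polar_double_eq {x y : WittModule P.doubleRing P.doubleModule} {a : P.doubleRing}
    (h1 : QuadraticMap.polar (wittForm q₀) (wittMap P.moduleFst x) (wittMap P.moduleFst y) =
      P.ringFst a)
    (h2 : QuadraticMap.polar (wittForm q₀) (wittMap P.moduleSnd x) (wittMap P.moduleSnd y) =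
      P.ringSnd a) :
    QuadraticMap.polar (wittForm P.doubleForm) x y = a := by
  rw [polar_semilinear (wittForm_wittMap P.form_moduleFst)] at h1
  rw [polar_semilinear (wittForm_wittMap P.form_moduleSnd)] at h2
  exact P.doubleRing_ext h1 h2

theorem wittForm_double_eq {x : WittModule P.doubleRing P.doubleModule} {a : P.doubleRing}
    (h1 : wittForm q₀ (wittMap P.moduleFst x) = P.ringFst a)
    (h2 : wittForm q₀ (wittMap P.moduleSnd x) = P.ringSnd a) :
    wittForm P.doubleForm x = a := by
  rw [wittForm_wittMap P.form_moduleFst] at h1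
  rw [wittForm_wittMap P.form_moduleSnd] at h2
  exact P.doubleRing_ext h1 h2

/-! ### Normality of the relative elementary group -/

variable {P}

/-- The relative elementary group is normal in the orthogonal group. -/
theorem relElementary_normal (hq : Ideal.span (Set.range q₀) = ⊤)
    (hN : ∀ (φ : orthogonalGroup (wittForm q₀)), ∀ v ∈ P.N,
      (φ : WittModule K M₀ ≃ₗ[K] WittModule K M₀) v ∈ P.N) : P.relElementary.Normal := by
  have key : ∀ (φ : orthogonalGroup (wittForm q₀)), ∀ x ∈ transvections q₀ P.N₀ P.I,
      φ * x * φ⁻¹ ∈ P.relElementary := by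
    intro φ x hx
    obtain ⟨k, w, hw, hxw⟩ := exists_isRootVector hx
    have h0 : ∀ p : WittModule K M₀, p - p ∈ P.N := fun p => by
      rw [sub_self]; exact P.N.zero_mem
    set e := (φ : WittModule K M₀ ≃ₗ[K] WittModule K M₀) (hyp K M₀ k) with he
    set f := (φ : WittModule K M₀ ≃ₗ[K] WittModule K M₀) (hyp K M₀ (-k)) with hf
    set n := (φ : WittModule K M₀ ≃ₗ[K] WittModule K M₀) w with hn
    have hn' : n - 0 ∈ P.N := by rw [sub_zero]; exact hN φ w hw.mem
    have hqe : wittForm q₀ e = 0 := (φ.2 _).trans (wittForm_hyp k)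
    have hef : QuadraticMap.polar (wittForm q₀) e f = 1 := by
      rw [he, hf, polar_map_orthogonal, polar_hyp_left, hyp_fst_apply, if_pos rfl]
    have hen : QuadraticMap.polar (wittForm q₀) e n = 0 := by
      rw [he, hn, polar_map_orthogonal, hw.polar_eq_zero]
    -- In the double, (φe_k, φe_k) pairs to 1 with (φe_{-k}, φe_{-k}), and (φw, 0) is a legitimate
    -- vector since φw ∈ N. The resulting pair is (φxφ⁻¹, 1).
    have h1 : EichlerMem (elementaryGroup P.doubleForm) (P.doubleMk e e (h0 e))
        (P.doubleMk n 0 hn') := by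
      refine eichlerMem_of_unimodular (P.span_range_doubleForm hq)
        (P.wittForm_double_eq (a := 0) ?_ ?_) (p := P.doubleMk f f (h0 f))
        (P.polar_double_eq (a := 1) ?_ ?_) (P.polar_double_eq (a := 0) ?_ ?_)
      · rw [map_zero]; exact hqe
      · rw [map_zero]; exact hqe
      · rw [map_one]; exact hef
      · rw [map_one]; exact hef
      · rw [map_zero]; exact hen
      · rw [map_zero]; exact QuadraticMap.polar_zero_right _ _
    obtain ⟨g₁, g₂, hg, hg₁, hg₂⟩ := P.exists_pair_of_eichlerMem h1
    have e1 : g₁ = φ * x * φ⁻¹ := by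
      refine orthogonal_ext fun p => ?_
      rw [hg₁, orthogonal_mul_apply, orthogonal_mul_apply, hxw, map_eichler,
        orthogonal_apply_inv]
      rfl
    have e2 : g₂ = 1 := by
      refine orthogonal_ext fun p => ?_
      rw [hg₂]
      exact eichler_zero _ _
    rwa [e1, e2, inv_one, mul_one] at hg
  constructor
  intro h hh φ
  unfold relElementary at hh
  induction hh using Subgroup.closure_induction with
  | mem z hz =>
    obtain ⟨e, he, x, hx, rfl⟩ := hz
    have h1 := key (φ * e) x hx
    rwa [show φ * e * x * (φ * e)⁻¹ = φ * (e * x * e⁻¹) * φ⁻¹ by group] at h1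
  | one => rw [mul_one, mul_inv_cancel]; exact Subgroup.one_mem _
  | mul x y _ _ hx hy =>
    have h1 := Subgroup.mul_mem _ hx hy
    rwa [show φ * x * φ⁻¹ * (φ * y * φ⁻¹) = φ * (x * y) * φ⁻¹ by group] at h1
  | inv x _ hx =>
    have h1 := Subgroup.inv_mem _ hx
    rwa [show (φ * x * φ⁻¹)⁻¹ = φ * x⁻¹ * φ⁻¹ by group] at h1

theorem pow_sub_one_mem {a : K} (ha : a * a - 1 ∈ P.I) (n : ℕ) : a ^ (2 * n) - 1 ∈ P.I := by
  have h := sub_dvd_pow_sub_pow (a * a) 1 n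
  rw [one_pow, ← sq, ← pow_mul] at h
  exact P.I.mem_of_dvd h (by rwa [sq])

/-- Automorphisms that are scalar modulo `N` commute with elementary transvections modulo the
relative elementary group. -/
theorem commutator_transvection_mem (hq : Ideal.span (Set.range q₀) = ⊤)
    (hN : ∀ (φ : orthogonalGroup (wittForm q₀)), ∀ v ∈ P.N,
      (φ : WittModule K M₀ ≃ₗ[K] WittModule K M₀) v ∈ P.N)
    {φ : orthogonalGroup (wittForm q₀)} {a : K} (ha : a * a - 1 ∈ P.I)
    (hφ : ∀ v, (φ : WittModule K M₀ ≃ₗ[K] WittModule K M₀) v - a • v ∈ P.N)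
    {g : orthogonalGroup (wittForm q₀)} (hg : g ∈ transvections q₀ ⊤ ⊤) :
    φ * g * φ⁻¹ * g⁻¹ ∈ P.relElementary := by
  obtain ⟨k, w, hw, hgw⟩ := exists_isRootVector hg
  have hnorm := relElementary_normal hq hN
  have hqh := wittForm_hyp (q₀ := q₀) k
  have hhw : QuadraticMap.polar (wittForm q₀) (hyp K M₀ k) w = 0 := hw.polar_eq_zero
  set e := (φ : WittModule K M₀ ≃ₗ[K] WittModule K M₀) (hyp K M₀ k) with he
  set c := e.1 k with hc
  have hca : c - a ∈ P.I := by
    have h1 := (hφ (hyp K M₀ k)).1 k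
    have h2 : (e - a • hyp K M₀ k).1 k = c - a := by simp [hyp, hc]
    rwa [h2] at h1
  have hcc : c * c - 1 ∈ P.I := by
    have h1 : c * c - 1 = (c - a) * (c + a) + (a * a - 1) := by ring
    rw [h1]
    exact P.I.add_mem (P.I.mul_mem_right _ hca) ha
  -- The hypothesis on φ says exactly that φv and a v form a vector of the double. The scalar a need
  -- not be a unit of K, so x need not be unimodular and only the cube lemma is available.
  set x := P.doubleMk e (a • hyp K M₀ k) (hφ _) with hx
  set y := P.doubleMk ((φ : WittModule K M₀ ≃ₗ[K] WittModule K M₀) w) (a • w) (hφ _) with hy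
  have hqx : wittForm P.doubleForm x = 0 := by
    refine P.wittForm_double_eq ?_ ?_
    · rw [map_zero]; exact (φ.2 _).trans hqh
    · rw [map_zero]
      refine (QuadraticMap.map_smul (wittForm q₀) _ _).trans ?_
      rw [hqh, smul_zero]
  have hxy : QuadraticMap.polar (wittForm P.doubleForm) x y = 0 := by
    refine P.polar_double_eq ?_ ?_
    · rw [map_zero]; exact (polar_map_orthogonal φ _ _).trans hhw
    · rw [map_zero]
      refine (QuadraticMap.polar_smul_left (wittForm q₀) _ _ _).trans ?_
      rw [wittSnd_doubleMk, QuadraticMap.polar_smul_right, hhw, smul_zero, smul_zero]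
  -- The extra factor x_k makes the exponents even. The components are T(φe_k, c⁴ φw) and T(a e_k,
  -- a⁵ w) = T(e_k, a⁶ w), and c⁴ and a⁶ are both 1 modulo I.
  obtain ⟨g₁, g₂, hgg, hg₁, hg₂⟩ := P.exists_pair_of_eichlerMem
    (eichlerMem_cube (P.span_range_doubleForm hq) hqx k (w := x.1 k • y)
      (by rw [QuadraticMap.polar_smul_right, hxy, smul_zero]))
  -- These relative transvections absorb the errors: g₁ = φ h₁ g φ⁻¹ and g₂ = h₂ g. Normality then
  -- allows h₁ and h₂ to be dropped.
  obtain ⟨h₁, hh₁, hhp₁⟩ := (hw.smul (pow_sub_one_mem hcc 2)).exists_mem (q₀ := q₀)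
  obtain ⟨h₂, hh₂, hhp₂⟩ := (hw.smul (pow_sub_one_mem ha 3)).exists_mem (q₀ := q₀)
  have hpol : ∀ b : K, QuadraticMap.polar (wittForm q₀) (hyp K M₀ k) (b • w) = 0 := fun b => by
    rw [QuadraticMap.polar_smul_right, hhw, smul_zero]
  have e1 : g₁ = φ * (h₁ * g) * φ⁻¹ := by
    refine orthogonal_ext fun p => ?_
    rw [hg₁, orthogonal_mul_apply, orthogonal_mul_apply, orthogonal_mul_apply, hgw, hhp₁,
      eichler_add hqh (hpol _) hhw, map_eichler, orthogonal_apply_inv]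
    congr 1
    rw [LinearMap.map_smulₛₗ, LinearMap.map_smulₛₗ, map_pow, hy, wittFst_doubleMk,
      map_add, map_smul]
    change c ^ 3 • c • _ = _
    module
  have e2 : g₂ = h₂ * g := by
    refine orthogonal_ext fun p => ?_
    rw [hg₂, orthogonal_mul_apply, hgw, hhp₂, eichler_add hqh (hpol _) hhw, hx, wittSnd_doubleMk,
      eichler_smul_left]
    congr 1
    rw [LinearMap.map_smulₛₗ, LinearMap.map_smulₛₗ, map_pow, hy, wittSnd_doubleMk]
    have h3 : P.ringSnd ((P.doubleMk e (a • hyp K M₀ k) (hφ _)).1 k) = a := by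
      change (a • hyp K M₀ k).1 k = a
      simp [hyp]
    rw [h3]
    module
  rw [e1, e2] at hgg
  have h4 := hnorm.conj_mem _ (Subgroup.inv_mem _ (P.transvections_subset_relElementary hh₁)) φ
  have h5 := Subgroup.mul_mem _ (Subgroup.mul_mem _ h4 hgg)
    (P.transvections_subset_relElementary hh₂)
  rwa [show φ * h₁⁻¹ * φ⁻¹ * (φ * (h₁ * g) * φ⁻¹ * (h₂ * g)⁻¹) * h₂ = φ * g * φ⁻¹ * g⁻¹ * h₂⁻¹ * h₂
    by group, inv_mul_cancel_right] at h5

theorem commutator_elementary_mem (hq : Ideal.span (Set.range q₀) = ⊤)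
    (hN : ∀ (φ : orthogonalGroup (wittForm q₀)), ∀ v ∈ P.N,
      (φ : WittModule K M₀ ≃ₗ[K] WittModule K M₀) v ∈ P.N)
    {φ : orthogonalGroup (wittForm q₀)} {a : K} (ha : a * a - 1 ∈ P.I)
    (hφ : ∀ v, (φ : WittModule K M₀ ≃ₗ[K] WittModule K M₀) v - a • v ∈ P.N)
    {g : orthogonalGroup (wittForm q₀)} (hg : g ∈ elementaryGroup q₀) :
    φ * g * φ⁻¹ * g⁻¹ ∈ P.relElementary := by
  have hnorm := relElementary_normal hq hN
  unfold elementaryGroup at hg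
  induction hg using Subgroup.closure_induction with
  | mem g hg => exact commutator_transvection_mem hq hN ha hφ hg
  | one =>
    rw [mul_one, mul_inv_cancel, inv_one, one_mul]
    exact Subgroup.one_mem _
  | mul x y _ _ hx hy =>
    have h1 := Subgroup.mul_mem _ hx (hnorm.conj_mem _ hy x)
    rwa [show φ * x * φ⁻¹ * x⁻¹ * (x * (φ * y * φ⁻¹ * y⁻¹) * x⁻¹) =
      φ * (x * y) * φ⁻¹ * (x * y)⁻¹ by group] at h1
  | inv x _ hx =>
    have h1 := hnorm.conj_mem _ (Subgroup.inv_mem _ hx) x⁻¹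
    rwa [show x⁻¹ * (φ * x * φ⁻¹ * x⁻¹)⁻¹ * x⁻¹⁻¹ = φ * x⁻¹ * φ⁻¹ * x⁻¹⁻¹ by group] at h1

end AdmissiblePair

/-! ### The semidiscriminant -/

section Semidisc

variable {K M : Type*} [CommRing K] [AddCommGroup M] [Module K M] {ν : ℕ}

/-- The semidiscriminant of a family of `2ν + 1` vectors. -/
noncomputable def semidisc (q : QuadraticForm K M) (u : Fin (2 * ν + 1) → M) : K :=
  MvPolynomial.aeval (gramValue q u) (halfDet ν)

/-- The Gram matrix of the polar form. -/
def polarMatrix (q : QuadraticForm K M) {ι : Type*} (u : ι → M) : Matrix ι ι K :=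
  Matrix.of fun i j => QuadraticMap.polar q (u i) (u j)

theorem two_mul_semidisc (q : QuadraticForm K M) (u : Fin (2 * ν + 1) → M) :
    2 * semidisc q u = (polarMatrix q u).det := by
  have h := congrArg (MvPolynomial.aeval (gramValue q u)) (two_mul_halfDet ν)
  rw [map_mul, map_ofNat, AlgHom.map_det] at h
  refine h.trans (congrArg _ ?_)
  ext i j
  simp only [AlgHom.mapMatrix_apply, Matrix.map_apply, genericGram, polarMatrix, Matrix.of_apply]
  by_cases hij : i = j
  · subst hij
    rw [if_pos rfl, map_mul, map_ofNat, MvPolynomial.aeval_X, polar_self_eq]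
    simp [gramValue]
  · rw [if_neg hij, MvPolynomial.aeval_X]
    simp [gramValue, hij]

section Semilinear

variable {K' M' : Type*} [CommRing K'] [AddCommGroup M'] [Module K' M'] {σ : K' →+* K}
  {q : QuadraticForm K M} {q' : QuadraticForm K' M'} {f : M' →ₛₗ[σ] M}

theorem gramValue_semilinear (hf : ∀ x, q (f x) = σ (q' x)) {n : ℕ} (u : Fin n → M')
    (s : Sym2 (Fin n)) : gramValue q (fun i => f (u i)) s = σ (gramValue q' u s) := by
  induction s with
  | _ i j =>
    simp only [gramValue, Sym2.lift_mk]
    split_ifs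
    · exact hf _
    · exact polar_semilinear hf _ _

/-- The half-determinant has integer coefficients, so its values are compatible with every ring
homomorphism. -/
theorem semidisc_semilinear (hf : ∀ x, q (f x) = σ (q' x)) (u : Fin (2 * ν + 1) → M') :
    semidisc q (fun i => f (u i)) = σ (semidisc q' u) := by
  have h := MvPolynomial.comp_aeval_apply (f := gramValue q' u) σ.toIntAlgHom (halfDet ν)
  refine Eq.trans ?_ h.symm
  rw [semidisc]
  congr 2
  funext s
  exact gramValue_semilinear hf u s

end Semilinear

/-- Killing the variables of row j annihilates the generic determinant, hence also its half, since
the integer polynomial ring is a domain in which 2 ≠ 0. Every evaluation that vanishes on that row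
factors through this substitution. -/
theorem aeval_halfDet_eq_zero {R : Type*} [CommRing R] {g : Sym2 (Fin (2 * ν + 1)) → R}
    (j : Fin (2 * ν + 1)) (hg : ∀ k, g s(j, k) = 0) :
    MvPolynomial.aeval g (halfDet ν) = 0 := by
  classical
  let κ : MvPolynomial (Sym2 (Fin (2 * ν + 1))) ℤ →ₐ[ℤ] MvPolynomial (Sym2 (Fin (2 * ν + 1))) ℤ :=
    MvPolynomial.aeval fun s => if j ∈ s then 0 else MvPolynomial.X s
  have h1 : κ (halfDet ν) = 0 := by
    have h2 := congrArg κ (two_mul_halfDet ν)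
    rw [map_mul, map_ofNat, AlgHom.map_det, Matrix.det_eq_zero_of_row_eq_zero j] at h2
    · exact (mul_eq_zero.1 h2).resolve_left two_ne_zero
    · intro k
      simp only [AlgHom.mapMatrix_apply, Matrix.map_apply, genericGram, Matrix.of_apply]
      by_cases hjk : j = k
      · subst hjk
        simp [κ]
      · simp [hjk, κ]
  have h2 : (MvPolynomial.aeval g).comp κ = MvPolynomial.aeval (R := ℤ) g := by
    refine MvPolynomial.algHom_ext fun s => ?_
    simp only [AlgHom.comp_apply, κ, MvPolynomial.aeval_X]
    split_ifs with hs
    · obtain ⟨k, rfl⟩ := hs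
      rw [map_zero, hg]
    · rw [MvPolynomial.aeval_X]
  rw [← h2, AlgHom.comp_apply, h1, map_zero]

theorem semidisc_mem {q : QuadraticForm K M} {u : Fin (2 * ν + 1) → M} {I : Ideal K}
    (j : Fin (2 * ν + 1)) (hj : q (u j) ∈ I) (hjk : ∀ k, QuadraticMap.polar q (u j) (u k) ∈ I) :
    semidisc q u ∈ I := by
  rw [← Ideal.Quotient.eq_zero_iff_mem]
  have h := MvPolynomial.comp_aeval_apply (f := gramValue q u)
    (Ideal.Quotient.mk I).toIntAlgHom (halfDet ν)
  refine h.trans (aeval_halfDet_eq_zero j fun k => ?_)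
  refine Ideal.Quotient.eq_zero_iff_mem.2 ?_
  simp only [gramValue, Sym2.lift_mk]
  split_ifs
  exacts [hj, hjk k]

/-- By `semidisc_mem` for a single row, each semidiscriminant already lies in the ideal generated by
the values of q. -/
theorem IsSemiregular.span_range {q : QuadraticForm K M} (hq : IsSemiregular ν q) :
    Ideal.span (Set.range q) = ⊤ := by
  rw [eq_top_iff, ← hq, IsSemiregular] at *
  rw [Ideal.span_le]
  rintro _ ⟨u, rfl⟩
  have h : ∀ x, q x ∈ Ideal.span (Set.range q) := fun x => Ideal.subset_span ⟨x, rfl⟩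
  exact semidisc_mem 0 (h _) fun k => Ideal.sub_mem _ (Ideal.sub_mem _ (h _) (h _)) (h _)

/-! ### Lifting to torsion-free rings -/

/-- The specialization `ℤ[K] → K`. -/
noncomputable def freeLift (K : Type*) [CommRing K] : MvPolynomial K ℤ →+* K :=
  (MvPolynomial.aeval id : MvPolynomial K ℤ →ₐ[ℤ] K).toRingHom

theorem freeLift_X (a : K) : freeLift K (MvPolynomial.X a) = a :=
  MvPolynomial.aeval_X _ _

/-- The semilinear map `∑ xᵢ eᵢ ↦ ∑ xᵢ uᵢ`. -/
noncomputable def liftMap {n : ℕ} (u : Fin n → M) :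
    (Fin n → MvPolynomial K ℤ) →ₛₗ[freeLift K] M where
  toFun x := ∑ i, freeLift K (x i) • u i
  map_add' x y := by
    simp only [Pi.add_apply, map_add, add_smul, Finset.sum_add_distrib]
  map_smul' a x := by
    simp only [Pi.smul_apply, smul_eq_mul, map_mul, mul_smul, Finset.smul_sum]

theorem liftMap_single {n : ℕ} (u : Fin n → M) (i : Fin n) :
    liftMap (K := K) u (Pi.single i 1) = u i := by
  change ∑ j, freeLift K ((Pi.single i 1 : Fin n → MvPolynomial K ℤ) j) • u j = u i
  rw [Finset.sum_eq_single i]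
  · rw [Pi.single_eq_same, map_one, one_smul]
  · intro j _ hj
    rw [Pi.single_eq_of_ne hj, map_zero, zero_smul]
  · simp

theorem toQuadraticForm'_apply {R : Type*} [CommRing R] {n : ℕ} (B : Matrix (Fin n) (Fin n) R)
    (x : Fin n → R) : B.toQuadraticForm' x = dotProduct x (B.mulVec x) := by
  rw [Matrix.toQuadraticForm', LinearMap.BilinMap.toQuadraticMap_apply,
    Matrix.toLinearMap₂'_apply']

/-- A quadratic form on Kⁿ comes from a bilinear form, not necessarily symmetric. Replacing each
entry a of its matrix by the variable X_a gives a form over ℤ[K] specializing to the given one;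
identities proved there by cancelling 2 descend to K. -/
theorem exists_lift (q : QuadraticForm K M) {n : ℕ} (u : Fin n → M) :
    ∃ B : Matrix (Fin n) (Fin n) (MvPolynomial K ℤ),
      ∀ x, q (liftMap u x) = freeLift K (B.toQuadraticForm' x) := by
  obtain ⟨b, hb⟩ := LinearMap.BilinMap.toQuadraticMap_surjective (R := K) (M := Fin n → K)
    (q.comp (Fintype.linearCombination K u))
  refine ⟨(LinearMap.toMatrix₂' K b).map MvPolynomial.X, fun x => ?_⟩
  have h1 : q (liftMap u x) = (q.comp (Fintype.linearCombination K u))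
      (fun i => freeLift K (x i)) := by
    rw [QuadraticMap.comp_apply, Fintype.linearCombination_apply]
    rfl
  rw [h1, ← hb, LinearMap.BilinMap.toQuadraticMap_apply, toQuadraticForm'_apply]
  conv_lhs => rw [← Matrix.toLinearMap₂'_toMatrix' (R := K) b, Matrix.toLinearMap₂'_apply']
  simp only [dotProduct, Matrix.mulVec, map_sum, map_mul, Matrix.map_apply, freeLift_X]

theorem polarMatrix_lift {R : Type*} [CommRing R] {n : ℕ} (B : Matrix (Fin n) (Fin n) R) :
    polarMatrix B.toQuadraticForm' (fun i => Pi.single i 1) = B + B.transpose := by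
  ext i j
  rw [polarMatrix, Matrix.of_apply, Matrix.toQuadraticForm',
    LinearMap.BilinMap.polar_toQuadraticMap]
  simp [Matrix.toLinearMap₂'_apply']

theorem polarMatrix_mul (q : QuadraticForm K M) {ι : Type*} [Fintype ι] (u : ι → M)
    (A : Matrix ι ι K) :
    polarMatrix q (fun i => ∑ j, A i j • u j) = A * polarMatrix q u * A.transpose := by
  ext i j
  simp only [polarMatrix, Matrix.of_apply, Matrix.mul_apply, Matrix.transpose_apply]
  change QuadraticMap.polarBilin q _ _ = _
  simp only [map_sum, LinearMap.sum_apply, map_smul, LinearMap.smul_apply, smul_eq_mul,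
    QuadraticMap.polarBilin_apply_apply, Finset.mul_sum, Finset.sum_mul]
  refine Finset.sum_congr rfl fun k _ => Finset.sum_congr rfl fun l _ => ?_
  ring

theorem semidisc_mul_of_torsionFree {R N : Type*} [CommRing R] [IsDomain R] [CharZero R]
    [AddCommGroup N] [Module R N] (q : QuadraticForm R N) (u : Fin (2 * ν + 1) → N)
    (A : Matrix (Fin (2 * ν + 1)) (Fin (2 * ν + 1)) R) :
    semidisc q (fun i => ∑ j, A i j • u j) = A.det ^ 2 * semidisc q u := by
  refine mul_left_cancel₀ (two_ne_zero (α := R)) ?_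
  rw [two_mul_semidisc, polarMatrix_mul, Matrix.det_mul, Matrix.det_mul, Matrix.det_transpose,
    ← two_mul_semidisc]
  ring

/-- The semidiscriminant of a transformed family. -/
theorem semidisc_mul (q : QuadraticForm K M) (u : Fin (2 * ν + 1) → M)
    (A : Matrix (Fin (2 * ν + 1)) (Fin (2 * ν + 1)) K) :
    semidisc q (fun i => ∑ j, A i j • u j) = A.det ^ 2 * semidisc q u := by
  obtain ⟨B, hB⟩ := exists_lift q u
  have h1 := congrArg (freeLift K) (semidisc_mul_of_torsionFree B.toQuadraticForm'
    (fun i => Pi.single i 1) (A.map MvPolynomial.X))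
  rw [map_mul, map_pow, ← semidisc_semilinear hB, ← semidisc_semilinear hB, RingHom.map_det] at h1
  simp only [map_sum, LinearMap.map_smulₛₗ, liftMap_single, Matrix.map_apply, freeLift_X] at h1
  rw [h1]
  congr 3
  ext i j
  simp [freeLift_X]

/-- A form of Euler's identity for the semidiscriminant. -/
theorem exists_card_mul_semidisc (q : QuadraticForm K M) (u : Fin (2 * ν + 1) → M) :
    ∃ B : Matrix (Fin (2 * ν + 1)) (Fin (2 * ν + 1)) K,
      (2 * ν + 1 : K) * semidisc q u = (B * (polarMatrix q u).adjugate).trace := by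
  obtain ⟨B, hB⟩ := exists_lift q u
  refine ⟨B.map (freeLift K), ?_⟩
  set e : Fin (2 * ν + 1) → Fin (2 * ν + 1) → MvPolynomial K ℤ := fun i => Pi.single i 1
  set G := polarMatrix B.toQuadraticForm' e with hG
  have hG' : G = B + B.transpose := polarMatrix_lift B
  have hadj : G.adjugate.transpose = G.adjugate := by
    rw [Matrix.adjugate_transpose, hG', Matrix.transpose_add, Matrix.transpose_transpose,
      add_comm B.transpose]
  have h1 : (2 * ν + 1 : MvPolynomial K ℤ) * semidisc B.toQuadraticForm' e =
      (B * G.adjugate).trace := by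
    refine mul_left_cancel₀ (two_ne_zero (α := MvPolynomial K ℤ)) ?_
    -- With G = B + Bᵀ and symmetric adjugate, tr(G adj G) = 2 tr(B adj G), while it is also n det
    -- G, that is 2n times the semidiscriminant.
    have h2 : (B.transpose * G.adjugate).trace = (B * G.adjugate).trace := by
      rw [← Matrix.trace_transpose, Matrix.transpose_mul, Matrix.transpose_transpose, hadj,
        Matrix.trace_mul_comm]
    have h3 : (G * G.adjugate).trace = 2 * (B * G.adjugate).trace := by
      conv_lhs => rw [hG', Matrix.add_mul, Matrix.trace_add, ← hG', h2]
      ring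
    rw [← h3, Matrix.mul_adjugate, Matrix.trace_smul, Matrix.trace_one, hG, ← two_mul_semidisc]
    simp
    ring
  have h2 := congrArg (freeLift K) h1
  rw [map_mul, ← semidisc_semilinear hB] at h2
  have h3 : (freeLift K).mapMatrix G = polarMatrix q u := by
    ext i j
    simp only [RingHom.mapMatrix_apply, Matrix.map_apply, hG, polarMatrix, Matrix.of_apply]
    rw [← polar_semilinear hB]
    simp only [e, liftMap_single]
  simp only [e, liftMap_single] at h2
  rw [map_add, map_mul, map_ofNat, map_natCast, map_one] at h2
  rw [h2, ← h3, ← RingHom.map_adjugate]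
  simp [Matrix.trace, Matrix.mul_apply]

/-! ### Semiregularity of the Witt module -/

variable {M₀ : Type*} [AddCommGroup M₀] [Module K M₀] {q₀ : QuadraticForm K M₀}

/-- The Gram matrix of the hyperbolic coordinates. -/
def hypMatrix (K : Type*) [CommRing K] : Matrix Idx Idx K :=
  Matrix.of fun i j => if i = -j then 1 else 0

theorem hypMatrix_mul_self (K : Type*) [CommRing K] : hypMatrix K * hypMatrix K = 1 := by
  ext i j
  rw [Matrix.mul_apply]
  simp only [hypMatrix, Matrix.of_apply, Matrix.one_apply, mul_ite, mul_one, mul_zero]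
  rw [Finset.sum_eq_single (-j)]
  · simp [idx_neg_neg]
  · intro k _ hk
    rw [if_neg hk]
  · simp

/-- The standard hyperbolic vectors followed by a family in `M₀`. -/
def wittFamily {n : ℕ} (u : Fin n → M₀) : Idx ⊕ Fin n → WittModule K M₀ :=
  Sum.elim (hyp K M₀) fun k => aniso K (u k)

theorem polarMatrix_wittFamily (q₀ : QuadraticForm K M₀) {n : ℕ} (u : Fin n → M₀) :
    polarMatrix (wittForm q₀) (wittFamily u) =
      Matrix.fromBlocks (hypMatrix K) 0 0 (polarMatrix q₀ u) := by
  ext i j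
  rcases i with i | i <;> rcases j with j | j
  · simp only [polarMatrix, wittFamily, Matrix.of_apply, Sum.elim_inl, Matrix.fromBlocks_apply₁₁,
      hypMatrix, polar_hyp_right, hyp_fst_apply]
    simp only [eq_comm]
  · simp only [polarMatrix, wittFamily, Matrix.of_apply, Sum.elim_inl, Sum.elim_inr,
      Matrix.fromBlocks_apply₁₂, polar_hyp_left]
    rfl
  · simp only [polarMatrix, wittFamily, Matrix.of_apply, Sum.elim_inl, Sum.elim_inr,
      Matrix.fromBlocks_apply₂₁, polar_hyp_right]
    rfl
  · simp only [polarMatrix, wittFamily, Matrix.of_apply, Sum.elim_inr,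
      Matrix.fromBlocks_apply₂₂, polar_aniso_left]
    rfl

theorem semidisc_wittFamily_of_torsionFree {R N : Type*} [CommRing R] [IsDomain R] [CharZero R]
    [AddCommGroup N] [Module R N] (q : QuadraticForm R N) (u : Fin (2 * ν + 1) → N)
    (e : Fin (2 * (ν + 2) + 1) ≃ Idx ⊕ Fin (2 * ν + 1)) :
    semidisc (wittForm q) (fun i => wittFamily u (e i)) = (hypMatrix R).det * semidisc q u := by
  refine mul_left_cancel₀ (two_ne_zero (α := R)) ?_
  have h : polarMatrix (wittForm q) (fun i => wittFamily u (e i)) =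
      (polarMatrix (wittForm q) (wittFamily u)).submatrix e e := rfl
  rw [two_mul_semidisc, h, Matrix.det_submatrix_equiv_self, polarMatrix_wittFamily,
    Matrix.det_fromBlocks_zero₂₁, ← two_mul_semidisc]
  ring

theorem semidisc_wittFamily (q₀ : QuadraticForm K M₀) (u : Fin (2 * ν + 1) → M₀)
    (e : Fin (2 * (ν + 2) + 1) ≃ Idx ⊕ Fin (2 * ν + 1)) :
    semidisc (wittForm q₀) (fun i => wittFamily u (e i)) =
      (hypMatrix K).det * semidisc q₀ u := by
  obtain ⟨B, hB⟩ := exists_lift q₀ u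
  have h1 := congrArg (freeLift K) (semidisc_wittFamily_of_torsionFree B.toQuadraticForm'
    (fun i => Pi.single i 1) e)
  rw [map_mul, ← semidisc_semilinear hB, ← semidisc_semilinear (wittForm_wittMap hB),
    RingHom.map_det] at h1
  have h2 : (freeLift K).mapMatrix (hypMatrix _) = hypMatrix K := by
    ext i j
    simp only [RingHom.mapMatrix_apply, Matrix.map_apply, hypMatrix, Matrix.of_apply]
    split_ifs <;> simp
  have h3 : ∀ i, wittMap (liftMap (K := K) u) (wittFamily (fun i => Pi.single i 1) i) =
      wittFamily u i := by
    rintro (i | i)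
    · exact wittMap_hyp _ _
    · refine (wittMap_aniso _ _).trans ?_
      rw [liftMap_single]
      rfl
  simp only [h2, h3, liftMap_single] at h1
  exact h1

/-- Adjoining the hyperbolic vectors multiplies each semidiscriminant by the determinant of the
hyperbolic Gram matrix. That matrix squares to 1, so the factor is a unit. -/
theorem IsSemiregular.wittForm (hq : IsSemiregular ν q₀) :
    IsSemiregular (ν + 2) (wittForm q₀) := by
  rw [IsSemiregular, eq_top_iff, ← hq, Ideal.span_le]
  rintro _ ⟨u, rfl⟩
  have hcard : Fintype.card (Fin (2 * (ν + 2) + 1)) = Fintype.card (Idx ⊕ Fin (2 * ν + 1)) := by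
    rw [Fintype.card_fin, Fintype.card_sum, Fintype.card_fin]
    change _ = 4 + _
    ring
  have h1 := semidisc_wittFamily q₀ u (Fintype.equivOfCardEq hcard)
  have h2 : (hypMatrix K).det * (hypMatrix K).det = 1 := by
    rw [← Matrix.det_mul, hypMatrix_mul_self, Matrix.det_one]
  have h3 : semidisc q₀ u = (hypMatrix K).det *
      semidisc (OddOrthogonal.wittForm q₀)
        (fun i => wittFamily u (Fintype.equivOfCardEq hcard i)) := by
    rw [h1, ← mul_assoc, h2, one_mul]
  change semidisc q₀ u ∈ _
  rw [h3]
  exact Ideal.mul_mem_left _ _ (Ideal.subset_span ⟨_, rfl⟩)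

end Semidisc

/-! ### Local bases -/

section Local

variable {K M : Type*} [CommRing K] [AddCommGroup M] [Module K M] {ν : ℕ}

theorem polar_mem_of_mem_smul_top (q : QuadraticForm K M) {I : Ideal K} {w : M}
    (hw : w ∈ I • (⊤ : Submodule K M)) (x : M) : QuadraticMap.polar q w x ∈ I := by
  induction hw using Submodule.smul_induction_on' with
  | smul a ha y _ =>
    rw [QuadraticMap.polar_smul_left]
    exact I.mul_mem_right _ ha
  | add y _ z _ hy hz =>
    rw [QuadraticMap.polar_add_left]
    exact I.add_mem hy hz

theorem form_mem_of_mem_smul_top (q : QuadraticForm K M) {I : Ideal K} {w : M}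
    (hw : w ∈ I • (⊤ : Submodule K M)) : q w ∈ I := by
  induction hw using Submodule.smul_induction_on' with
  | smul a ha y _ =>
    rw [QuadraticMap.map_smul]
    exact I.mul_mem_right _ (I.mul_mem_right _ ha)
  | add y hy z _ hy' hz' =>
    rw [QuadraticMap.map_add q]
    exact I.add_mem (I.add_mem hy' hz') (polar_mem_of_mem_smul_top q hy z)

theorem mem_smul_top_of_tmul_eq_zero {m : Ideal K} {w : M}
    (h : (1 : K ⧸ m) ⊗ₜ[K] w = 0) : w ∈ m • (⊤ : Submodule K M) := by
  have h1 := congrArg (TensorProduct.quotTensorEquivQuotSMul M m) h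
  rw [map_zero] at h1
  have h2 := TensorProduct.quotTensorEquivQuotSMul_mk_tmul m (1 : K) w
  rw [map_one, h1, one_smul] at h2
  exact (Submodule.Quotient.mk_eq_zero _).1 h2.symm

theorem finrank_residue [Module.Finite K M] [Module.Projective K M] {n : ℕ}
    (hrank : ∀ p : PrimeSpectrum K, Module.rankAtStalk M p = n) (m : Ideal K) [m.IsMaximal] :
    Module.finrank (K ⧸ m) ((K ⧸ m) ⊗[K] M) = n := by
  let := Ideal.Quotient.field m
  have h1 := Module.rankAtStalk_baseChange (R := K) (M := M) (S := K ⧸ m) ⊥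
  rw [hrank, Module.rankAtStalk_eq_finrank_of_free] at h1
  exact h1

/-- A family whose semidiscriminant is nonzero modulo `m` is independent modulo `m`. -/
theorem linearIndependent_of_semidisc_notMem (q : QuadraticForm K M) {m : Ideal K} [m.IsMaximal]
    {u : Fin (2 * ν + 1) → M} (hu : semidisc q u ∉ m) :
    LinearIndependent (K ⧸ m) fun i => (1 : K ⧸ m) ⊗ₜ[K] u i := by
  rw [Fintype.linearIndependent_iff]
  intro c hc j
  choose c' hc' using fun i => Ideal.Quotient.mk_surjective (I := m) (c i)
  have hw : ∑ i, c' i • u i ∈ m • (⊤ : Submodule K M) := by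
    apply mem_smul_top_of_tmul_eq_zero
    rw [TensorProduct.tmul_sum, ← hc]
    refine Finset.sum_congr rfl fun i _ => ?_
    rw [TensorProduct.tmul_smul, ← hc' i]
    rfl
  -- Replacing u_j by the relation vector, which lies in mM, multiplies the semidiscriminant by the
  -- square of the j-th coefficient and also puts it into m.
  have h1 := semidisc_mul q u (Matrix.updateRow 1 j c')
  have hdet : (Matrix.updateRow (1 : Matrix (Fin (2 * ν + 1)) (Fin (2 * ν + 1)) K) j c').det =
      c' j := by
    rw [← Matrix.cramer_transpose_apply, Matrix.transpose_one, Matrix.cramer_one]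
    rfl
  have h2 : semidisc q (fun i => ∑ k, Matrix.updateRow (1 : Matrix _ _ K) j c' i k • u k) ∈ m := by
    have hj : ∑ k, Matrix.updateRow (1 : Matrix _ _ K) j c' j k • u k = ∑ k, c' k • u k := by
      rw [Matrix.updateRow_self]
    refine semidisc_mem j ?_ fun k => ?_
    · rw [hj]; exact form_mem_of_mem_smul_top q hw
    · rw [hj]; exact polar_mem_of_mem_smul_top q hw _
  rw [h1, hdet] at h2
  have hp : m.IsPrime := inferInstance
  rw [← hc' j]
  exact Ideal.Quotient.eq_zero_iff_mem.2
    (hp.mem_of_pow_mem 2 ((hp.mem_or_mem h2).resolve_right hu))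

/-- A family whose semidiscriminant is nonzero modulo `m` is a basis locally at `m`. -/
theorem exists_local_coordinates [Module.Finite K M] [Module.Projective K M]
    (hrank : ∀ p : PrimeSpectrum K, Module.rankAtStalk M p = 2 * ν + 1) (q : QuadraticForm K M)
    (m : Ideal K) [m.IsMaximal] {u : Fin (2 * ν + 1) → M} (hu : semidisc q u ∉ m) :
    ∃ s ∉ m, ∃ A : M →ₗ[K] (Fin (2 * ν + 1) → K), ∀ x, ∑ k, A x k • u k = s • x := by
  have hli := linearIndependent_of_semidisc_notMem q hu
  have htop : Submodule.span (K ⧸ m) (Set.range fun i => (1 : K ⧸ m) ⊗ₜ[K] u i) = ⊤ := by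
    let := Ideal.Quotient.field m
    refine LinearIndependent.span_eq_top_of_card_eq_finrank' hli ?_
    rw [finrank_residue hrank, Fintype.card_fin]
  set F : (Fin (2 * ν + 1) → K) →ₗ[K] M := Fintype.linearCombination K u with hF
  have hFa : ∀ a, F a = ∑ k, a k • u k := fun a => Fintype.linearCombination_apply K u a
  have hspan : ∀ x, ∃ a, x - F a ∈ m • (⊤ : Submodule K M) := by
    intro x
    have hx : (1 : K ⧸ m) ⊗ₜ[K] x ∈
        Submodule.span (K ⧸ m) (Set.range fun i => (1 : K ⧸ m) ⊗ₜ[K] u i) := by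
      rw [htop]; exact Submodule.mem_top
    obtain ⟨c, hc⟩ := (Submodule.mem_span_range_iff_exists_fun _).1 hx
    choose c' hc' using fun i => Ideal.Quotient.mk_surjective (I := m) (c i)
    refine ⟨c', mem_smul_top_of_tmul_eq_zero ?_⟩
    rw [TensorProduct.tmul_sub, hFa, TensorProduct.tmul_sum, ← hc, sub_eq_zero]
    refine Finset.sum_congr rfl fun i _ => ?_
    rw [TensorProduct.tmul_smul, ← hc' i]
    rfl
  -- Nakayama's lemma for the cokernel of F: some r ≡ 1 modulo m kills it. Projectivity of M then
  -- lifts multiplication by r through F.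
  obtain ⟨r, hr, hrx⟩ := Submodule.exists_sub_one_mem_and_smul_eq_zero_of_fg_of_le_smul m
    (⊤ : Submodule K (M ⧸ LinearMap.range F)) Module.Finite.fg_top (by
      rintro y -
      obtain ⟨x, rfl⟩ := Submodule.mkQ_surjective _ y
      obtain ⟨a, ha⟩ := hspan x
      have h1 : (LinearMap.range F).mkQ x = (LinearMap.range F).mkQ (x - F a) := by
        rw [map_sub, eq_comm, sub_eq_self]
        exact (Submodule.Quotient.mk_eq_zero _).2 ⟨a, rfl⟩
      rw [h1]
      have h2 := Submodule.mem_map_of_mem (f := (LinearMap.range F).mkQ) ha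
      rw [Submodule.map_smul''] at h2
      exact Submodule.smul_mono le_rfl le_top h2)
  have hmem : ∀ x, r • x ∈ LinearMap.range F := by
    intro x
    rw [← Submodule.Quotient.mk_eq_zero]
    exact hrx (Submodule.Quotient.mk x) Submodule.mem_top
  obtain ⟨A, hA⟩ := Module.projective_lifting_property F.rangeRestrict
    ((LinearMap.lsmul K M r).codRestrict _ hmem) F.surjective_rangeRestrict
  refine ⟨r, fun hrm => ?_, A, fun x => ?_⟩
  · have h1 := m.sub_mem hrm hr
    rw [sub_sub_cancel] at h1
    exact Ideal.IsPrime.ne_top' ((Ideal.eq_top_iff_one m).2 h1)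
  · rw [← hFa]
    exact congrArg Subtype.val (LinearMap.congr_fun hA x)

theorem mulVec_mem {n : ℕ} {I : Ideal K} (A : Matrix (Fin n) (Fin n) K) {v : Fin n → K}
    (hv : ∀ l, v l ∈ I) (k : Fin n) : A.mulVec v k ∈ I := by
  rw [Matrix.mulVec, dotProduct]
  exact Ideal.sum_mem _ fun l _ => I.mul_mem_left (A k l) (hv l)

/-- Locally, the vectors orthogonal to everything modulo `I` form a line modulo `I M`. -/
theorem exists_local_radical_line [Module.Finite K M] [Module.Projective K M]
    (hrank : ∀ p : PrimeSpectrum K, Module.rankAtStalk M p = 2 * ν + 1) {q : QuadraticForm K M}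
    (hq : IsSemiregular ν q) (I m : Ideal K) [hm : m.IsMaximal] :
    ∃ t ∉ m, ∃ (z : M) (π : M →ₗ[K] K), ∀ x, (∀ y, QuadraticMap.polar q x y ∈ I) →
      t • x - π x • z ∈ I • (⊤ : Submodule K M) := by
  have hp : m.IsPrime := inferInstance
  obtain ⟨u, hu⟩ : ∃ u : Fin (2 * ν + 1) → M, semidisc q u ∉ m := by
    by_contra! hcon
    refine hm.ne_top (top_le_iff.1 ?_)
    rw [← hq, Ideal.span_le]
    rintro _ ⟨u, rfl⟩
    exact hcon u
  obtain ⟨s, hs, A, hA⟩ := exists_local_coordinates hrank q m hu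
  set G := polarMatrix q u with hG
  have hGA : ∀ x, (∀ y, QuadraticMap.polar q x y ∈ I) → ∀ i, (G.mulVec (A x)) i ∈ I := by
    intro x hx i
    have h1 : (G.mulVec (A x)) i = s * QuadraticMap.polar q x (u i) := by
      rw [QuadraticMap.polar_comm, ← smul_eq_mul s,
        ← QuadraticMap.polar_smul_right, ← hA]
      change _ = QuadraticMap.polarBilin q (u i) _
      simp only [map_sum, map_smul, Matrix.mulVec, dotProduct, hG, polarMatrix, Matrix.of_apply,
        QuadraticMap.polarBilin_apply_apply, smul_eq_mul, mul_comm]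
    rw [h1]
    exact I.mul_mem_left _ (hx _)
  have hcomb : ∀ {a : Fin (2 * ν + 1) → K}, (∀ k, a k ∈ I) →
      ∑ k, a k • u k ∈ I • (⊤ : Submodule K M) := fun ha =>
    Submodule.sum_mem _ fun k _ => Submodule.smul_mem_smul (ha k) Submodule.mem_top
  -- If 2 ∈ m, the odd number n is a unit at m, and Euler's identity forces an adjugate entry
  -- outside m, so the Gram matrix has corank at most one modulo m. If 2 ∉ m, its determinant is
  -- outside m and the radical is zero modulo I locally.
  by_cases h2 : (2 : K) ∈ m
  · obtain ⟨j, i, hij⟩ : ∃ j i, G.adjugate j i ∉ m := by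
      by_contra! hcon
      obtain ⟨B, hB⟩ := exists_card_mul_semidisc q u
      have h3 : (2 * ν + 1 : K) * semidisc q u ∈ m := by
        rw [hB]
        refine Ideal.sum_mem _ fun k _ => ?_
        rw [Matrix.diag_apply, Matrix.mul_apply]
        exact Ideal.sum_mem _ fun l _ => m.mul_mem_left _ (hcon l k)
      have h4 := (hp.mem_or_mem h3).resolve_right hu
      have h5 := m.sub_mem h4 (m.mul_mem_right (ν : K) h2)
      rw [add_sub_cancel_left] at h5
      exact hm.ne_top ((Ideal.eq_top_iff_one m).2 h5)
    -- Trading row i for the j-th coordinate functional gives a matrix whose determinant is the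
    -- chosen adjugate entry. Cramer's rule then recovers all coordinates of x modulo I from its
    -- j-th coordinate alone.
    set G' := G.updateRow i (Pi.single j 1) with hG'
    have hdet : G'.det = G.adjugate j i := (Matrix.adjugate_apply G j i).symm
    refine ⟨G'.det * s, fun h => (hp.mem_or_mem h).elim (hdet ▸ hij) hs,
      ∑ k, G'.adjugate k i • u k, LinearMap.proj j ∘ₗ A, fun x hx => ?_⟩
    have h3 : ∀ k, G'.det * A x k - A x j * G'.adjugate k i ∈ I := by
      intro k
      have h4 : G'.det * A x k = (G'.adjugate.mulVec (G'.mulVec (A x))) k := by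
        rw [Matrix.mulVec_mulVec, Matrix.adjugate_mul, Matrix.smul_mulVec, Matrix.one_mulVec]
        rfl
      have h5 : G'.adjugate.mulVec (Pi.single i (A x j)) k = A x j * G'.adjugate k i := by
        rw [Matrix.mulVec_single]
        simp [mul_comm]
      rw [h4, ← h5, ← Pi.sub_apply, ← Matrix.mulVec_sub]
      refine mulVec_mem _ (fun l => ?_) k
      rw [Pi.sub_apply]
      by_cases hl : l = i
      · subst hl
        rw [Pi.single_eq_same, Matrix.mulVec, hG', Matrix.updateRow_self, single_one_dotProduct,
          sub_self]
        exact I.zero_mem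
      · rw [Pi.single_eq_of_ne hl, sub_zero, Matrix.mulVec, hG', Matrix.updateRow_ne hl]
        exact hGA x hx l
    have h4 := hcomb h3
    rw [mul_smul, ← hA, LinearMap.comp_apply, LinearMap.proj_apply]
    simp only [sub_smul, mul_smul, Finset.sum_sub_distrib, ← Finset.smul_sum] at h4
    exact h4
  · refine ⟨2 * semidisc q u * s, fun h => ?_, 0, 0, fun x hx => ?_⟩
    · rcases hp.mem_or_mem h with h | h
      · exact (hp.mem_or_mem h).elim h2 hu
      · exact hs h
    · rw [smul_zero, sub_zero, mul_smul, ← hA, Finset.smul_sum]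
      simp only [smul_smul]
      refine hcomb fun k => ?_
      have h4 : 2 * semidisc q u * A x k = (G.adjugate.mulVec (G.mulVec (A x))) k := by
        rw [Matrix.mulVec_mulVec, Matrix.adjugate_mul, Matrix.smul_mulVec, Matrix.one_mulVec,
          two_mul_semidisc]
        rfl
      rw [h4]
      exact mulVec_mem _ (hGA x hx) k

/-- Isometries stabilize the lines in the radical modulo `I`. -/
theorem orthogonal_apply_mem_of_radical [Module.Finite K M] [Module.Projective K M]
    (hrank : ∀ p : PrimeSpectrum K, Module.rankAtStalk M p = 2 * ν + 1) {q : QuadraticForm K M}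
    (hq : IsSemiregular ν q) {I : Ideal K} (φ : orthogonalGroup q) {x : M}
    (hx : ∀ y, QuadraticMap.polar q x y ∈ I) :
    (φ : M ≃ₗ[K] M) x ∈ Submodule.span K {x} ⊔ I • (⊤ : Submodule K M) := by
  set L := Submodule.span K {x} ⊔ I • (⊤ : Submodule K M) with hL
  have hIL : ∀ {w}, w ∈ I • (⊤ : Submodule K M) → w ∈ L := fun h => Submodule.mem_sup_right h
  have hxL : x ∈ L := Submodule.mem_sup_left (Submodule.mem_span_singleton_self x)
  have hφI : ∀ {w}, w ∈ I • (⊤ : Submodule K M) →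
      (φ : M ≃ₗ[K] M) w ∈ I • (⊤ : Submodule K M) := by
    intro w hw
    have h1 := Submodule.mem_map_of_mem (f := ((φ : M ≃ₗ[K] M) : M →ₗ[K] M)) hw
    rw [Submodule.map_smul''] at h1
    exact Submodule.smul_mono le_rfl le_top h1
  have hφr : ∀ {w}, (∀ y, QuadraticMap.polar q w y ∈ I) →
      ∀ y, QuadraticMap.polar q ((φ : M ≃ₗ[K] M) w) y ∈ I := by
    intro w hw y
    rw [← orthogonal_apply_inv φ y, polar_map_orthogonal]
    exact hw _
  -- Membership of φx in L is a local question: no maximal ideal may contain the ideal of scalars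
  -- moving φx into L.
  let J : Ideal K := L.colon {(φ : M ≃ₗ[K] M) x}
  have hJ : J = ⊤ := by
    by_contra hne
    obtain ⟨m, hm, hJm⟩ := Ideal.exists_le_maximal J hne
    obtain ⟨t, ht, z, π, hz⟩ := exists_local_radical_line hrank hq I m
    have htt : t * t ∈ J := by
      rw [Submodule.mem_colon_singleton]
      have h1 := hz x hx
      have hxr : ∀ y, QuadraticMap.polar q (π x • z) y ∈ I := by
        intro y
        have h2 : π x • z = t • x - (t • x - π x • z) := by abel
        rw [h2, QuadraticMap.polar_sub_left, QuadraticMap.polar_smul_left]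
        exact I.sub_mem (I.mul_mem_left _ (hx y)) (polar_mem_of_mem_smul_top q h1 y)
      have h2 := hz _ (hφr hxr)
      -- Modulo IM, t x ≡ π(x) z and t φ(π(x) z) ≡ π(φ(π(x) z)) z. By linearity the last term is
      -- π(φz) π(x) z ≡ π(φz) t x, a multiple of x.
      have h3 : (t * t) • (φ : M ≃ₗ[K] M) x = t • (φ : M ≃ₗ[K] M) (t • x - π x • z) +
          (t • (φ : M ≃ₗ[K] M) (π x • z) - π ((φ : M ≃ₗ[K] M) (π x • z)) • z) +
          π ((φ : M ≃ₗ[K] M) z) • (t • x - (t • x - π x • z)) := by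
        simp only [map_sub, map_smul, smul_eq_mul]
        module
      rw [h3]
      refine L.add_mem (L.add_mem (L.smul_mem _ (hIL (hφI h1))) (hIL h2)) (L.smul_mem _ ?_)
      exact L.sub_mem (L.smul_mem _ hxL) (hIL h1)
    have hp : m.IsPrime := inferInstance
    exact (hp.mem_or_mem (hJm htt)).elim ht ht
  have h1 : (1 : K) ∈ J := by rw [hJ]; exact Submodule.mem_top
  rw [Submodule.mem_colon_singleton, one_smul] at h1
  exact h1

end Local

/-! ### Invariance of `N` under isometries -/

section WittRank

variable {K M₀ : Type*} [CommRing K] [AddCommGroup M₀] [Module K M₀] {ν : ℕ}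

theorem rankAtStalk_wittModule [Module.Finite K M₀] [Module.Projective K M₀]
    (hrank : ∀ p : PrimeSpectrum K, Module.rankAtStalk M₀ p = 2 * ν + 1) (p : PrimeSpectrum K) :
    Module.rankAtStalk (WittModule K M₀) p = 2 * (ν + 2) + 1 := by
  have : Nontrivial K := p.nontrivial
  rw [Module.rankAtStalk_prod, Pi.add_apply, hrank, Module.rankAtStalk_eq_finrank_of_free,
    Pi.natCast_apply, Module.finrank_fintype_fun_eq_card]
  change 4 + _ = _
  ring

/-- Admissibility puts every v ∈ N into the radical modulo I, so φv ∈ Kv + IM, and this submodule is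
contained in N. -/
theorem AdmissiblePair.orthogonal_apply_mem [Module.Finite K M₀] [Module.Projective K M₀]
    (hrank : ∀ p : PrimeSpectrum K, Module.rankAtStalk M₀ p = 2 * ν + 1)
    {q₀ : QuadraticForm K M₀} (hq : IsSemiregular ν q₀) (P : AdmissiblePair q₀)
    (φ : orthogonalGroup (wittForm q₀)) (v : WittModule K M₀) (hv : v ∈ P.N) :
    (φ : WittModule K M₀ ≃ₗ[K] WittModule K M₀) v ∈ P.N := by
  have hr : ∀ y, QuadraticMap.polar (wittForm q₀) v y ∈ P.I := by
    intro y
    rw [polar_wittForm, QuadraticMap.polar_comm]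
    have h1 := fun i j => P.I.mul_mem_right (y.1 j) (hv.1 i)
    exact P.I.add_mem (P.I.add_mem (P.polar_mem _ _ hv.2) (P.I.add_mem (h1 _ _) (h1 _ _)))
      (P.I.add_mem (h1 _ _) (h1 _ _))
  have h1 := orthogonal_apply_mem_of_radical (rankAtStalk_wittModule hrank) hq.wittForm φ hr
  refine (sup_le ?_ ?_ : _ ≤ P.N) h1
  · rw [Submodule.span_singleton_le_iff_mem]; exact hv
  · rw [Submodule.smul_le]
    exact fun a ha w _ => P.smul_mem ha w

end WittRank

/-! ### Determinants of isometries -/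

section Det

theorem det_one_add_comp {R V W : Type*} [CommRing R] [AddCommGroup V] [Module R V]
    [AddCommGroup W] [Module R W] [Module.Free R V] [Module.Finite R V] [Module.Free R W]
    [Module.Finite R W] (g : V →ₗ[R] W) (h : W →ₗ[R] V) :
    LinearMap.det (LinearMap.id + g ∘ₗ h) = LinearMap.det (LinearMap.id + h ∘ₗ g) := by
  classical
  let b := Module.Free.chooseBasis R V
  let c := Module.Free.chooseBasis R W
  rw [← LinearMap.det_toMatrix c, ← LinearMap.det_toMatrix b, map_add, map_add,
    LinearMap.toMatrix_id, LinearMap.toMatrix_id, LinearMap.toMatrix_comp c b c,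
    LinearMap.toMatrix_comp b c b, Matrix.det_one_add_mul_comm]

/-- After identifying V with W, determinants multiply, and those of F and A together give the power
of s. Thus s may be a mere near-inverse factor, with no inverse of A or F required. -/
theorem det_comp_comp_of_comp_eq_smul {R V W : Type*} [CommRing R] [Nontrivial R]
    [AddCommGroup V] [Module R V]
    [AddCommGroup W] [Module R W] [Module.Free R V] [Module.Finite R V] [Module.Free R W]
    [Module.Finite R W] (hVW : Module.finrank R V = Module.finrank R W) (A : V →ₗ[R] W)
    (F : W →ₗ[R] V) (s : R) (hs : F ∘ₗ A = s • LinearMap.id) (ψ : V →ₗ[R] V) :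
    LinearMap.det (A ∘ₗ ψ ∘ₗ F) = s ^ Module.finrank R W * LinearMap.det ψ := by
  let e : V ≃ₗ[R] W := LinearEquiv.ofFinrankEq V W hVW
  have h1 : A ∘ₗ ψ ∘ₗ F = (A ∘ₗ (e.symm : W →ₗ[R] V)) ∘ₗ
      ((e : V →ₗ[R] W) ∘ₗ ψ ∘ₗ (e.symm : W →ₗ[R] V)) ∘ₗ ((e : V →ₗ[R] W) ∘ₗ F) := by
    ext x
    simp
  have h2 : ((e : V →ₗ[R] W) ∘ₗ F) ∘ₗ (A ∘ₗ (e.symm : W →ₗ[R] V)) = s • LinearMap.id := by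
    ext x
    have h3 := LinearMap.congr_fun hs (e.symm x)
    simp only [LinearMap.comp_apply, LinearMap.smul_apply, LinearMap.id_apply] at h3
    simp [h3]
  have h4 := congrArg LinearMap.det h2
  rw [LinearMap.det_comp, LinearMap.det_smul, LinearMap.det_id, mul_one] at h4
  rw [h1, LinearMap.det_comp, LinearMap.det_comp, ← h4]
  have h5 : LinearMap.det ((e : V →ₗ[R] W) ∘ₗ ψ ∘ₗ (e.symm : W →ₗ[R] V)) = LinearMap.det ψ :=
    LinearMap.det_conj ψ e
  rw [h5]
  ring

variable {K M : Type*} [CommRing K] [AddCommGroup M] [Module K M] {ν : ℕ}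

theorem free_localization [Module.Finite K M] [Module.Projective K M] (m : Ideal K)
    [m.IsMaximal] : Module.Free (Localization.AtPrime m) (Localization.AtPrime m ⊗[K] M) :=
  Module.free_of_flat_of_isLocalRing

theorem finrank_localization [Module.Finite K M] [Module.Projective K M] {n : ℕ}
    (hrank : ∀ p : PrimeSpectrum K, Module.rankAtStalk M p = n) (m : Ideal K) [hm : m.IsMaximal] :
    Module.finrank (Localization.AtPrime m) (Localization.AtPrime m ⊗[K] M) = n := by
  rw [← hrank ⟨m, hm.isPrime⟩, Module.rankAtStalk_eq_finrank_tensorProduct]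

theorem det_baseChange_smul [Module.Finite K M] [Module.Projective K M] {n : ℕ}
    (hrank : ∀ p : PrimeSpectrum K, Module.rankAtStalk M p = n) (a : K) (ψ : M →ₗ[K] M)
    (m : Ideal K) [m.IsMaximal] :
    LinearMap.det ((a • ψ).baseChange (Localization.AtPrime m)) =
      algebraMap K (Localization.AtPrime m) a ^ n *
        LinearMap.det (ψ.baseChange (Localization.AtPrime m)) := by
  have := free_localization (M := M) m
  rw [LinearMap.baseChange_smul, ← algebraMap_smul (Localization.AtPrime m) a (LinearMap.baseChange _ _),
    LinearMap.det_smul,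
    finrank_localization hrank m]

theorem apply_mem_of_mem_smul_top {n : ℕ} {I : Ideal K} (A : M →ₗ[K] (Fin n → K)) {w : M}
    (hw : w ∈ I • (⊤ : Submodule K M)) (i : Fin n) : A w i ∈ I := by
  induction hw using Submodule.smul_induction_on' with
  | smul a ha y _ =>
    rw [map_smul]
    exact I.mul_mem_right _ ha
  | add y _ z _ hy hz =>
    rw [map_add]
    exact I.add_mem hy hz

/-- The local determinant of an endomorphism, in terms of local coordinates. -/
theorem algebraMap_det_coordinates [Module.Finite K M] [Module.Projective K M] {n : ℕ}
    (hrank : ∀ p : PrimeSpectrum K, Module.rankAtStalk M p = n) (m : Ideal K) [m.IsMaximal]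
    {u : Fin n → M} {s : K} {A : M →ₗ[K] (Fin n → K)} (hA : ∀ x, ∑ k, A x k • u k = s • x)
    (ψ : M →ₗ[K] M) :
    algebraMap K (Localization.AtPrime m) (Matrix.of fun i j => A (ψ (u i)) j).det =
      algebraMap K (Localization.AtPrime m) s ^ n *
        LinearMap.det (ψ.baseChange (Localization.AtPrime m)) := by
  set F : (Fin n → K) →ₗ[K] M := Fintype.linearCombination K u with hF
  have hFa : ∀ a, F a = ∑ k, a k • u k := fun a => Fintype.linearCombination_apply K u a
  have h1 : LinearMap.det (A ∘ₗ ψ ∘ₗ F) = (Matrix.of fun i j => A (ψ (u i)) j).det := by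
    rw [← LinearMap.det_toMatrix', ← Matrix.det_transpose]
    congr 1
    ext i j
    rw [Matrix.transpose_apply, LinearMap.toMatrix'_apply]
    simp [hF]
  have hFA : F ∘ₗ A = s • LinearMap.id := LinearMap.ext fun x => (hFa _).trans (hA x)
  have h2 : F.baseChange (Localization.AtPrime m) ∘ₗ A.baseChange (Localization.AtPrime m) =
      algebraMap K (Localization.AtPrime m) s • LinearMap.id := by
    rw [← LinearMap.baseChange_comp, hFA, LinearMap.baseChange_smul, LinearMap.baseChange_id,
      algebraMap_smul]
  have := free_localization (M := M) m
  have : Nontrivial K := (algebraMap K (Localization.AtPrime m)).domain_nontrivial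
  have hn : Module.finrank (Localization.AtPrime m) (Localization.AtPrime m ⊗[K] (Fin n → K)) =
      n := by
    rw [Module.finrank_baseChange, Module.finrank_fintype_fun_eq_card, Fintype.card_fin]
  have h3 := det_comp_comp_of_comp_eq_smul ((finrank_localization hrank m).trans hn.symm) _ _ _ h2
    (ψ.baseChange (Localization.AtPrime m))
  rw [← h1, ← LinearMap.det_baseChange, LinearMap.baseChange_comp, LinearMap.baseChange_comp, h3,
    hn]

theorem semidisc_map_orthogonal (q : QuadraticForm K M) (φ : orthogonalGroup q)
    (u : Fin (2 * ν + 1) → M) :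
    semidisc q (fun i => (φ : M ≃ₗ[K] M) (u i)) = semidisc q u :=
  semidisc_semilinear (f := ((φ : M ≃ₗ[K] M) : M →ₗ[K] M)) (σ := RingHom.id K) φ.2 u

theorem exists_semidisc_notMem {q : QuadraticForm K M} (hq : IsSemiregular ν q) (m : Ideal K)
    [hm : m.IsMaximal] : ∃ u : Fin (2 * ν + 1) → M, semidisc q u ∉ m := by
  by_contra! hcon
  refine hm.ne_top (top_le_iff.1 ?_)
  rw [← hq, Ideal.span_le]
  rintro _ ⟨u, rfl⟩
  exact hcon u

theorem isUnit_algebraMap_of_notMem {m : Ideal K} [m.IsMaximal] {a : K} (ha : a ∉ m) :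
    IsUnit (algebraMap K (Localization.AtPrime m) a) :=
  IsLocalization.map_units (Localization.AtPrime m) (⟨a, ha⟩ : m.primeCompl)

/-- In local coordinates the matrix B satisfies ∑ B_ij u_j = s φ(u_i). Computing the
semidiscriminant of this family both ways, with φ preserving it, gives det(B)² = s^{2n} locally,
while det B = sⁿ det φ. -/
theorem det_baseChange_sq [Module.Finite K M] [Module.Projective K M]
    (hrank : ∀ p : PrimeSpectrum K, Module.rankAtStalk M p = 2 * ν + 1) {q : QuadraticForm K M}
    (hq : IsSemiregular ν q) (φ : orthogonalGroup q) (m : Ideal K) [m.IsMaximal] :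
    LinearMap.det (((φ : M ≃ₗ[K] M) : M →ₗ[K] M).baseChange (Localization.AtPrime m)) ^ 2 = 1 := by
  obtain ⟨u, hu⟩ := exists_semidisc_notMem hq m
  obtain ⟨s, hs, A, hA⟩ := exists_local_coordinates hrank q m hu
  set B : Matrix (Fin (2 * ν + 1)) (Fin (2 * ν + 1)) K :=
    Matrix.of fun i j => A ((φ : M ≃ₗ[K] M) (u i)) j with hB
  have h1 := algebraMap_det_coordinates hrank m hA ((φ : M ≃ₗ[K] M) : M →ₗ[K] M)
  have h2 := semidisc_mul q u B
  have h3 := semidisc_mul q (fun i => (φ : M ≃ₗ[K] M) (u i)) (s • 1)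
  have h4 : (fun i => ∑ j, B i j • u j) =
      fun i => ∑ j, (s • (1 : Matrix (Fin (2 * ν + 1)) (Fin (2 * ν + 1)) K)) i j •
        (φ : M ≃ₗ[K] M) (u j) := by
    funext i
    refine (hA _).trans ?_
    rw [Finset.sum_eq_single i]
    · simp
    · intro j _ hj
      simp [Matrix.one_apply_ne hj.symm]
    · simp
  rw [h4, h3, semidisc_map_orthogonal, Matrix.det_smul, Matrix.det_one, mul_one,
    Fintype.card_fin] at h2
  have h5 := congrArg (algebraMap K (Localization.AtPrime m)) h2
  rw [map_mul, map_mul] at h5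
  have h6 := (isUnit_algebraMap_of_notMem hu).mul_right_cancel h5
  have h7 : algebraMap K (Localization.AtPrime m) B.det = algebraMap K (Localization.AtPrime m) s ^
    (2 * ν + 1) * _ := h1
  rw [map_pow, map_pow, map_pow, h7, mul_pow] at h6
  exact ((isUnit_algebraMap_of_notMem hs).pow _ |>.pow 2).mul_left_cancel
    (h6.symm.trans (mul_one _).symm)

theorem pow_odd_sub_mem {I : Ideal K} {a : K} (ha : a * a - 1 ∈ I) (n : ℕ) :
    a ^ (2 * n + 1) - a ∈ I := by
  have h := sub_dvd_pow_sub_pow (a * a) 1 n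
  rw [one_pow, ← sq, ← pow_mul] at h
  have h1 := I.mul_mem_left a (I.mem_of_dvd h (by rwa [sq]))
  have h2 : a ^ (2 * n + 1) - a = a * (a ^ (2 * n) - 1) := by ring
  rwa [h2]

/-- The coordinate matrices of ψ and a · id agree modulo I, so det ψ ≡ aⁿ, and aⁿ ≡ a because n is
odd and a² ≡ 1. -/
theorem det_baseChange_sub_mem [Module.Finite K M] [Module.Projective K M]
    (hrank : ∀ p : PrimeSpectrum K, Module.rankAtStalk M p = 2 * ν + 1) {q : QuadraticForm K M}
    (hq : IsSemiregular ν q) {I : Ideal K} {a : K} (ha : a * a - 1 ∈ I) {ψ : M →ₗ[K] M}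
    (hψ : ∀ v, ψ v - a • v ∈ I • (⊤ : Submodule K M)) (m : Ideal K) [m.IsMaximal] :
    LinearMap.det (ψ.baseChange (Localization.AtPrime m)) -
      algebraMap K (Localization.AtPrime m) a ∈ I.map (algebraMap K (Localization.AtPrime m)) := by
  obtain ⟨u, hu⟩ := exists_semidisc_notMem hq m
  obtain ⟨s, hs, A, hA⟩ := exists_local_coordinates hrank q m hu
  have h1 := algebraMap_det_coordinates hrank m hA ψ
  have h2 := algebraMap_det_coordinates hrank m hA (a • LinearMap.id)
  rw [det_baseChange_smul hrank, LinearMap.baseChange_id, LinearMap.det_id, mul_one] at h2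
  have h3 : (Matrix.of fun i j => A (ψ (u i)) j).det -
      (Matrix.of fun i j => A ((a • LinearMap.id : M →ₗ[K] M) (u i)) j).det ∈ I := by
    rw [← Ideal.Quotient.eq, RingHom.map_det, RingHom.map_det]
    congr 1
    ext i j
    simp only [RingHom.mapMatrix_apply, Matrix.map_apply, Matrix.of_apply]
    rw [Ideal.Quotient.eq, ← Pi.sub_apply, ← map_sub]
    exact apply_mem_of_mem_smul_top A (hψ _) j
  have h4 := Ideal.mem_map_of_mem (algebraMap K (Localization.AtPrime m)) h3
  rw [map_sub, h1, h2, ← mul_sub] at h4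
  have h5 := ((Ideal.unit_mul_mem_iff_mem _
    ((isUnit_algebraMap_of_notMem hs).pow (2 * ν + 1))).1 h4)
  have h6 := Ideal.mem_map_of_mem (algebraMap K (Localization.AtPrime m)) (pow_odd_sub_mem ha ν)
  rw [map_sub, map_pow] at h6
  have h7 := Ideal.add_mem _ h5 h6
  rwa [sub_add_sub_cancel] at h7

/-- Realize M as a direct summand of a free module and extend ψ by the identity on the complement.
The determinant of the extension is global, and Sylvester's identity compares it with each local
determinant. -/
theorem exists_global_det [Module.Finite K M] [Module.Projective K M] (ψ : M →ₗ[K] M) :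
    ∃ d : K, ∀ (m : Ideal K) [m.IsMaximal],
      algebraMap K (Localization.AtPrime m) d =
        LinearMap.det (ψ.baseChange (Localization.AtPrime m)) := by
  obtain ⟨n, f, g, -, -, hfg⟩ := Module.Finite.exists_comp_eq_id_of_projective K M
  refine ⟨LinearMap.det (LinearMap.id + g ∘ₗ ((ψ - LinearMap.id) ∘ₗ f)), fun m _ => ?_⟩
  have := free_localization (M := M) m
  rw [← LinearMap.det_baseChange, LinearMap.baseChange_add, LinearMap.baseChange_id,
    LinearMap.baseChange_comp, det_one_add_comp, ← LinearMap.baseChange_comp,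
    LinearMap.comp_assoc, hfg, LinearMap.comp_id, LinearMap.baseChange_sub,
    LinearMap.baseChange_id]
  congr 1
  exact add_sub_cancel
    (LinearMap.id : Localization.AtPrime m ⊗[K] M →ₗ[Localization.AtPrime m] _) _

theorem eq_of_algebraMap_eq {a b : K}
    (h : ∀ (m : Ideal K) [m.IsMaximal], algebraMap K (Localization.AtPrime m) a =
      algebraMap K (Localization.AtPrime m) b) : a = b := by
  rw [← sub_eq_zero, ← Ideal.mem_bot]
  refine Ideal.mem_of_localization_maximal fun m hm => ?_
  rw [map_sub, h m, sub_self]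
  exact Ideal.zero_mem _

/-- The determinant of an isometry of a semiregular form of odd rank is a square root of one. -/
theorem exists_det_orthogonal [Module.Finite K M] [Module.Projective K M]
    (hrank : ∀ p : PrimeSpectrum K, Module.rankAtStalk M p = 2 * ν + 1) {q : QuadraticForm K M}
    (hq : IsSemiregular ν q) (φ : orthogonalGroup q) :
    ∃ ω : rootsOfUnity 2 K,
      (∀ (m : Ideal K) [m.IsMaximal], algebraMap K (Localization.AtPrime m) ((ω : Kˣ) : K) =
        LinearMap.det (((φ : M ≃ₗ[K] M) : M →ₗ[K] M).baseChange (Localization.AtPrime m))) ∧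
      ∀ (I : Ideal K) (a : K), a * a - 1 ∈ I →
        (∀ v, (φ : M ≃ₗ[K] M) v - a • v ∈ I • (⊤ : Submodule K M)) →
          ((ω : Kˣ) : K) - a ∈ I := by
  obtain ⟨d, hd⟩ := exists_global_det ((φ : M ≃ₗ[K] M) : M →ₗ[K] M)
  have hdd : d ^ 2 = 1 := eq_of_algebraMap_eq fun m _ => by
    rw [map_pow, hd, det_baseChange_sq hrank hq, map_one]
  refine ⟨rootsOfUnity.mkOfPowEq d hdd, fun m _ => ?_, fun I a ha hφ => ?_⟩
  · rw [rootsOfUnity.coe_mkOfPowEq, hd]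
  · rw [rootsOfUnity.coe_mkOfPowEq]
    refine Ideal.mem_of_localization_maximal fun m hm => ?_
    rw [map_sub, hd]
    exact det_baseChange_sub_mem hrank hq ha hφ m

end Det

/-! ### Transporters and scalar isometries -/

theorem mem_transporter {G : Type*} [Group G] {A B : Subgroup G} {φ : G} :
    φ ∈ transporter A B ↔ ∀ a ∈ A, φ * a * φ⁻¹ * a⁻¹ ∈ B := by
  rw [transporter, Set.mem_ofPred_eq, Subgroup.closure_le, Set.image_subset_iff]
  rfl

theorem scalarHom_apply {K M : Type*} [CommRing K] [AddCommGroup M] [Module K M]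
    (q : QuadraticForm K M) (ω : rootsOfUnity 2 K) (v : M) :
    (scalarHom q ω : M ≃ₗ[K] M) v = ((ω : Kˣ) : K) • v := rfl

theorem coe_rootsOfUnity_two_mul_self {K : Type*} [CommRing K] (ω : rootsOfUnity 2 K) :
    ((ω : Kˣ) : K) * ((ω : Kˣ) : K) = 1 := by
  rw [← sq, ← Units.val_pow_eq_pow_val, (mem_rootsOfUnity 2 (ω : Kˣ)).1 ω.2, Units.val_one]

theorem scalarHom_mul_comm {K M : Type*} [CommRing K] [AddCommGroup M] [Module K M]
    (q : QuadraticForm K M) (ω : rootsOfUnity 2 K) (φ : orthogonalGroup q) :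
    scalarHom q ω * φ = φ * scalarHom q ω := by
  refine orthogonal_ext fun v => ?_
  rw [orthogonal_mul_apply, orthogonal_mul_apply, scalarHom_apply, scalarHom_apply, map_smul]

namespace AdmissiblePair

variable {K M₀ : Type*} [CommRing K] [AddCommGroup M₀] [Module K M₀] {q₀ : QuadraticForm K M₀}
  (P : AdmissiblePair q₀)

/-! ### The induced automorphisms of the quotient -/

/-- The automorphism of `M/N` induced by an isometry. -/
def inducedEquiv (hN : ∀ (φ : orthogonalGroup (wittForm q₀)), ∀ v ∈ P.N,
    (φ : WittModule K M₀ ≃ₗ[K] WittModule K M₀) v ∈ P.N) (φ : orthogonalGroup (wittForm q₀)) :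
    P.Quot ≃ₗ[K ⧸ P.I] P.Quot where
  toFun := P.N.mapQ P.N ((φ : WittModule K M₀ ≃ₗ[K] WittModule K M₀) :
    WittModule K M₀ →ₗ[K] WittModule K M₀) (hN φ)
  invFun := P.N.mapQ P.N (((φ⁻¹ : orthogonalGroup (wittForm q₀)) :
    WittModule K M₀ ≃ₗ[K] WittModule K M₀) : WittModule K M₀ →ₗ[K] WittModule K M₀) (hN φ⁻¹)
  map_add' := map_add _
  map_smul' c x := by
    obtain ⟨a, rfl⟩ := Ideal.Quotient.mk_surjective c
    exact map_smul (P.N.mapQ P.N ((φ : WittModule K M₀ ≃ₗ[K] WittModule K M₀) :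
      WittModule K M₀ →ₗ[K] WittModule K M₀) (hN φ)) a x
  left_inv x := by
    obtain ⟨v, rfl⟩ := P.proj_surjective x
    exact congrArg P.proj (orthogonal_inv_apply φ v)
  right_inv x := by
    obtain ⟨v, rfl⟩ := P.proj_surjective x
    exact congrArg P.proj (orthogonal_apply_inv φ v)

/-- The homomorphism `ρ_N : O(M, q) → O(M/N, q_{M/N})`. -/
def inducedHom (hN : ∀ (φ : orthogonalGroup (wittForm q₀)), ∀ v ∈ P.N,
    (φ : WittModule K M₀ ≃ₗ[K] WittModule K M₀) v ∈ P.N) :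
    orthogonalGroup (wittForm q₀) →* orthogonalGroup P.quotForm where
  toFun φ := ⟨P.inducedEquiv hN φ, fun x => by
    obtain ⟨v, rfl⟩ := P.proj_surjective x
    exact congrArg (Ideal.Quotient.mk P.I) (φ.2 v)⟩
  map_one' := orthogonal_ext fun x => by
    obtain ⟨v, rfl⟩ := P.proj_surjective x
    rfl
  map_mul' a b := orthogonal_ext fun x => by
    obtain ⟨v, rfl⟩ := P.proj_surjective x
    rfl

theorem inducedHom_proj (hN : ∀ (φ : orthogonalGroup (wittForm q₀)), ∀ v ∈ P.N,
    (φ : WittModule K M₀ ≃ₗ[K] WittModule K M₀) v ∈ P.N) (φ : orthogonalGroup (wittForm q₀))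
    (v : WittModule K M₀) :
    (P.inducedHom hN φ : P.Quot ≃ₗ[K ⧸ P.I] P.Quot) (P.proj v) =
      P.proj ((φ : WittModule K M₀ ≃ₗ[K] WittModule K M₀) v) := rfl

/-- The isometries that are scalar modulo `N`. -/
def IsScalarMod (φ : orthogonalGroup (wittForm q₀)) : Prop :=
  ∃ a : K, a * a - 1 ∈ P.I ∧
    ∀ v, (φ : WittModule K M₀ ≃ₗ[K] WittModule K M₀) v - a • v ∈ P.N

theorem mem_comap_scalars_iff (hN : ∀ (φ : orthogonalGroup (wittForm q₀)), ∀ v ∈ P.N,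
    (φ : WittModule K M₀ ≃ₗ[K] WittModule K M₀) v ∈ P.N) (φ : orthogonalGroup (wittForm q₀)) :
    φ ∈ (scalars P.quotForm).comap (P.inducedHom hN) ↔ P.IsScalarMod φ := by
  rw [Subgroup.mem_comap]
  constructor
  · rintro ⟨ω, hω⟩
    obtain ⟨a, ha⟩ := Ideal.Quotient.mk_surjective (((ω : (K ⧸ P.I)ˣ) : K ⧸ P.I))
    refine ⟨a, ?_, fun v => ?_⟩
    · rw [← Ideal.Quotient.eq, map_mul, ha, map_one, coe_rootsOfUnity_two_mul_self]
    · rw [← P.proj_eq_iff, ← P.inducedHom_proj hN, ← hω, scalarHom_apply, ← ha, P.mk_smul_proj]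
  · rintro ⟨a, ha, hφ⟩
    have h1 : Ideal.Quotient.mk P.I a ^ 2 = 1 := by
      rw [sq, ← map_mul, ← map_one (Ideal.Quotient.mk P.I), Ideal.Quotient.eq]
      exact ha
    refine ⟨rootsOfUnity.mkOfPowEq _ h1, orthogonal_ext fun x => ?_⟩
    obtain ⟨v, rfl⟩ := P.proj_surjective x
    rw [scalarHom_apply, rootsOfUnity.coe_mkOfPowEq, P.mk_smul_proj, P.inducedHom_proj hN, eq_comm,
      P.proj_eq_iff]
    exact hφ v

/-! ### Transporters -/

variable {P}

theorem commutator_mem_relOrthogonal_iff {φ g : orthogonalGroup (wittForm q₀)} :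
    φ * g * φ⁻¹ * g⁻¹ ∈ P.relOrthogonal ↔
      ∀ x, (φ : WittModule K M₀ ≃ₗ[K] WittModule K M₀)
          ((g : WittModule K M₀ ≃ₗ[K] WittModule K M₀) x) -
        (g : WittModule K M₀ ≃ₗ[K] WittModule K M₀)
          ((φ : WittModule K M₀ ≃ₗ[K] WittModule K M₀) x) ∈ P.N := by
  constructor
  · intro h x
    have h1 := h ((g : WittModule K M₀ ≃ₗ[K] WittModule K M₀)
      ((φ : WittModule K M₀ ≃ₗ[K] WittModule K M₀) x))
    rwa [orthogonal_mul_apply, orthogonal_inv_apply, orthogonal_mul_apply, orthogonal_inv_apply,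
      orthogonal_mul_apply] at h1
  · intro h v
    have h1 := h (((φ⁻¹ : orthogonalGroup (wittForm q₀)) :
      WittModule K M₀ ≃ₗ[K] WittModule K M₀) (((g⁻¹ : orthogonalGroup (wittForm q₀)) :
      WittModule K M₀ ≃ₗ[K] WittModule K M₀) v))
    rwa [orthogonal_apply_inv, orthogonal_apply_inv] at h1

theorem IsScalarMod.commutator_mem (hN : ∀ (φ : orthogonalGroup (wittForm q₀)), ∀ v ∈ P.N,
    (φ : WittModule K M₀ ≃ₗ[K] WittModule K M₀) v ∈ P.N) {φ : orthogonalGroup (wittForm q₀)}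
    (hφ : P.IsScalarMod φ) (g : orthogonalGroup (wittForm q₀)) :
    φ * g * φ⁻¹ * g⁻¹ ∈ P.relOrthogonal := by
  obtain ⟨a, -, ha⟩ := hφ
  rw [commutator_mem_relOrthogonal_iff]
  intro x
  have h1 := P.N.sub_mem (ha ((g : WittModule K M₀ ≃ₗ[K] WittModule K M₀) x)) (hN g _ (ha x))
  rwa [map_sub, map_smul, sub_sub_sub_cancel_right] at h1

theorem longT_one_apply {i j : Idx} (h : i ≠ j ∧ i ≠ -j) (x : WittModule K M₀) :
    (longT q₀ i j h 1 : WittModule K M₀ ≃ₗ[K] WittModule K M₀) x =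
      x + x.1 j • hyp K M₀ i - x.1 (-i) • hyp K M₀ (-j) := by
  rw [longT_apply, eichler, one_smul, polar_hyp_left, polar_hyp_left, idx_neg_neg, wittForm_hyp,
    zero_mul, zero_smul, sub_zero]

/-- Modulo N, φ commutes with every elementary transvection. Commuting with T_{ij}(1) forces φ to
scale all e_i by one common factor, and commuting with T_1(u) extends this to M₀. -/
theorem isScalarMod_of_commutator (φ : orthogonalGroup (wittForm q₀))
    (hφ : ∀ g ∈ elementaryGroup q₀, φ * g * φ⁻¹ * g⁻¹ ∈ P.relOrthogonal) : P.IsScalarMod φ := by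
  set f := (φ : WittModule K M₀ ≃ₗ[K] WittModule K M₀) with hf
  have hc := fun g hg => commutator_mem_relOrthogonal_iff.1 (hφ g hg)
  -- T_{j,-i}(1) fixes e_j, so its displacement of φ(e_j) lies in N; the coefficient of e_j in that
  -- displacement is the coordinate in question.
  have s1 : ∀ {i j : Idx}, (i ≠ j ∧ i ≠ -j) → (f (hyp K M₀ j)).1 (-i) ∈ P.I := by
    intro i j h
    have h' : j ≠ -i ∧ j ≠ -(-i) := idx_indep_neg_right (idx_indep_symm h)
    have h1 := hc _ (longT_mem j (-i) h' 1) (hyp K M₀ j)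
    have h2 : (hyp K M₀ j).1 (-j) = 0 := by
      rw [hyp_fst_apply, if_neg (by cases j <;> decide)]
    have h3 : (hyp K M₀ j).1 (-i) = 0 := by
      rw [hyp_fst_apply, if_neg h'.1.symm]
    rw [longT_one_apply, longT_one_apply, h2, h3, zero_smul, zero_smul, add_zero, sub_zero,
      idx_neg_neg] at h1
    have h4 := P.I.neg_mem (h1.1 j)
    convert h4 using 1
    change _ = -((f (hyp K M₀ j)).1 j - ((f (hyp K M₀ j)).1 j +
      (f (hyp K M₀ j)).1 (-i) * (hyp K M₀ j).1 j - (f (hyp K M₀ j)).1 (-j) * (hyp K M₀ i).1 j))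
    rw [hyp_fst_apply, hyp_fst_apply, if_pos rfl, if_neg h.1.symm]
    ring
  have s2 : ∀ {i j : Idx}, (i ≠ j ∧ i ≠ -j) →
      f (hyp K M₀ i) - (f (hyp K M₀ j)).1 j • hyp K M₀ i ∈ P.N := by
    intro i j h
    have h1 := hc _ (longT_mem i j h 1) (hyp K M₀ j)
    have h3 : (hyp K M₀ j).1 (-i) = 0 := by
      rw [hyp_fst_apply, if_neg (idx_indep_neg_left h).1]
    rw [longT_one_apply, longT_one_apply, h3, zero_smul, sub_zero, hyp_fst_apply, if_pos rfl,
      one_smul, map_add] at h1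
    have h4 := P.N.sub_mem h1 (P.smul_mem (s1 h) (hyp K M₀ (-j)))
    convert h4 using 1
    module
  set a := (f (hyp K M₀ .p1)).1 .p1 with ha
  have s3 : (f (hyp K M₀ .p2)).1 .p2 - a ∈ P.I := by
    have h1 := (s2 (i := .p2) (j := .p1) (by decide)).1 .p2
    convert h1 using 1
    change _ = (f (hyp K M₀ .p2)).1 .p2 - a * (hyp K M₀ .p2).1 .p2
    rw [hyp_fst_apply, if_pos rfl, mul_one]
  have s4 : ∀ {i : Idx}, (i ≠ .p2 ∧ i ≠ -.p2) → f (hyp K M₀ i) - a • hyp K M₀ i ∈ P.N := by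
    intro i h
    have h1 := P.N.add_mem (s2 h) (P.smul_mem s3 (hyp K M₀ i))
    rwa [sub_smul, sub_add_sub_cancel] at h1
  have s5 : ∀ i : Idx, f (hyp K M₀ i) - a • hyp K M₀ i ∈ P.N := by
    intro i
    cases i
    · exact s2 (by decide)
    · exact s4 (by decide)
    · exact s4 (by decide)
    · exact s2 (by decide)
  have s6 : ∀ u : M₀, f (aniso K u) - a • aniso K u ∈ P.N := by
    intro u
    have h1 := hc _ (shortT_mem .p1 u) (hyp K M₀ .p1)
    have h2 : (shortT q₀ .p1 u : WittModule K M₀ ≃ₗ[K] WittModule K M₀)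
        (f (hyp K M₀ .p1) - a • hyp K M₀ .p1) ∈ P.N := by
      have h3 := s5 .p1
      set n := f (hyp K M₀ .p1) - a • hyp K M₀ .p1
      rw [shortT_apply, eichler, polar_hyp_left, polar_aniso_left, idx_neg_neg]
      refine P.N.sub_mem (P.N.sub_mem (P.N.add_mem h3 (P.smul_mem (h3.1 _) _))
        (P.smul_mem (P.polar_mem _ _ h3.2) _)) (P.smul_mem (P.I.mul_mem_left _ (h3.1 _)) _)
    have h3 := P.N.add_mem (P.N.sub_mem (P.N.add_mem h1 h2) (s5 .p1))
      (P.N.smul_mem (q₀ u) (s5 (-.p1)))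
    rw [map_sub, map_smul, shortT_hyp] at h3
    convert h3 using 1
    rw [← hf, map_sub, map_add, map_smul]
    module
  have s7 : ∀ v, f v - a • v ∈ P.N := by
    intro v
    have h := witt_decomp (i := .p1) (j := .p2) (by decide) v
    have h1 := P.N.add_mem (P.N.add_mem (P.N.add_mem (P.N.add_mem
      (P.N.smul_mem (v.1 .p1) (s5 .p1)) (P.N.smul_mem (v.1 (-.p1)) (s5 (-.p1))))
      (P.N.smul_mem (v.1 .p2) (s5 .p2))) (P.N.smul_mem (v.1 (-.p2)) (s5 (-.p2)))) (s6 v.2)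
    have h2 := congrArg f h
    simp only [map_add, map_smul] at h2
    rw [h2]
    have h3 := congrArg (fun w => a • w) h
    refine (congrArg (· ∈ P.N) ?_).mp h1
    rw [h3]
    module
  refine ⟨a, ?_, s7⟩
  -- A vector with q(v) = 1: comparing q(φv) = 1 with q(av) = a² modulo I gives a² ≡ 1.
  set v := hyp K M₀ .p1 + hyp K M₀ (-.p1) with hv
  have h1 := P.wittForm_sub_mem (s7 v)
  have h2 : wittForm q₀ v = 1 := by
    rw [hv, QuadraticMap.map_add (wittForm q₀), wittForm_hyp, wittForm_hyp, polar_hyp_left,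
      hyp_fst_apply, if_pos rfl, zero_add, zero_add]
  have h3 : wittForm q₀ (f v) = wittForm q₀ v := φ.2 v
  rw [h3, QuadraticMap.map_smul, h2, smul_eq_mul, mul_one] at h1
  have h4 := P.I.neg_mem h1
  rwa [neg_sub] at h4

theorem relElementary_le_relOrthogonal (hN : ∀ (φ : orthogonalGroup (wittForm q₀)), ∀ v ∈ P.N,
    (φ : WittModule K M₀ ≃ₗ[K] WittModule K M₀) v ∈ P.N) :
    P.relElementary ≤ P.relOrthogonal := by
  unfold relElementary
  rw [Subgroup.closure_le]
  rintro _ ⟨g, -, x, hx, rfl⟩ v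
  obtain ⟨k, w, hw, hxw⟩ := exists_isRootVector hx
  have h1 : ∀ p, (x : WittModule K M₀ ≃ₗ[K] WittModule K M₀) p - p ∈ P.N := by
    intro p
    have h2 : QuadraticMap.polar (wittForm q₀) w p ∈ P.I := by
      rw [polar_wittForm, QuadraticMap.polar_comm]
      have h3 := fun i j => P.I.mul_mem_right (p.1 j) (hw.mem.1 i)
      exact P.I.add_mem (P.I.add_mem (P.polar_mem _ _ hw.mem.2) (P.I.add_mem (h3 _ _) (h3 _ _)))
        (P.I.add_mem (h3 _ _) (h3 _ _))
    have h3 : wittForm q₀ w ∈ P.I := by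
      have h4 := P.wittForm_sub_mem (v := w) (w := 0) (by rw [sub_zero]; exact hw.mem)
      rwa [QuadraticMap.map_zero, sub_zero] at h4
    have h5 : ∀ a b c : WittModule K M₀, p + a - b - c - p = a - (b + c) := fun a b c => by abel
    rw [hxw, eichler, h5]
    exact P.N.sub_mem (P.N.smul_mem _ hw.mem) (P.N.add_mem (P.smul_mem h2 _)
      (P.smul_mem (P.I.mul_mem_right _ h3) _))
  have h2 := hN g _ (h1 (((g⁻¹ : orthogonalGroup (wittForm q₀)) :
    WittModule K M₀ ≃ₗ[K] WittModule K M₀) v))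
  rwa [map_sub, orthogonal_apply_inv] at h2

/-! ### The direct product decomposition -/

/-- The condition N₀ = M₀I means N = IM. This is what makes the determinant congruence applicable,
since coordinates of vectors in a larger N need not lie in I. -/
theorem mem_smul_top_of_eq (hP : P.N₀ = P.I • (⊤ : Submodule K M₀)) {v : WittModule K M₀}
    (hv : v ∈ P.N) : v ∈ P.I • (⊤ : Submodule K (WittModule K M₀)) := by
  have h1 : ∀ i, v.1 i • hyp K M₀ i ∈ P.I • (⊤ : Submodule K (WittModule K M₀)) := fun i =>
    Submodule.smul_mem_smul (hv.1 i) Submodule.mem_top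
  have h2 : aniso K v.2 ∈ P.I • (⊤ : Submodule K (WittModule K M₀)) := by
    have h3 : v.2 ∈ P.I • (⊤ : Submodule K M₀) := hP ▸ hv.2
    have h4 := Submodule.mem_map_of_mem (f := LinearMap.inr K (Idx → K) M₀) h3
    rw [Submodule.map_smul''] at h4
    exact Submodule.smul_mono le_rfl le_top h4
  rw [witt_decomp (i := .p1) (j := .p2) (by decide) v]
  exact Submodule.add_mem _ (Submodule.add_mem _ (Submodule.add_mem _ (Submodule.add_mem _
    (h1 _) (h1 _)) (h1 _)) (h1 _)) h2

theorem isScalarMod_scalarHom_mul (ω : rootsOfUnity 2 K) {σ : orthogonalGroup (wittForm q₀)}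
    (hσ : σ ∈ P.relOrthogonal) : P.IsScalarMod (scalarHom (wittForm q₀) ω * σ) := by
  refine ⟨((ω : Kˣ) : K), ?_, fun v => ?_⟩
  · rw [coe_rootsOfUnity_two_mul_self, sub_self]
    exact P.I.zero_mem
  · rw [orthogonal_mul_apply, scalarHom_apply, ← smul_sub]
    exact P.N.smul_mem _ (hσ v)

end AdmissiblePair

section Product

variable {K M : Type*} [CommRing K] [AddCommGroup M] [Module K M] {ν : ℕ}

/-- In odd rank the scalar ω has determinant ω, so the determinant recovers the scalar factor. -/
theorem det_baseChange_scalarHom_mul [Module.Finite K M] [Module.Projective K M]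
    (hrank : ∀ p : PrimeSpectrum K, Module.rankAtStalk M p = 2 * ν + 1) (q : QuadraticForm K M)
    (ω : rootsOfUnity 2 K) (σ : orthogonalGroup q) (m : Ideal K) [m.IsMaximal] :
    LinearMap.det ((((scalarHom q ω * σ : orthogonalGroup q) : M ≃ₗ[K] M) :
      M →ₗ[K] M).baseChange (Localization.AtPrime m)) =
      algebraMap K (Localization.AtPrime m) ((ω : Kˣ) : K) *
        LinearMap.det (((σ : M ≃ₗ[K] M) : M →ₗ[K] M).baseChange (Localization.AtPrime m)) := by
  have h1 : (((scalarHom q ω * σ : orthogonalGroup q) : M ≃ₗ[K] M) : M →ₗ[K] M) =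
      ((ω : Kˣ) : K) • ((σ : M ≃ₗ[K] M) : M →ₗ[K] M) := rfl
  rw [h1, det_baseChange_smul hrank, ← map_pow]
  congr 2
  rw [pow_succ, pow_mul, sq, coe_rootsOfUnity_two_mul_self, one_pow, one_mul]

end Product

theorem AdmissiblePair.exists_mulEquiv {K M₀ : Type*} [CommRing K] [AddCommGroup M₀] [Module K M₀]
    [Module.Finite K M₀] [Module.Projective K M₀] {ν : ℕ}
    (hrank : ∀ p : PrimeSpectrum K, Module.rankAtStalk M₀ p = 2 * ν + 1)
    {q₀ : QuadraticForm K M₀} (hq₀ : IsSemiregular ν q₀) (P : AdmissiblePair q₀)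
    (hP : P.N₀ = P.I • (⊤ : Submodule K M₀)) (C : Subgroup (orthogonalGroup (wittForm q₀)))
    (hC : ∀ φ, φ ∈ C ↔ P.IsScalarMod φ) :
    ∃ e : rootsOfUnity 2 K × P.relSpecialOrthogonal ≃* C,
      ∀ (ω : rootsOfUnity 2 K) (σ : P.relSpecialOrthogonal),
        (e (ω, σ) : orthogonalGroup (wittForm q₀)) = scalarHom (wittForm q₀) ω * σ := by
  have hr := rankAtStalk_wittModule hrank
  let f : rootsOfUnity 2 K × P.relSpecialOrthogonal →* C :=
    { toFun := fun x => ⟨scalarHom (wittForm q₀) x.1 * x.2,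
        (hC _).2 (isScalarMod_scalarHom_mul x.1 x.2.2.2)⟩
      map_one' := Subtype.ext (by simp)
      map_mul' := fun x y => Subtype.ext (by
        change scalarHom (wittForm q₀) (x.1 * y.1) * ((x.2 : orthogonalGroup (wittForm q₀)) * y.2) =
          (scalarHom (wittForm q₀) x.1 * x.2) * (scalarHom (wittForm q₀) y.1 * y.2)
        rw [map_mul, mul_assoc, mul_assoc, ← mul_assoc _ (x.2 : orthogonalGroup (wittForm q₀)),
          scalarHom_mul_comm _ y.1, mul_assoc]) }
  have hinj : Function.Injective f := by
    rw [injective_iff_map_eq_one]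
    rintro ⟨ω, σ⟩ h
    have h1 : scalarHom (wittForm q₀) ω * (σ : orthogonalGroup (wittForm q₀)) = 1 :=
      congrArg Subtype.val h
    have hω : ω = 1 := by
      refine Subtype.ext (Units.ext (eq_of_algebraMap_eq fun m _ => ?_))
      have h2 := det_baseChange_scalarHom_mul hr (wittForm q₀) ω σ m
      rw [h1, σ.2.1 m, mul_one] at h2
      have h3 : (((1 : orthogonalGroup (wittForm q₀)) :
          WittModule K M₀ ≃ₗ[K] WittModule K M₀) : WittModule K M₀ →ₗ[K] WittModule K M₀) =
          LinearMap.id := rfl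
      rw [h3, LinearMap.baseChange_id, LinearMap.det_id] at h2
      rw [← h2]
      exact (map_one _).symm
    rw [hω, map_one, one_mul] at h1
    exact Prod.ext hω (Subtype.ext h1)
  have hsurj : Function.Surjective f := by
    rintro ⟨φ, hφ⟩
    obtain ⟨a, ha, hφa⟩ := (hC φ).1 hφ
    -- The scalar factor must be ω = det φ. Since ω ≡ a modulo I, the remaining factor ωφ is ω² = 1
    -- modulo N and has determinant ω² = 1.
    obtain ⟨ω, hω, hωI⟩ := exists_det_orthogonal hr hq₀.wittForm φ
    have hωa := hωI P.I a ha fun v => mem_smul_top_of_eq hP (hφa v)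
    have hωω : scalarHom (wittForm q₀) ω * scalarHom (wittForm q₀) ω = 1 := by
      refine orthogonal_ext fun v => ?_
      rw [orthogonal_mul_apply, scalarHom_apply, scalarHom_apply, smul_smul,
        coe_rootsOfUnity_two_mul_self, one_smul, orthogonal_one_apply]
    refine ⟨(ω, ⟨scalarHom (wittForm q₀) ω * φ, fun m _ => ?_, fun v => ?_⟩), Subtype.ext ?_⟩
    · rw [det_baseChange_scalarHom_mul hr, ← hω, ← map_mul, coe_rootsOfUnity_two_mul_self, map_one]
    · have h1 := P.N.smul_mem ((ω : Kˣ) : K) (P.N.sub_mem (hφa v) (P.smul_mem hωa v))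
      rw [orthogonal_mul_apply, scalarHom_apply]
      have h2 : v = (((ω : Kˣ) : K) * ((ω : Kˣ) : K)) • v := by
        rw [coe_rootsOfUnity_two_mul_self, one_smul]
      convert h1 using 1
      refine (congrArg (fun w => ((ω : Kˣ) : K) •
        (φ : WittModule K M₀ ≃ₗ[K] WittModule K M₀) v - w) h2).trans ?_
      module
    · change scalarHom (wittForm q₀) ω * (scalarHom (wittForm q₀) ω * φ) = φ
      rw [← mul_assoc, hωω, one_mul]
  exact ⟨MulEquiv.ofBijective f ⟨hinj, hsurj⟩, fun _ _ => rfl⟩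

end OddOrthogonal

theorem mainTheorem4 {K M₀ : Type*} [CommRing K] [AddCommGroup M₀] [Module K M₀]
    [Module.Finite K M₀] [Module.Projective K M₀] (ν : ℕ)
    (hrank : ∀ p : PrimeSpectrum K, Module.rankAtStalk M₀ p = 2 * ν + 1)
    (q₀ : QuadraticForm K M₀) (hq₀ : IsSemiregular ν q₀) (P : AdmissiblePair q₀) :
    ∃ ρ : orthogonalGroup (wittForm q₀) →* orthogonalGroup P.quotForm,
      (∀ (φ : orthogonalGroup (wittForm q₀)) (v : WittModule K M₀),
        (ρ φ : P.Quot ≃ₗ[K ⧸ P.I] P.Quot) (P.proj v) =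
          P.proj ((φ : WittModule K M₀ ≃ₗ[K] WittModule K M₀) v)) ∧
      transporter (elementaryGroup q₀) P.relOrthogonal =
        ((scalars P.quotForm).comap ρ : Set (orthogonalGroup (wittForm q₀))) ∧
      transporter (⊤ : Subgroup (orthogonalGroup (wittForm q₀))) P.relOrthogonal =
        ((scalars P.quotForm).comap ρ : Set (orthogonalGroup (wittForm q₀))) ∧
      transporter (elementaryGroup q₀) P.relElementary =
        ((scalars P.quotForm).comap ρ : Set (orthogonalGroup (wittForm q₀))) ∧
      (P.N₀ = P.I • (⊤ : Submodule K M₀) →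
        ∃ e : rootsOfUnity 2 K × P.relSpecialOrthogonal ≃* (scalars P.quotForm).comap ρ,
          ∀ (ω : rootsOfUnity 2 K) (σ : P.relSpecialOrthogonal),
            (e (ω, σ) : orthogonalGroup (wittForm q₀)) = scalarHom (wittForm q₀) ω * σ) := by
  have hN := P.orthogonal_apply_mem hrank hq₀
  have hC := P.mem_comap_scalars_iff hN
  refine ⟨P.inducedHom hN, P.inducedHom_proj hN, ?_, ?_, ?_, fun hP =>
    P.exists_mulEquiv hrank hq₀ hP _ hC⟩
  · ext φ
    rw [SetLike.mem_coe, hC, mem_transporter]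
    exact ⟨AdmissiblePair.isScalarMod_of_commutator φ, fun h g _ => h.commutator_mem hN g⟩
  · ext φ
    rw [SetLike.mem_coe, hC, mem_transporter]
    exact ⟨fun h => AdmissiblePair.isScalarMod_of_commutator φ fun g _ => h g (Subgroup.mem_top g),
      fun h g _ => h.commutator_mem hN g⟩
  · ext φ
    rw [SetLike.mem_coe, hC, mem_transporter]
    -- One inclusion only needs that the relative elementary group acts trivially modulo N; the
    -- other is the commutator formula obtained from the double.
    refine ⟨fun h => AdmissiblePair.isScalarMod_of_commutator φ fun g hg =>
      AdmissiblePair.relElementary_le_relOrthogonal hN (h g hg), ?_⟩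
    rintro ⟨a, ha, hφ⟩ g hg
    exact AdmissiblePair.commutator_elementary_mem hq₀.span_range hN ha hφ hg
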